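/- **Setting.** Let $(P,\pi,M,S)$ be a smooth principal fibre bundle with compact structure group $S$, with fibres $F_x=\pi^{-1}(x)$, and let $\mathcal A$ be the set of smooth connections on $P$. Let $G$ be a Lie group that acts smoothly on $P$ from the left by bundle automorphisms, $\theta\colon G\times P\to P$, $\theta(g,p\cdot s)=\theta(g,p)\cdot s$; write $gp=\theta(g,p)$, and $g\cdot\pi(p)=\pi(gp)$ for the induced action on $M$. Then $\phi(g,\omega)=\theta_{g^{-1}}^*\omega$ is a left action of $G$ on $\mathcal A$. Let $k\in\mathbb N_{\ge1}\cup\{\infty,\omega\}$ (with $M$ a $C^k$-manifold) and let $\mathcal P$ be a set of $C^k$-paths in $M$ (maps $\gamma\colon[a,b]\to M$, $a<b$, piecewise of class $C^k$) which is stable under inversion ($\gamma^{-1}(t)=\gamma(a+b-t)$) and decomposition (restriction to the intervals of a subdivision of $[a,b]$). For $\omega\in\mathcal A$ let $\mathcal P^\omega_\gamma\colon F_{\gamma(a)}\to F_{\gamma(b)}$ be the parallel transport along $\gamma$, and write $\gamma\sim\gamma'$ if $\gamma,\gamma'$ have the same end points and $\mathcal P_\gamma^\omega=\mathcal P_{\gamma'}^\omega$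 for all $\omega\in\mathcal A$. Fix $\nu_m\in F_m$ for each $m\in M$, and let $h_\gamma^\nu(\omega)\in S$ be defined by $\mathcal P_\gamma^\omega(\nu_{\gamma(a)})=\nu_{\gamma(b)}\cdot h_\gamma^\nu(\omega)$. - $\mathcal P$ is *$G$-invariant* if $g\gamma\in\mathcal P$ for all $g\in G$, $\gamma\in\mathcal P$, where $(g\gamma)(t)=g\cdot\gamma(t)$. - $\mathcal P$ is *independent* if for each finite $\{\gamma_1,\dots,\gamma_l\}\subseteq\mathcal P$ there is a finite $\{\delta_1,\dots,\delta_n\}\subseteq\mathcal P$ such that each $\gamma_j$ has a decomposition each of whose pieces is equivalent to some $\delta_r$ or $\delta_r^{-1}$, and such that for all $s_1,\dots,s_n\in S$ there is $\omega\in\mathcal A$ with $h^\nu_{\delta_i}(\omega)=s_i$ for all $i$. - A *homomorphism of paths* $\mathfrak h\in\mathrm{Hom}(\mathcal P,\mathrm{Iso}_F)$ assigns to each $\gamma\in\mathcal P$, $\gamma\colon[a,b]\to M$, an $S$-equivariant map $\mathfrak h(\gamma)\colon F_{\gamma(a)}\to F_{\gamma(b)}$ such that $\mathfrak h(\gamma)=\mathrm{id}$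 if $\gamma$ is constant, $\mathfrak h(\gamma)=\mathfrak h(\gamma_{n-1})\circ\dots\circ\mathfrak h(\gamma_0)$ for each decomposition $(\gamma_i)_{0\le i<n}$ of $\gamma$, $\mathfrak h(\gamma^{-1})=\mathfrak h(\gamma)^{-1}$, and $\mathfrak h(\gamma)=\mathfrak h(\gamma')$ if $\gamma\sim\gamma'$. - Let $\overline{\mathrm{Cyl}}$ be the unital $C^*$-subalgebra of the bounded functions on $\mathcal A$ generated by all $\rho_{ij}\circ h^\nu_\gamma$, where $\gamma\in\mathcal P$ and $\rho_{ij}$ are the entries of an irreducible matrix representation $\rho$ of $S$. The *generalized connections* are the elements of the spectrum $\overline{\mathcal A}$ of $\overline{\mathrm{Cyl}}$; let $\iota\colon\mathcal A\to\overline{\mathcal A}$ be given by evaluation. A generalized connection $\overline\omega$ is *$G$-invariant* if $\Phi(g,\overline\omega):=\overline\omega\circ\phi_g^*=\overline\omega$ for all $g\in G$. To $\overline\omega$ corresponds $\kappa(\overline\omega)\in\mathrm{Hom}(\mathcal P,\mathrm{Iso}_F)$, $\kappa(\overline\omega)(\gamma)(p)=\lim_\alpha\mathcal P^{\omega_\alpha}_\gamma(p)$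 for any net $(\omega_\alpha)$ in $\mathcal A$ with $\iota(\omega_\alpha)\to\overline\omega$. Let $\mathrm{Hom}_G(\mathcal P,\mathrm{Iso}_F)$ be the image under $\kappa$ of the set of $G$-invariant generalized connections. **Lemma.** 1. Let $\mathcal P$ be $G$-invariant and independent, and let $\mathfrak h\in\mathrm{Hom}(\mathcal P,\mathrm{Iso}_F)$. Then $\mathfrak h\in\mathrm{Hom}_G(\mathcal P,\mathrm{Iso}_F)$ if and only if $$\mathfrak h(g\gamma)(gp)=\theta\big(g,\mathfrak h(\gamma)(p)\big)\qquad\text{for all } g\in G,\ \gamma\in\mathcal P,\ p\in F_{\gamma(a)},\quad \mathrm{dom}\,\gamma=[a,b].$$ 2. (Homogeneous isotropic loop quantum cosmology.) Let $P=\mathbb R^3\times SU(2)$ be the trivial bundle over $\mathbb R^3$. Let $\mu(v)=v^1\tau_1+v^2\tau_2+v^3\tau_3\in\mathfrak{su}(2)$ with $\tau_1=\begin{pmatrix}0&-i\\-i&0\end{pmatrix}$, $\tau_2=\begin{pmatrix}0&-1\\1&0\end{pmatrix}$, $\tau_3=\begin{pmatrix}-i&0\\0&i\end{pmatrix}$,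 and $\sigma(v)=\mu^{-1}(\sigma\mu(v)\sigma^{-1})$ for $\sigma\in SU(2)$, $v\in\mathbb R^3$. Let $E=\mathbb R^3\rtimes SU(2)$, with $(v,\sigma)(v',\sigma')=(v+\sigma(v'),\sigma\sigma')$, act on $P$ by $\theta((v,\sigma),(x,s))=(v+\sigma(x),\sigma s)$. Let $\mathcal P$ be $E$-invariant and independent. Let $\mathrm{Hom}(\mathcal P,SU(2))$ be the set of maps $\mathfrak h\colon\mathcal P\to SU(2)$ with $\mathfrak h(\gamma)=\mathfrak h(\gamma_{n-1})\cdots\mathfrak h(\gamma_0)$ for each decomposition of $\gamma$, $\mathfrak h(\gamma^{-1})=\mathfrak h(\gamma)^{-1}$, and $\mathfrak h(\gamma)=\mathfrak h(\gamma')$ if $\gamma\sim\gamma'$, and let $\mathrm{Hom}_E(\mathcal P,SU(2))$ be the image of $\mathrm{Hom}_E(\mathcal P,\mathrm{Iso}_F)$ under $\Omega(\mathfrak h)(\gamma)=\mathrm{pr}_2\big(\mathfrak h(\gamma)(\gamma(a),e)\big)$. Then $\mathfrak h\in\mathrm{Hom}(\mathcal P,SU(2))$ lies in $\mathrm{Hom}_E(\mathcal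 P,SU(2))$ if and only if $$\mathfrak h(v+\sigma(\gamma))=\alpha_\sigma(\mathfrak h(\gamma))=\sigma\,\mathfrak h(\gamma)\,\sigma^{-1}\qquad\text{for all }(v,\sigma)\in E,\ \gamma\in\mathcal P.$$ -/

import Mathlib

open scoped Manifold ContDiff Matrix BoundedContinuousFunction
open Set Filter Topology

/-! ### Curves -/

/-- A map `γ : [a,b] → M` with `a < b`.  (Continuity is part of `IsPath` below.) -/
@[ext]
structure Curve (M : Type*) where
  a : ℝ
  b : ℝ
  lt : a < b
  toFun : Icc a b → M

namespace Curve

variable {M N : Type*}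

/-- The starting point `γ(a)`. -/
def startPoint (γ : Curve M) : M := γ.toFun ⟨γ.a, le_rfl, γ.lt.le⟩

/-- The end point `γ(b)`. -/
def endPoint (γ : Curve M) : M := γ.toFun ⟨γ.b, γ.lt.le, le_rfl⟩

/-- The extension of `γ` to `ℝ` that is constant on both sides of `[a,b]`. -/
noncomputable def extend (γ : Curve M) : ℝ → M := IccExtend γ.lt.le γ.toFun

/-- The inverse curve `t ↦ γ(b + a - t)`. -/
def inv (γ : Curve M) : Curve M where
  a := γ.a
  b := γ.b
  lt := γ.lt
  toFun t := γ.toFun ⟨γ.b + γ.a - t, by linarith [t.2.2], by linarith [t.2.1]⟩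

/-- The curve `t ↦ f (γ(t))`. -/
def map (f : M → N) (γ : Curve M) : Curve N where
  a := γ.a
  b := γ.b
  lt := γ.lt
  toFun t := f (γ.toFun t)

/-- The restriction `γ|_[c,d]`. -/
def restrict (γ : Curve M) (c d : ℝ) (hc : γ.a ≤ c) (hcd : c < d) (hd : d ≤ γ.b) : Curve M where
  a := c
  b := d
  lt := hcd
  toFun t := γ.toFun ⟨t, hc.trans t.2.1, t.2.2.trans hd⟩

/-- A subdivision `a = τ₀ < ⋯ < τₙ = b` of the domain of `γ`. -/
structure Subdivision (γ : Curve M) where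
  n : ℕ
  τ : Fin (n + 1) → ℝ
  strictMono : StrictMono τ
  first : τ 0 = γ.a
  last : τ (Fin.last n) = γ.b

/-- The decomposition of `γ` given by a subdivision: `γᵢ = γ|_[τᵢ, τᵢ₊₁]`. -/
def piece (γ : Curve M) (D : γ.Subdivision) (i : Fin D.n) : Curve M :=
  γ.restrict (D.τ i.castSucc) (D.τ i.succ)
    (D.first ▸ D.strictMono.monotone (Fin.zero_le _))
    (D.strictMono Fin.castSucc_lt_succ)
    (D.last ▸ D.strictMono.monotone (Fin.le_last _))

/-- `γ` is constant. -/
def IsConst (γ : Curve M) : Prop := ∀ t, γ.toFun t = γ.startPoint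

theorem startPoint_inv (γ : Curve M) : γ.inv.startPoint = γ.endPoint := by
  simp [startPoint, endPoint, inv]

theorem startPoint_map (f : M → N) (γ : Curve M) : (γ.map f).startPoint = f γ.startPoint := rfl

theorem endPoint_inv (γ : Curve M) : γ.inv.endPoint = γ.startPoint := by
  simp [startPoint, endPoint, inv]

/-- The set of paths `Γ` is stable under inversion and decomposition of its elements. -/
def IsStable (Γ : Set (Curve M)) : Prop :=
  (∀ γ ∈ Γ, γ.inv ∈ Γ) ∧ ∀ γ ∈ Γ, ∀ (D : γ.Subdivision) (i : Fin D.n), γ.piece D i ∈ Γ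

section Regularity

variable {E H : Type*} [NormedAddCommGroup E] [NormedSpace ℝ E] [TopologicalSpace H]
  (I : ModelWithCorners ℝ E H) [TopologicalSpace M] [ChartedSpace H M]

/-- `γ` is of class `C^k`: it is the restriction of a `C^k` map on an open interval that
contains `[a,b]`. -/
def IsClass (k : ℕ∞ω) (γ : Curve M) : Prop :=
  ∃ (c d : ℝ) (f : ℝ → M), c < γ.a ∧ γ.b < d ∧ ContMDiffOn 𝓘(ℝ, ℝ) I k f (Ioo c d) ∧
    ∀ t : Icc γ.a γ.b, f t = γ.toFun t

/-- `γ` is a `C^k`-path, i.e. piecewise of class `C^k`.  The pieces are restrictions to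
closed intervals, so that a `C^k`-path is continuous. -/
def IsPath (k : ℕ∞ω) (γ : Curve M) : Prop :=
  ∃ D : γ.Subdivision, ∀ i, (γ.piece D i).IsClass I k

end Regularity

end Curve

/-! ### Principal fibre bundles -/

/-- An irreducible (continuous, complex) matrix representation of `S`. -/
structure IrrepMatrix (S : Type*) [TopologicalSpace S] [Group S] (n : ℕ) where
  ρ : S →* Matrix (Fin n) (Fin n) ℂ
  continuous : Continuous ρ
  pos : 0 < n
  irreducible : ∀ W : Submodule ℂ (Fin n → ℂ), (∀ s, ∀ w ∈ W, ρ s *ᵥ w ∈ W) → W = ⊥ ∨ W = ⊤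

section Bundle

variable {EP HP EM HM ES HS : Type*}
  [NormedAddCommGroup EP] [NormedSpace ℝ EP] [TopologicalSpace HP]
  [NormedAddCommGroup EM] [NormedSpace ℝ EM] [TopologicalSpace HM]
  [NormedAddCommGroup ES] [NormedSpace ℝ ES] [TopologicalSpace HS]

/-- A principal fibre bundle `(P, π, M, S)`: the smooth surjection `proj`, the smooth right action
`act` of `S` on `P` that preserves the fibres of `proj` and is simply transitive on each of them, and
equivariant local trivializations. -/
structure PrincipalBundle (IP : ModelWithCorners ℝ EP HP) (IM : ModelWithCorners ℝ EM HM)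
    (IS : ModelWithCorners ℝ ES HS) (P M S : Type*)
    [TopologicalSpace P] [ChartedSpace HP P] [TopologicalSpace M] [ChartedSpace HM M]
    [TopologicalSpace S] [ChartedSpace HS S] [Group S] where
  proj : P → M
  proj_surjective : Function.Surjective proj
  contMDiff_proj : ContMDiff IP IM ∞ proj
  act : P → S → P
  act_one : ∀ p, act p 1 = p
  act_mul : ∀ p s t, act p (s * t) = act (act p s) t
  contMDiff_act : ContMDiff (IP.prod IS) IP ∞ fun x : P × S => act x.1 x.2
  proj_act : ∀ p s, proj (act p s) = proj p
  existsUnique_act : ∀ p q, proj p = proj q → ∃! s, q = act p s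
  locallyTrivial : ∀ m : M, ∃ (U : Set M) (φ : OpenPartialHomeomorph P (M × S)),
    IsOpen U ∧ m ∈ U ∧ φ.source = proj ⁻¹' U ∧ φ.target = U ×ˢ univ ∧
    ContMDiffOn IP (IM.prod IS) ∞ φ φ.source ∧
    ContMDiffOn (IM.prod IS) IP ∞ φ.symm φ.target ∧
    ∀ p ∈ φ.source, ∀ s, φ (act p s) = (proj p, (φ p).2 * s)

variable {IP : ModelWithCorners ℝ EP HP} {IM : ModelWithCorners ℝ EM HM}
  {IS : ModelWithCorners ℝ ES HS} {P M S : Type*}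
  [TopologicalSpace P] [ChartedSpace HP P] [TopologicalSpace M] [ChartedSpace HM M]
  [TopologicalSpace S] [ChartedSpace HS S] [Group S]

/-- `Ad(s)`, the differential at the unit of `h ↦ s h s⁻¹`. -/
noncomputable def adjointMap (IS : ModelWithCorners ℝ ES HS) (s : S) :
    GroupLieAlgebra IS S →L[ℝ] GroupLieAlgebra IS S :=
  (mfderiv IS IS (fun h : S => s * h * s⁻¹) 1 : ES →L[ℝ] ES)

namespace PrincipalBundle

variable (B : PrincipalBundle IP IM IS P M S)

/-- The fibre `F_x = π⁻¹(x)`. -/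
abbrev Fibre (x : M) : Type _ := {p : P // B.proj p = x}

/-- The differential `d_p R_s` of the right translation by `s`. -/
noncomputable def dAct (p : P) (s : S) : TangentSpace IP p →L[ℝ] TangentSpace IP (B.act p s) :=
  mfderiv IP IP (fun q => B.act q s) p

/-- The value at `p` of the fundamental vector field of `v ∈ 𝔰`, i.e. the derivative at the unit
of `s ↦ p · s` in the direction `v`. -/
noncomputable def fundamental (p : P) (v : GroupLieAlgebra IS S) : TangentSpace IP p :=
  (mfderiv IS IP (fun s => B.act p s) 1 : ES →L[ℝ] EP) v

theorem proj_act_eq {x : M} (p : B.Fibre x) (s : S) : B.proj (B.act p s) = x :=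
  (B.proj_act _ _).trans p.2

/-- The morphisms `F_x → F_y` between two fibres. -/
structure FibreMorphism (x y : M) where
  toFun : B.Fibre x → B.Fibre y
  map_act : ∀ (p : B.Fibre x) (s : S),
    (toFun ⟨B.act p s, B.proj_act_eq p s⟩ : P) = B.act (toFun p) s

/-- The `s ∈ S` with `q = p · s`, for `p`, `q` in the same fibre. -/
noncomputable def diff (p q : P) : S :=
  open Classical in
  if h : ∃ s, q = B.act p s then h.choose else 1

/-! ### Lie groups of automorphisms -/

variable {EG HG : Type*} [NormedAddCommGroup EG] [NormedSpace ℝ EG] [TopologicalSpace HG]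

/-- A smooth left action `θ` of `G` on `P` by automorphisms of the bundle. -/
structure AutAction (IG : ModelWithCorners ℝ EG HG) (G : Type*) [TopologicalSpace G]
    [ChartedSpace HG G] [Group G] where
  θ : G → P → P
  one_θ : ∀ p, θ 1 p = p
  mul_θ : ∀ g h p, θ (g * h) p = θ g (θ h p)
  contMDiff_θ : ContMDiff (IG.prod IP) IP ∞ fun x : G × P => θ x.1 x.2
  θ_act : ∀ g p s, θ g (B.act p s) = B.act (θ g p) s

namespace AutAction

variable {B}

variable {IG : ModelWithCorners ℝ EG HG} {G : Type*} [TopologicalSpace G] [ChartedSpace HG G]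
  [Group G] (Θ : B.AutAction IG G)

/-- The induced action on `M`, `(g, m) ↦ π(θ(g, p))` for any `p ∈ F_m`. -/
noncomputable def base (g : G) (m : M) : M :=
  B.proj (Θ.θ g (Function.surjInv B.proj_surjective m))

theorem proj_θ (g : G) (p : P) : B.proj (Θ.θ g p) = Θ.base g (B.proj p) := by
  obtain ⟨s, hs, -⟩ := B.existsUnique_act (Function.surjInv B.proj_surjective (B.proj p)) p
    (Function.surjInv_eq _ _)
  conv_lhs => rw [hs]
  rw [Θ.θ_act, B.proj_act]
  rfl

theorem proj_θ_startPoint (g : G) (γ : Curve M) (p : B.Fibre γ.startPoint) :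
    B.proj (Θ.θ g p) = (γ.map (Θ.base g)).startPoint := by
  rw [Θ.proj_θ, p.2, Curve.startPoint_map]

/-- The set of paths `Γ` is `G`-invariant. -/
def IsInvariantPaths (Γ : Set (Curve M)) : Prop :=
  ∀ g, ∀ γ ∈ Γ, γ.map (Θ.base g) ∈ Γ

theorem contMDiff_translation (g : G) : ContMDiff IP IP ∞ (Θ.θ g) :=
  Θ.contMDiff_θ.comp (contMDiff_const.prodMk contMDiff_id)

theorem mdifferentiable_translation (g : G) : MDifferentiable IP IP (Θ.θ g) :=
  (Θ.contMDiff_translation g).mdifferentiable (by simp)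

theorem mdifferentiable_act (B : PrincipalBundle IP IM IS P M S) (s : S) :
    MDifferentiable IP IP fun q => B.act q s :=
  (B.contMDiff_act.comp (contMDiff_id.prodMk contMDiff_const)).mdifferentiable (by simp)

theorem mdifferentiable_orbit (B : PrincipalBundle IP IM IS P M S) (p : P) :
    MDifferentiable IS IP fun s => B.act p s :=
  (B.contMDiff_act.comp (contMDiff_const.prodMk contMDiff_id)).mdifferentiable (by simp)

end AutAction

/-! ### Connections -/

section Connections

variable [IsManifold IP ∞ P]

/-- A connection on `P`: a smooth `𝔰`-valued 1-form `A` with `R_s^* A = Ad(s⁻¹) ∘ A` and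
`A(ṽ(p)) = v`. -/
structure Connection where
  form : ∀ p : P, TangentSpace IP p →L[ℝ] GroupLieAlgebra IS S
  contMDiff_form : ContMDiff (M' := ES) IP.tangent 𝓘(ℝ, ES) ∞
    fun v : TangentBundle IP P => form v.1 v.2
  equivariant : ∀ p s v, form (B.act p s) (B.dAct p s v) = adjointMap IS s⁻¹ (form p v)
  vertical : ∀ p v, form p (B.fundamental p v) = v

/-- Only bounded functions on the set of connections are considered, so it carries the discrete
topology; `B.Connection →ᵇ ℂ` then is the algebra of all bounded functions. -/
instance : TopologicalSpace B.Connection := ⊥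

instance : DiscreteTopology B.Connection := ⟨rfl⟩

/-! ### Parallel transport -/

variable {B} in
/-- `c` is a horizontal lift of the `C^1`-path `γ`: a lift of `γ` that, for some subdivision of the
domain, is `C^1` and horizontal on each piece. -/
def Connection.IsHorizontalLift (A : B.Connection) (γ : Curve M) (c : Curve P) : Prop :=
  c.map B.proj = γ ∧ ∃ D : c.Subdivision, ∀ i, (c.piece D i).IsClass IP 1 ∧
    ∀ t ∈ Icc (c.piece D i).a (c.piece D i).b,
      A.form ((c.piece D i).extend t)
        (mfderivWithin 𝓘(ℝ, ℝ) IP (c.piece D i).extend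
          (Icc (c.piece D i).a (c.piece D i).b) t (1 : ℝ)) = 0

variable {B} in
/-- The parallel transport `P_γ^A(p)` of `p ∈ F_{γ(a)}` along the `C^1`-path `γ`: the end point
of the horizontal lift of `γ` that starts at `p` (and `p` if there is none). -/
noncomputable def Connection.transport (A : B.Connection) (γ : Curve M) (p : P) : P :=
  open Classical in
  if h : ∃ c : Curve P, A.IsHorizontalLift γ c ∧ c.startPoint = p then h.choose.endPoint else p

/-- `γ ∼ γ'`: the two paths have the same end points and the same parallel transports. -/
def Equivalent (γ γ' : Curve M) : Prop :=
  γ.startPoint = γ'.startPoint ∧ γ.endPoint = γ'.endPoint ∧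
    ∀ (A : B.Connection) (p : P), B.proj p = γ.startPoint → A.transport γ p = A.transport γ' p

/-- `h_γ^ν(A) = ψ_{γ(b)}(P_γ^A(ν_{γ(a)}))`, where `p = ν_m · ψ_m(p)` for `p ∈ F_m`. -/
noncomputable def holonomy (ν : M → P) (γ : Curve M) (A : B.Connection) : S :=
  B.diff (ν γ.endPoint) (A.transport γ (ν γ.startPoint))

/-! ### Cylindrical functions and generalized connections -/

/-- The generators `ρᵢⱼ ∘ h_γ^ν` of the cylindrical functions. -/
def cylGenerators (ν : M → P) (Γ : Set (Curve M)) : Set (B.Connection →ᵇ ℂ) :=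
  {f | ∃ γ ∈ Γ, ∃ (n : ℕ) (r : IrrepMatrix S n) (i j : Fin n),
    ∀ A, f A = r.ρ (B.holonomy ν γ A) i j}

/-- The `C^*`-algebra of cylindrical functions of the set of paths `Γ`. -/
noncomputable def Cyl (ν : M → P) (Γ : Set (Curve M)) : StarSubalgebra ℂ (B.Connection →ᵇ ℂ) :=
  (StarAlgebra.adjoin ℂ (B.cylGenerators ν Γ)).topologicalClosure

/-- The space of generalized connections: the spectrum of the cylindrical functions. -/
abbrev GenConnection (ν : M → P) (Γ : Set (Curve M)) : Type _ :=
  WeakDual.characterSpace ℂ (B.Cyl ν Γ)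

/-- `ι(A)`, the evaluation at the connection `A`. -/
noncomputable def evalChar (ν : M → P) (Γ : Set (Curve M)) (A : B.Connection) :
    B.GenConnection ν Γ :=
  ⟨((BoundedContinuousFunction.evalCLM ℂ A).comp
      (B.Cyl ν Γ).toSubalgebra.toSubmodule.subtypeL :), by
    rw [WeakDual.CharacterSpace.eq_set_map_one_map_mul]
    exact ⟨rfl, fun x y => rfl⟩⟩

/-- The finite family `t` is a refinement of the finite family `s`. -/
def IsRefinement (s t : Finset (Curve M)) : Prop :=
  ∀ γ ∈ s, ∃ D : γ.Subdivision, ∀ i, ∃ δ ∈ t,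
    B.Equivalent (γ.piece D i) δ ∨ B.Equivalent (γ.piece D i) δ.inv

/-- The finite family `t` is independent. -/
def IsIndependentFamily (ν : M → P) (t : Finset (Curve M)) : Prop :=
  ∀ s : Curve M → S, ∃ A : B.Connection, ∀ δ ∈ t, B.holonomy ν δ A = s δ

/-- The set of paths `Γ` is independent: each finite family in `Γ` has an independent refinement
in `Γ`. -/
def IsIndependent (ν : M → P) (Γ : Set (Curve M)) : Prop :=
  ∀ s : Finset (Curve M), (s : Set (Curve M)) ⊆ Γ → ∃ t : Finset (Curve M),
    (t : Set (Curve M)) ⊆ Γ ∧ B.IsRefinement s t ∧ B.IsIndependentFamily ν t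

/-! ### Homomorphisms of paths -/

/-- The homomorphisms of paths `Hom(Γ, Iso_F)`. -/
structure PathHom (Γ : Set (Curve M)) where
  toFun : ∀ γ ∈ Γ, B.FibreMorphism γ.startPoint γ.endPoint
  map_const : ∀ (γ) (hγ : γ ∈ Γ), γ.IsConst →
    ∀ p : B.Fibre γ.startPoint, ((toFun γ hγ).toFun p : P) = p
  /-- `h(γ) = h(γₙ₋₁) ∘ ⋯ ∘ h(γ₀)` for each decomposition of `γ`: if `qᵢ₊₁ = h(γᵢ)(qᵢ)` for all
  `i < n`, then `h(γ)(q₀) = qₙ`. -/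
  map_decomposition : ∀ (γ) (hγ : γ ∈ Γ) (D : γ.Subdivision) (hD : ∀ i, γ.piece D i ∈ Γ)
    (q : Fin (D.n + 1) → P) (h0 : B.proj (q 0) = γ.startPoint),
    (∀ i : Fin D.n, ∃ hi : B.proj (q i.castSucc) = (γ.piece D i).startPoint,
      ((toFun _ (hD i)).toFun ⟨q i.castSucc, hi⟩ : P) = q i.succ) →
    ((toFun γ hγ).toFun ⟨q 0, h0⟩ : P) = q (Fin.last D.n)
  /-- `h(γ⁻¹) = h(γ)⁻¹`; since morphisms are bijective, one composition suffices. -/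
  map_inv : ∀ (γ) (hγ : γ ∈ Γ) (hi : γ.inv ∈ Γ) (p : B.Fibre γ.startPoint),
    ((toFun γ.inv hi).toFun
      ⟨(toFun γ hγ).toFun p, ((toFun γ hγ).toFun p).2.trans γ.startPoint_inv.symm⟩ : P) = p
  map_equivalent : ∀ (γ γ') (hγ : γ ∈ Γ) (hγ' : γ' ∈ Γ) (h : B.Equivalent γ γ')
    (p : B.Fibre γ.startPoint),
    ((toFun γ hγ).toFun p : P) = (toFun γ' hγ').toFun ⟨p, p.2.trans h.1⟩

variable {B}

/-- `κ(χ) = h`, i.e. `h(γ)(p) = lim P_γ^{A}(p)` as `ι(A)` tends to the generalized connection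
`χ`. -/
def IsKappa {ν : M → P} {Γ : Set (Curve M)} (χ : B.GenConnection ν Γ) (h : B.PathHom Γ) : Prop :=
  ∀ (γ) (hγ : γ ∈ Γ) (p : B.Fibre γ.startPoint),
    Tendsto (fun A : B.Connection => A.transport γ p) (comap (B.evalChar ν Γ) (𝓝 χ))
      (𝓝 ((h.toFun γ hγ).toFun p : P))

namespace AutAction

variable {EG HG : Type*} [NormedAddCommGroup EG] [NormedSpace ℝ EG] [TopologicalSpace HG]
  {IG : ModelWithCorners ℝ EG HG} {G : Type*} [TopologicalSpace G] [ChartedSpace HG G]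
  [Group G] (Θ : B.AutAction IG G)

theorem form_congr (A : B.Connection) {v w : TangentBundle IP P} (h : v = w) :
    (A.form v.1 v.2 : ES) = A.form w.1 w.2 := by rw [h]

/-- The left action `φ(g, A) = θ_{g⁻¹}^* A` on the connections. -/
noncomputable def onConnection (g : G) (A : B.Connection) : B.Connection where
  form p := (A.form (Θ.θ g⁻¹ p)).comp (mfderiv IP IP (Θ.θ g⁻¹) p)
  contMDiff_form :=
    A.contMDiff_form.comp ((Θ.contMDiff_translation g⁻¹).contMDiff_tangentMap (by simp))
  equivariant p s v := by
    have h1 : tangentMap IP IP (Θ.θ g⁻¹) (tangentMap IP IP (fun q => B.act q s) ⟨p, v⟩) =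
        tangentMap IP IP (fun q => B.act q s) (tangentMap IP IP (Θ.θ g⁻¹) ⟨p, v⟩) := by
      have e1 := congrFun (tangentMap_comp (Θ.mdifferentiable_translation g⁻¹)
        (mdifferentiable_act B s)) ⟨p, v⟩
      have e2 := congrFun (tangentMap_comp (mdifferentiable_act B s)
        (Θ.mdifferentiable_translation g⁻¹)) ⟨p, v⟩
      refine e1.symm.trans (Eq.trans ?_ e2)
      have : Θ.θ g⁻¹ ∘ (fun q => B.act q s) = (fun q => B.act q s) ∘ Θ.θ g⁻¹ :=
        funext fun q => Θ.θ_act _ _ _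
      rw [this]
    have h2 := form_congr A h1
    exact h2.trans (A.equivariant (Θ.θ g⁻¹ p) s (mfderiv IP IP (Θ.θ g⁻¹) p v))
  vertical p v := by
    have h0 : ∀ q : P, (⟨q, B.fundamental q v⟩ : TangentBundle IP P) =
        tangentMap IS IP (fun s => B.act q s) ⟨1, v⟩ := fun q => by
      refine Bundle.TotalSpace.ext (B.act_one q).symm ?_
      exact HEq.rfl
    have h1 : tangentMap IP IP (Θ.θ g⁻¹) ⟨p, B.fundamental p v⟩ =
        ⟨Θ.θ g⁻¹ p, B.fundamental (Θ.θ g⁻¹ p) v⟩ := by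
      rw [h0, h0]
      have e1 := congrFun (tangentMap_comp (Θ.mdifferentiable_translation g⁻¹)
        (mdifferentiable_orbit B p)) ⟨1, v⟩
      refine e1.symm.trans ?_
      have : Θ.θ g⁻¹ ∘ (fun s => B.act p s) = fun s => B.act (Θ.θ g⁻¹ p) s :=
        funext fun s => Θ.θ_act _ _ _
      rw [this]
    exact (form_congr A h1).trans (A.vertical _ v)

/-- The pullback `φ_g^* f = f ∘ φ_g` of bounded functions. -/
noncomputable def pullback (g : G) (f : B.Connection →ᵇ ℂ) :
    B.Connection →ᵇ ℂ :=
  f.compContinuous ⟨Θ.onConnection g, continuous_of_discreteTopology⟩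

/-- The generalized connection `χ` is `G`-invariant: `Φ(g, χ) = χ` for all `g`, where
`Φ(g, χ) = χ ∘ φ_g^*`.  It is part of the condition that `φ_g^*` maps the cylindrical functions
to themselves. -/
def IsInvariantGen {ν : M → P} {Γ : Set (Curve M)}
    (χ : B.GenConnection ν Γ) : Prop :=
  ∀ g, ∃ hg : ∀ f ∈ B.Cyl ν Γ, Θ.pullback g f ∈ B.Cyl ν Γ,
    ∀ f : B.Cyl ν Γ, χ ⟨Θ.pullback g f, hg f f.2⟩ = χ f

/-- `h ∈ Hom_G(Γ, Iso_F)`: `h` is the image under `κ` of a `G`-invariant generalized connection. -/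
def IsInvariantHom (ν : M → P) {Γ : Set (Curve M)} (h : B.PathHom Γ) : Prop :=
  ∃ χ : B.GenConnection ν Γ, Θ.IsInvariantGen χ ∧ IsKappa χ h

end AutAction

end Connections

/-! ### Trivial bundles -/

section Trivial

variable (IM IS M S) in
/-- The trivial bundle `M × S`. -/
def trivial [LieGroup IS ∞ S] : PrincipalBundle (IM.prod IS) IM IS (M × S) M S where
  proj := Prod.fst
  proj_surjective := Prod.fst_surjective
  contMDiff_proj := contMDiff_fst
  act p s := (p.1, p.2 * s)
  act_one p := by simp
  act_mul p s t := by simp [mul_assoc]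
  contMDiff_act := (contMDiff_fst.comp contMDiff_fst).prodMk
    ((contMDiff_snd.comp contMDiff_fst).mul contMDiff_snd)
  proj_act p s := rfl
  existsUnique_act p q h := by
    refine ⟨p.2⁻¹ * q.2, Prod.ext h.symm (by simp), fun s hs => ?_⟩
    simp [hs]
  locallyTrivial m := by
    refine ⟨univ, OpenPartialHomeomorph.refl _, isOpen_univ, mem_univ _, rfl, by simp, ?_, ?_, ?_⟩
    · exact contMDiffOn_id
    · exact contMDiffOn_id
    · intros; rfl

variable [LieGroup IS ∞ S] [IsManifold IM ∞ M]

variable (IM IS M S) in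
/-- The maps `Γ → S` with the algebraic properties of a homomorphism of paths of the trivial
bundle `M × S`: this is `Hom(Γ, S)`. -/
structure GroupPathHom (Γ : Set (Curve M)) where
  toFun : ∀ γ ∈ Γ, S
  /-- `h(γ) = h(γₙ₋₁) ⋯ h(γ₀)` for each decomposition of `γ`. -/
  map_decomposition : ∀ (γ) (hγ : γ ∈ Γ) (D : γ.Subdivision) (hD : ∀ i, γ.piece D i ∈ Γ),
    toFun γ hγ = (List.ofFn fun i : Fin D.n => toFun _ (hD i.rev)).prod
  map_inv : ∀ (γ) (hγ : γ ∈ Γ) (hi : γ.inv ∈ Γ), toFun γ.inv hi = (toFun γ hγ)⁻¹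
  map_equivalent : ∀ (γ γ') (hγ : γ ∈ Γ) (hγ' : γ' ∈ Γ),
    (trivial IM IS M S).Equivalent γ γ' → toFun γ hγ = toFun γ' hγ'

/-- `Ω(h)(γ) = pr₂(h(γ)(γ(a), e))`. -/
def omega {Γ : Set (Curve M)} (h : (trivial IM IS M S).PathHom Γ) (γ : Curve M) (hγ : γ ∈ Γ) : S :=
  ((h.toFun γ hγ).toFun ⟨(γ.startPoint, 1), rfl⟩ : M × S).2

/-- `f ∈ Hom_G(Γ, S)`: `f` is the image under `Ω` of an element of `Hom_G(Γ, Iso_F)`. -/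
def IsInvariantGroupHom {EG HG : Type*} [NormedAddCommGroup EG] [NormedSpace ℝ EG]
    [TopologicalSpace HG] {IG : ModelWithCorners ℝ EG HG} {G : Type*} [TopologicalSpace G]
    [ChartedSpace HG G] [Group G] (Θ : (trivial IM IS M S).AutAction IG G) (ν : M → M × S)
    {Γ : Set (Curve M)} (f : GroupPathHom IM IS M S Γ) : Prop :=
  ∃ h : (trivial IM IS M S).PathHom Γ, Θ.IsInvariantHom ν h ∧
    ∀ (γ) (hγ : γ ∈ Γ), f.toFun γ hγ = omega h γ hγ

end Trivial

end PrincipalBundle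

end Bundle

/-! ### Homogeneous isotropic loop quantum cosmology -/

/-- The base manifold `ℝ³`. -/
abbrev R3 : Type := EuclideanSpace ℝ (Fin 3)

/-- The group `SU(2)`. -/
abbrev SU2 : Type := Matrix.specialUnitaryGroup (Fin 2) ℂ

namespace SU2

theorem mat_mul (σ τ : SU2) : (σ * τ).1 = σ.1 * τ.1 := rfl
theorem coe_inv (σ : SU2) : (σ⁻¹).1 = (σ.1)ᴴ := rfl

theorem mul_conjTranspose (σ : SU2) : σ.1 * (σ.1)ᴴ = 1 := by
  have := (Matrix.mem_specialUnitaryGroup_iff.1 σ.2).1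
  exact Matrix.mem_unitaryGroup_iff.1 this

theorem conjTranspose_mul (σ : SU2) : (σ.1)ᴴ * σ.1 = 1 := by
  have := (Matrix.mem_specialUnitaryGroup_iff.1 σ.2).1
  exact Matrix.mem_unitaryGroup_iff'.1 this

theorem conjTranspose_eq_adjugate (σ : SU2) : (σ.1)ᴴ = σ.1.adjugate := by
  have h1 : σ.1.det = 1 := (Matrix.mem_specialUnitaryGroup_iff.1 σ.2).2
  calc (σ.1)ᴴ = (σ.1)ᴴ * (σ.1 * σ.1.adjugate) := by rw [Matrix.mul_adjugate, h1]; simp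
    _ = σ.1.adjugate := by rw [← Matrix.mul_assoc, conjTranspose_mul, Matrix.one_mul]

theorem apply_one_one (σ : SU2) : σ.1 1 1 = star (σ.1 0 0) := by
  have := congrFun (congrFun (conjTranspose_eq_adjugate σ) 0) 0
  simpa [Matrix.adjugate_fin_two, Matrix.conjTranspose_apply] using this.symm

theorem apply_one_zero (σ : SU2) : σ.1 1 0 = - star (σ.1 0 1) := by
  have := congrFun (congrFun (conjTranspose_eq_adjugate σ) 1) 0
  simp [Matrix.adjugate_fin_two, Matrix.conjTranspose_apply] at this
  simp [this]

/-- The unit sphere of `ℝ⁴`. -/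
abbrev S3 : Type := Metric.sphere (0 : EuclideanSpace ℝ (Fin 4)) 1

/-- The first row of `σ`, as a vector of `ℝ⁴`. -/
noncomputable def vec (σ : SU2) : EuclideanSpace ℝ (Fin 4) :=
  !₂[(σ.1 0 0).re, (σ.1 0 0).im, (σ.1 0 1).re, (σ.1 0 1).im]

/-- The matrix of `SU(2)` with the given first row. -/
noncomputable def matOfVec (x : EuclideanSpace ℝ (Fin 4)) : Matrix (Fin 2) (Fin 2) ℂ :=
  !![⟨x 0, x 1⟩, ⟨x 2, x 3⟩; ⟨-x 2, x 3⟩, ⟨x 0, -x 1⟩]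

theorem matOfVec_vec (σ : SU2) : matOfVec (vec σ) = σ.1 := by
  ext i j
  fin_cases i <;> fin_cases j <;>
    apply Complex.ext <;> simp [matOfVec, vec, apply_one_one, apply_one_zero]

theorem vec_mem (σ : SU2) : vec σ ∈ Metric.sphere (0 : EuclideanSpace ℝ (Fin 4)) 1 := by
  have h1 : σ.1.det = 1 := (Matrix.mem_specialUnitaryGroup_iff.1 σ.2).2
  rw [Matrix.det_fin_two, apply_one_one, apply_one_zero] at h1
  have h2 := congrArg Complex.re h1
  simp [Complex.mul_re] at h2
  rw [mem_sphere_zero_iff_norm, EuclideanSpace.norm_eq, Real.sqrt_eq_one]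
  simp [vec, Fin.sum_univ_four]
  nlinarith

theorem matOfVec_mem (x : S3) : matOfVec x.1 ∈ Matrix.specialUnitaryGroup (Fin 2) ℂ := by
  have hx := x.2
  rw [mem_sphere_zero_iff_norm, EuclideanSpace.norm_eq, Real.sqrt_eq_one] at hx
  simp [Fin.sum_univ_four] at hx
  rw [Matrix.mem_specialUnitaryGroup_iff, Matrix.mem_unitaryGroup_iff]
  constructor
  · ext i j
    fin_cases i <;> fin_cases j <;> apply Complex.ext <;>
      simp [matOfVec, Matrix.mul_apply, Fin.sum_univ_two, Matrix.star_apply] <;> nlinarith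
  · rw [Matrix.det_fin_two]
    apply Complex.ext <;> simp [matOfVec] <;> nlinarith

theorem vec_matOfVec (x : S3) : vec ⟨matOfVec x.1, matOfVec_mem x⟩ = x.1 := by
  ext i
  fin_cases i <;> simp [vec, matOfVec]

theorem continuous_vec : Continuous vec := by
  have h : ∀ i j, Continuous fun σ : SU2 => σ.1 i j := fun i j =>
    continuous_subtype_val.matrix_elem i j
  unfold vec
  refine (PiLp.continuous_toLp 2 _).comp (continuous_pi fun i => ?_)
  fin_cases i
  · exact Complex.continuous_re.comp (h 0 0)
  · exact Complex.continuous_im.comp (h 0 0)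
  · exact Complex.continuous_re.comp (h 0 1)
  · exact Complex.continuous_im.comp (h 0 1)

theorem continuous_matOfVec : Continuous matOfVec := by
  refine continuous_matrix fun i j => ?_
  have e : ∀ i, Continuous fun x : EuclideanSpace ℝ (Fin 4) => x i := fun i => by fun_prop
  have key : ∀ f g : EuclideanSpace ℝ (Fin 4) → ℝ, Continuous f → Continuous g →
      Continuous fun x => (⟨f x, g x⟩ : ℂ) := fun f g hf hg =>
    Complex.equivRealProdCLM.symm.continuous.comp (hf.prodMk hg)
  fin_cases i <;> fin_cases j
  · exact key _ _ (e 0) (e 1)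
  · exact key _ _ (e 2) (e 3)
  · exact key _ _ (e 2).neg (e 3)
  · exact key _ _ (e 0) (e 1).neg

/-- The homeomorphism of `SU(2)` with the unit sphere of `ℝ⁴` given by the first row. -/
noncomputable def homeoSphere : SU2 ≃ₜ S3 where
  toFun σ := ⟨vec σ, vec_mem σ⟩
  invFun x := ⟨matOfVec x.1, matOfVec_mem x⟩
  left_inv σ := Subtype.ext (matOfVec_vec σ)
  right_inv x := Subtype.ext (vec_matOfVec x)
  continuous_toFun := continuous_vec.subtype_mk _
  continuous_invFun := (continuous_matOfVec.comp continuous_subtype_val).subtype_mk _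

/-- The smooth structure of `SU(2)`: the one of the unit sphere of `ℝ⁴`. -/
noncomputable instance : ChartedSpace (EuclideanSpace ℝ (Fin 3)) SU2 where
  atlas := {e | ∃ c ∈ atlas (EuclideanSpace ℝ (Fin 3)) S3,
    e = homeoSphere.toOpenPartialHomeomorph.trans c}
  chartAt σ := homeoSphere.toOpenPartialHomeomorph.trans
    (chartAt (EuclideanSpace ℝ (Fin 3)) (homeoSphere σ))
  mem_chart_source σ := by simp
  chart_mem_atlas σ := ⟨_, chart_mem_atlas _ _, rfl⟩

instance : IsManifold (𝓡 3) ω SU2 where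
  compatible := by
    rintro _ _ ⟨c, hc, rfl⟩ ⟨c', hc', rfl⟩
    refine StructureGroupoid.mem_of_eqOnSource _
      ((contDiffGroupoid ω (𝓡 3)).compatible hc hc') ?_
    constructor
    · ext x; simp
    · intro x hx; simp

theorem contMDiff_homeoSphere : ContMDiff (𝓡 3) (𝓡 3) ω homeoSphere := by
  intro σ
  rw [contMDiffAt_iff]
  refine ⟨homeoSphere.continuous.continuousAt, ?_⟩
  refine (contMDiffAt_iff.1 (contMDiffAt_id (I := 𝓡 3) (n := ω) (x := homeoSphere σ))).2.congr_of_eventuallyEq_of_mem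
    (Eventually.of_forall fun y => ?_) (by simp)
  change _ = extChartAt (𝓡 3) (homeoSphere σ) (id _)
  change extChartAt (𝓡 3) (homeoSphere σ) (homeoSphere (homeoSphere.symm _)) = _
  rw [Homeomorph.apply_symm_apply]
  rfl

theorem contMDiff_homeoSphere_symm : ContMDiff (𝓡 3) (𝓡 3) ω homeoSphere.symm := by
  intro x
  obtain ⟨σ, rfl⟩ := homeoSphere.surjective x
  rw [contMDiffAt_iff]
  refine ⟨homeoSphere.symm.continuous.continuousAt, ?_⟩
  rw [Homeomorph.symm_apply_apply]
  refine (contMDiffAt_iff.1 (contMDiffAt_id (I := 𝓡 3) (n := ω) (x := homeoSphere σ))).2.congr_of_eventuallyEq_of_mem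
    (Eventually.of_forall fun y => ?_) (by simp)
  change extChartAt (𝓡 3) (homeoSphere σ) (homeoSphere (homeoSphere.symm _)) = _
  rw [Homeomorph.apply_symm_apply]
  rfl

theorem contMDiff_vec : ContMDiff (𝓡 3) 𝓘(ℝ, EuclideanSpace ℝ (Fin 4)) ω vec :=
  have := Fact.mk (@finrank_euclideanSpace_fin ℝ _ (3 + 1))
  (contMDiff_coe_sphere (n := 3)).comp contMDiff_homeoSphere

theorem contMDiff_entry (i j : Fin 2) :
    ContMDiff (𝓡 3) 𝓘(ℝ, ℂ) ω fun σ : SU2 => σ.1 i j := by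
  have h : ContDiff ℝ ω fun x : EuclideanSpace ℝ (Fin 4) => matOfVec x i j := by
    have e : ∀ i, ContDiff ℝ ω fun x : EuclideanSpace ℝ (Fin 4) => x i := fun i => by fun_prop
    have key : ∀ f g : EuclideanSpace ℝ (Fin 4) → ℝ, ContDiff ℝ ω f → ContDiff ℝ ω g →
        ContDiff ℝ ω fun x => (⟨f x, g x⟩ : ℂ) := fun f g hf hg =>
      Complex.equivRealProdCLM.symm.contDiff.comp (hf.prodMk hg)
    fin_cases i <;> fin_cases j
    · exact key _ _ (e 0) (e 1)
    · exact key _ _ (e 2) (e 3)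
    · exact key _ _ (e 2).neg (e 3)
    · exact key _ _ (e 0) (e 1).neg
  have := h.contMDiff.comp contMDiff_vec
  refine this.congr fun σ => ?_
  simp [matOfVec_vec]

section
variable {F H X : Type*} [NormedAddCommGroup F] [NormedSpace ℝ F] [TopologicalSpace H]
  {I : ModelWithCorners ℝ F H} [TopologicalSpace X] [ChartedSpace H X] 

theorem contMDiff_of_entry [IsManifold I ω X] {f : X → SU2}
    (hf : ∀ i j, ContMDiff I 𝓘(ℝ, ℂ) ω fun x => (f x).1 i j) : ContMDiff I (𝓡 3) ω f := by
  have h : ContMDiff I 𝓘(ℝ, EuclideanSpace ℝ (Fin 4)) ω fun x => vec (f x) := by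
    have hre : ∀ j, ContMDiff I 𝓘(ℝ, ℝ) ω fun x => ((f x).1 0 j).re := fun j =>
      Complex.reCLM.contDiff.contMDiff.comp (hf 0 j)
    have him : ∀ j, ContMDiff I 𝓘(ℝ, ℝ) ω fun x => ((f x).1 0 j).im := fun j =>
      Complex.imCLM.contDiff.contMDiff.comp (hf 0 j)
    have : ContMDiff I 𝓘(ℝ, Fin 4 → ℝ) ω fun x =>
        ![((f x).1 0 0).re, ((f x).1 0 0).im, ((f x).1 0 1).re, ((f x).1 0 1).im] := by
      rw [contMDiff_pi_space]
      intro i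
      fin_cases i
      · exact hre 0
      · exact him 0
      · exact hre 1
      · exact him 1
    exact (PiLp.continuousLinearEquiv 2 ℝ (fun _ : Fin 4 => ℝ)).symm.contDiff.contMDiff.comp this
  have := Fact.mk (@finrank_euclideanSpace_fin ℝ _ (3 + 1))
  have h2 := contMDiff_homeoSphere_symm.comp (h.codRestrict_sphere (n := 3) fun x => vec_mem (f x))
  refine h2.congr fun x => ?_
  exact (homeoSphere.symm_apply_apply (f x)).symm

end

instance : LieGroup (𝓡 3) ω SU2 where
  contMDiff_mul := by
    apply contMDiff_of_entry
    intro i j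
    have h : ∀ k, ContMDiff ((𝓡 3).prod (𝓡 3)) 𝓘(ℝ, ℂ) ω
        fun x : SU2 × SU2 => x.1.1 i k * x.2.1 k j := fun k =>
      (contDiff_mul (𝕜 := ℝ) (𝔸 := ℂ)).contMDiff.comp
        (((contMDiff_entry i k).comp contMDiff_fst).prodMk_space
          ((contMDiff_entry k j).comp contMDiff_snd))
    refine ((h 0).add (h 1)).congr fun x => ?_
    simp [Matrix.mul_apply, Fin.sum_univ_two]
  contMDiff_inv := by
    apply contMDiff_of_entry
    intro i j
    exact Complex.conjCLE.contDiff.contMDiff.comp (contMDiff_entry j i)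

/-- `μ(v) = v¹τ₁ + v²τ₂ + v³τ₃`. -/
noncomputable def mu (v : R3) : Matrix (Fin 2) (Fin 2) ℂ :=
  (v 0 : ℂ) • !![0, -Complex.I; -Complex.I, 0] + (v 1 : ℂ) • !![0, -1; 1, 0] +
    (v 2 : ℂ) • !![-Complex.I, 0; 0, Complex.I]

/-- The inverse of `mu` on `su(2)`. -/
noncomputable def muInv (A : Matrix (Fin 2) (Fin 2) ℂ) : R3 :=
  !₂[-(A 1 0).im, (A 1 0).re, (A 1 1).im]

theorem muInv_mu (v : R3) : muInv (mu v) = v := by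
  ext i
  fin_cases i <;> simp [muInv, mu]

theorem mu_muInv (A : Matrix (Fin 2) (Fin 2) ℂ) (hA : Aᴴ = -A) (ht : A.trace = 0) :
    mu (muInv A) = A := by
  have h := fun i j => congrFun (congrFun hA i) j
  have h00 := h 0 0
  have h01 := h 0 1
  have h11 := h 1 1
  rw [Matrix.trace_fin_two] at ht
  simp only [Matrix.conjTranspose_apply, Matrix.neg_apply, Complex.ext_iff] at h00 h01 h11 ht
  simp at h00 h01 h11 ht
  ext i j
  fin_cases i <;> fin_cases j <;> apply Complex.ext <;> simp [muInv, mu] <;> linarith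

/-- The rotation `σ(v) = μ⁻¹(σ μ(v) σ⁻¹)` of `ℝ³`. -/
noncomputable def rot (σ : SU2) (v : R3) : R3 :=
  muInv (σ.1 * mu v * (σ⁻¹).1)

theorem mu_conjTranspose (v : R3) : (mu v)ᴴ = -mu v := by
  ext i j
  fin_cases i <;> fin_cases j <;> apply Complex.ext <;>
    simp [mu, Matrix.conjTranspose_apply]

theorem mu_trace (v : R3) : (mu v).trace = 0 := by
  rw [Matrix.trace_fin_two]
  apply Complex.ext <;> simp [mu]

theorem mu_rot (σ : SU2) (v : R3) : mu (rot σ v) = σ.1 * mu v * (σ⁻¹).1 := by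
  apply mu_muInv
  · rw [coe_inv, Matrix.conjTranspose_mul, Matrix.conjTranspose_mul, mu_conjTranspose,
      Matrix.conjTranspose_conjTranspose]
    simp [Matrix.mul_assoc]
  · rw [Matrix.trace_mul_cycle, coe_inv, conjTranspose_mul, Matrix.one_mul, mu_trace]

theorem mu_injective : Function.Injective mu := Function.LeftInverse.injective muInv_mu

theorem rot_one (v : R3) : rot 1 v = v := by
  apply mu_injective
  rw [mu_rot]
  simp

theorem rot_mul (σ τ : SU2) (v : R3) : rot (σ * τ) v = rot σ (rot τ v) := by
  apply mu_injective
  rw [mu_rot, mu_rot, mu_rot, mul_inv_rev]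
  simp only [mat_mul, Matrix.mul_assoc]

theorem mu_add (v w : R3) : mu (v + w) = mu v + mu w := by
  ext i j
  fin_cases i <;> fin_cases j <;> apply Complex.ext <;> simp [mu] <;> ring

theorem rot_add (σ : SU2) (v w : R3) : rot σ (v + w) = rot σ v + rot σ w := by
  apply mu_injective
  rw [mu_rot, mu_add, mu_add, mu_rot, mu_rot]
  simp only [Matrix.mul_add, Matrix.add_mul]

theorem rot_zero (σ : SU2) : rot σ 0 = 0 := by
  have h := rot_add σ 0 0
  rw [add_zero] at h
  exact left_eq_add.1 h

theorem contMDiff_rot :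
    ContMDiff ((𝓡 3).prod (𝓡 3)) (𝓡 3) ω fun x : SU2 × R3 => rot x.1 x.2 := by
  have hmul : ∀ {f g : SU2 × R3 → ℂ}, ContMDiff ((𝓡 3).prod (𝓡 3)) 𝓘(ℝ, ℂ) ω f →
      ContMDiff ((𝓡 3).prod (𝓡 3)) 𝓘(ℝ, ℂ) ω g →
      ContMDiff ((𝓡 3).prod (𝓡 3)) 𝓘(ℝ, ℂ) ω fun x => f x * g x := fun hf hg =>
    (contDiff_mul (𝕜 := ℝ) (𝔸 := ℂ)).contMDiff.comp (hf.prodMk_space hg)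
  have hs : ∀ i j, ContMDiff ((𝓡 3).prod (𝓡 3)) 𝓘(ℝ, ℂ) ω fun x : SU2 × R3 => x.1.1 i j :=
    fun i j => (contMDiff_entry i j).comp contMDiff_fst
  have hs' : ∀ i j, ContMDiff ((𝓡 3).prod (𝓡 3)) 𝓘(ℝ, ℂ) ω
      fun x : SU2 × R3 => (x.1⁻¹).1 i j :=
    fun i j => (contMDiff_entry i j).comp ((contMDiff_inv (𝓡 3) ω).comp contMDiff_fst)
  have hm : ∀ i j, ContMDiff ((𝓡 3).prod (𝓡 3)) 𝓘(ℝ, ℂ) ω fun x : SU2 × R3 => mu x.2 i j := by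
    intro i j
    have : ContDiff ℝ ω fun v : R3 => mu v i j := by
      have e : ∀ k, ContDiff ℝ ω fun v : R3 => ((v k : ℝ) : ℂ) := fun k =>
        Complex.ofRealCLM.contDiff.comp (by fun_prop)
      simp only [mu, Matrix.add_apply, Matrix.smul_apply, smul_eq_mul]
      exact (((e 0).mul contDiff_const).add ((e 1).mul contDiff_const)).add
        ((e 2).mul contDiff_const)
    exact this.contMDiff.comp contMDiff_snd
  have hA : ∀ i j, ContMDiff ((𝓡 3).prod (𝓡 3)) 𝓘(ℝ, ℂ) ω
      fun x : SU2 × R3 => (x.1.1 * mu x.2 * (x.1⁻¹).1) i j := by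
    intro i j
    simp only [Matrix.mul_apply, Fin.sum_univ_two]
    exact (hmul ((hmul (hs i 0) (hm 0 0)).add (hmul (hs i 1) (hm 1 0))) (hs' 0 j)).add
      (hmul ((hmul (hs i 0) (hm 0 1)).add (hmul (hs i 1) (hm 1 1))) (hs' 1 j))
  have hpi : ContMDiff ((𝓡 3).prod (𝓡 3)) 𝓘(ℝ, Fin 3 → ℝ) ω fun x : SU2 × R3 =>
      ![-((x.1.1 * mu x.2 * (x.1⁻¹).1) 1 0).im, ((x.1.1 * mu x.2 * (x.1⁻¹).1) 1 0).re,
        ((x.1.1 * mu x.2 * (x.1⁻¹).1) 1 1).im] := by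
    rw [contMDiff_pi_space]
    intro i
    fin_cases i
    · exact (-Complex.imCLM).contDiff.contMDiff.comp (hA 1 0)
    · exact Complex.reCLM.contDiff.contMDiff.comp (hA 1 0)
    · exact Complex.imCLM.contDiff.contMDiff.comp (hA 1 1)
  exact (PiLp.continuousLinearEquiv 2 ℝ (fun _ : Fin 3 => ℝ)).symm.contDiff.contMDiff.comp hpi

end SU2

/-- The semidirect product `E = ℝ³ ⋊ SU(2)`. -/
def EuclideanCover : Type := R3 × SU2

namespace EuclideanCover

noncomputable instance : TopologicalSpace EuclideanCover := inferInstanceAs (TopologicalSpace (R3 × SU2))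

noncomputable instance : ChartedSpace (ModelProd R3 R3) EuclideanCover :=
  inferInstanceAs (ChartedSpace (ModelProd R3 R3) (R3 × SU2))

noncomputable instance : Group EuclideanCover where
  mul g h := (g.1 + SU2.rot g.2 h.1, g.2 * h.2)
  one := ((0 : R3), (1 : SU2))
  inv g := (-SU2.rot g.2⁻¹ g.1, g.2⁻¹)
  mul_assoc g h k := by
    refine Prod.ext ?_ (mul_assoc g.2 h.2 k.2)
    change (g.1 + SU2.rot g.2 h.1) + SU2.rot (g.2 * h.2) k.1 =
      g.1 + SU2.rot g.2 (h.1 + SU2.rot h.2 k.1)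
    rw [SU2.rot_mul, SU2.rot_add, add_assoc]
  one_mul g := by
    refine Prod.ext ?_ (one_mul g.2)
    change 0 + SU2.rot 1 g.1 = g.1
    rw [SU2.rot_one, zero_add]
  mul_one g := by
    refine Prod.ext ?_ (mul_one g.2)
    change g.1 + SU2.rot g.2 0 = g.1
    rw [SU2.rot_zero, add_zero]
  inv_mul_cancel g := by
    refine Prod.ext ?_ (inv_mul_cancel g.2)
    change -SU2.rot g.2⁻¹ g.1 + SU2.rot g.2⁻¹ g.1 = 0
    rw [neg_add_cancel]

theorem contMDiff_mul' : ContMDiff (((𝓡 3).prod (𝓡 3)).prod ((𝓡 3).prod (𝓡 3)))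
    ((𝓡 3).prod (𝓡 3)) ω fun x : (R3 × SU2) × (R3 × SU2) =>
      ((x.1.1 + SU2.rot x.1.2 x.2.1, x.1.2 * x.2.2) : R3 × SU2) := by
  have h11 := (contMDiff_fst (I := 𝓡 3) (J := 𝓡 3) (M := R3) (N := SU2) (n := ω))
  have h12 := (contMDiff_snd (I := 𝓡 3) (J := 𝓡 3) (M := R3) (N := SU2) (n := ω))
  have hf := (contMDiff_fst (I := (𝓡 3).prod (𝓡 3)) (J := (𝓡 3).prod (𝓡 3))
    (M := R3 × SU2) (N := R3 × SU2) (n := ω))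
  have hs := (contMDiff_snd (I := (𝓡 3).prod (𝓡 3)) (J := (𝓡 3).prod (𝓡 3))
    (M := R3 × SU2) (N := R3 × SU2) (n := ω))
  exact ((h11.comp hf).add (SU2.contMDiff_rot.comp ((h12.comp hf).prodMk (h11.comp hs)))).prodMk
    ((h12.comp hf).mul (h12.comp hs))

instance : LieGroup ((𝓡 3).prod (𝓡 3)) ω EuclideanCover where
  toIsManifold := inferInstanceAs (IsManifold ((𝓡 3).prod (𝓡 3)) ω (R3 × SU2))
  contMDiff_mul := contMDiff_mul'
  contMDiff_inv := by
    have h11 := (contMDiff_fst (I := 𝓡 3) (J := 𝓡 3) (M := R3) (N := SU2) (n := ω))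
    have h12 := (contMDiff_snd (I := 𝓡 3) (J := 𝓡 3) (M := R3) (N := SU2) (n := ω))
    have hi := (contMDiff_inv (𝓡 3) ω).comp h12
    exact (contDiff_neg.contMDiff.comp (SU2.contMDiff_rot.comp (hi.prodMk h11))).prodMk hi

end EuclideanCover

/-- The bundle `ℝ³ × SU(2)`. -/
noncomputable abbrev lqcBundle :
    PrincipalBundle ((𝓡 3).prod (𝓡 3)) (𝓡 3) (𝓡 3) (R3 × SU2) R3 SU2 :=
  PrincipalBundle.trivial (𝓡 3) (𝓡 3) R3 SU2

/-- The action `(v, σ) · (x, s) = (v + σ(x), σ s)` of `E` on `ℝ³ × SU(2)`. -/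
noncomputable def lqcAction : lqcBundle.AutAction ((𝓡 3).prod (𝓡 3)) EuclideanCover where
  θ g p := (g.1 + SU2.rot g.2 p.1, g.2 * p.2)
  one_θ p := one_mul (M := EuclideanCover) p
  mul_θ g h p := mul_assoc (G := EuclideanCover) g h p
  contMDiff_θ := EuclideanCover.contMDiff_mul'.of_le le_top
  θ_act _ _ _ := Prod.ext rfl (mul_assoc _ _ _).symm

theorem lqcAction_base (v : R3) (σ : SU2) :
    lqcAction.base (v, σ) = fun x => v + SU2.rot σ x :=
  funext fun x => (lqcAction.proj_θ (v, σ) (x, 1)).symm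

theorem lqcAction_mem {Γ : Set (Curve R3)} (hΓ : lqcAction.IsInvariantPaths Γ) (v : R3) (σ : SU2)
    {γ : Curve R3} (hγ : γ ∈ Γ) : γ.map (fun x => v + SU2.rot σ x) ∈ Γ :=
  lqcAction_base v σ ▸ hΓ (v, σ) γ hγ

/-!
A homomorphism of paths is invariant if and only if it is equivariant, because the parallel
transport is natural under automorphisms of the bundle and because each homomorphism of paths is a
limit of parallel transports of connections.

*Parallel transport.* If `c` and `c · s` are curves in `P`, a connection `A` maps the velocity of
`c · s` to `Ad(s⁻¹) A(c') + s⁻¹ s'` (`Connection.val_velocity_act`).  So two horizontal lifts of a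
path with the same starting point agree (`Connection.eq_of_isHorizontalAt`), and `c · s` is
horizontal if `s` solves `s' = -A(c') s`, which is an ordinary differential equation in a chart of `S`
(`exists_velocity_eq_neg_mul`); local lifts are glued in `Connection.hasLifts`.  Consequently the
transport is `S`-equivariant, compatible with decomposition and inversion, and natural:
`φ(g, A)` transports `gp` along `gγ` to `θ(g, P_γ^A(p))` (`AutAction.transport_onConnection`).

*The spectrum.* By Gelfand duality the evaluations are dense in the spectrum (`denseRange_of_eval`),
so that for each generalized connection `χ` the filter `ι⁻¹(𝓝 χ)` of connections is nontrivial.  If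
`χ` is `G`-invariant, this filter is mapped to itself by `φ(g, ·)`, and for `h = κ(χ)` the equation
`h(gγ)(gp) = θ(g, h(γ)(p))` is the limit of the naturality of the transport along it
(`AutAction.isEquivariantHom_of_isKappa`).

Conversely, let `h` be equivariant.  By independence there is for finitely many paths a connection
whose transport along them is given by `h` (`PathHom.exists_agrees`).  The spectrum is compact, so a
limit `χ` of these connections along an ultrafilter has the values `ρᵢⱼ(h_γ)` on the generators
`ρᵢⱼ ∘ h_γ^ν` (`PathHom.exists_genConnection`).  It satisfies `κ(χ) = h`, because the irreducible
representations determine the topology of `S` (`PathHom.isKappa`); this rests on the Peter–Weyl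
theorem (`IrrepMatrix.exists_apply_ne_one`), which is deduced from the spectral theorem for
convolution operators on `L²(S)`.  Finally, `φ_g^*` maps the generators for `gγ` to linear
combinations of those for `γ`, with coefficients that also relate `h(gγ)` and `h(γ)`, so that the
equivariance of `h` gives the invariance of `χ` on the generators and hence everywhere
(`AutAction.IsEquivariantHom.isInvariantGen`).

*The trivial bundle.* A map `f : Γ → S` with the algebraic properties of a homomorphism of paths has
the unique preimage `h(γ)(γ(a), s) = (γ(b), f(γ) s)` under `Ω` (`GroupPathHom.toPathHom`).  For the
action of `E`, equivariance of `h` reads `f(v + σ(γ)) σ s = σ f(γ) s`.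
-/

/-! ### The Peter–Weyl theorem -/

section PeterWeyl

open MeasureTheory DomMulAct

variable {S : Type*} [TopologicalSpace S] [Group S] [IsTopologicalGroup S] [CompactSpace S]
  [SecondCountableTopology S] [MeasurableSpace S] [BorelSpace S]

namespace LeftRegular

/-- The Hilbert space `L²(S)` of the Haar measure. -/
abbrev L2 (S : Type*) [TopologicalSpace S] [Group S] [IsTopologicalGroup S] [CompactSpace S]
  [MeasurableSpace S] [BorelSpace S] : Type _ := Lp ℂ 2 (Measure.haar : Measure S)

/-- The left regular representation `(L_g h)(x) = h(g⁻¹x)` on `L²(S)`. -/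
noncomputable def leftReg (g : S) : L2 S →ₗᵢ[ℂ] L2 S where
  toFun h := mk g⁻¹ • h
  map_add' := smul_add _
  map_smul' _ _ := smul_comm _ _ _
  norm_map' _ := norm_smul_Lp _ _

theorem leftReg_apply (g : S) (h : L2 S) : leftReg g h = mk g⁻¹ • h := rfl

theorem leftReg_one (h : L2 S) : leftReg 1 h = h := by
  simp [leftReg_apply]

theorem leftReg_mul (g g' : S) (h : L2 S) : leftReg (g * g') h = leftReg g (leftReg g' h) := by
  simp only [leftReg_apply, smul_smul, mul_inv_rev]
  rfl

theorem leftReg_inv_leftReg (g : S) (h : L2 S) : leftReg g⁻¹ (leftReg g h) = h := by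
  rw [← leftReg_mul, inv_mul_cancel, leftReg_one]

theorem continuous_leftReg (h : L2 S) : Continuous fun g : S => leftReg g h := by
  have : Fact ((2 : ENNReal) ≠ ⊤) := ⟨by simp⟩
  have : Continuous fun g : S => mk g⁻¹ := DomMulAct.continuous_mk.comp continuous_inv
  exact this.smul continuous_const

theorem inner_leftReg_left (g : S) (h h' : L2 S) :
    inner ℂ (leftReg g h) h' = inner ℂ h (leftReg g⁻¹ h') := by
  rw [← (leftReg g⁻¹).inner_map_map (leftReg g h), leftReg_inv_leftReg]

theorem leftReg_toLp (g : S) (u : S →ᵇ ℂ) :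
    leftReg g (BoundedContinuousFunction.toLp 2 Measure.haar ℂ u) =
      BoundedContinuousFunction.toLp 2 Measure.haar ℂ
        (u.compContinuous ⟨fun x => g⁻¹ * x, continuous_const_mul _⟩) := by
  rfl

/-- The function `x ↦ ⟨L_x f, h⟩ = ∫ conj (f (x⁻¹y)) h(y) dy`. -/
noncomputable def convFun (f : L2 S) : L2 S →L[ℂ] (S →ᵇ ℂ) :=
  LinearMap.mkContinuous
    { toFun := fun h => BoundedContinuousFunction.mkOfCompact
        ⟨fun x => inner ℂ (leftReg x f) h, (continuous_leftReg f).inner continuous_const⟩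
      map_add' := fun h h' => by ext x; simp [inner_add_right]
      map_smul' := fun c h => by ext x; simp [inner_smul_right] } ‖f‖ fun h => by
    refine (BoundedContinuousFunction.norm_le (by positivity)).2 fun x => ?_
    refine (norm_inner_le_norm (𝕜 := ℂ) (leftReg x f) h).trans ?_
    rw [LinearIsometry.norm_map]

theorem convFun_apply (f h : L2 S) (x : S) : convFun f h x = inner ℂ (leftReg x f) h := rfl

/-- By the Arzelà–Ascoli theorem: the functions `x ↦ ⟨L_x f, h⟩` with `‖h‖ ≤ 1` are
equicontinuous. -/
theorem isCompactOperator_convFun (f : L2 S) : IsCompactOperator (convFun f) := by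
  refine (isCompactOperator_iff_isCompact_closure_image_closedBall
    (convFun f : L2 S →ₗ[ℂ] (S →ᵇ ℂ)) one_pos).2 ?_
  refine BoundedContinuousFunction.arzela_ascoli (Metric.closedBall (0 : ℂ) ‖f‖)
    (isCompact_closedBall _ _) _ ?_ ?_
  · rintro _ x ⟨h, hh, rfl⟩
    rw [mem_closedBall_zero_iff] at hh ⊢
    refine (norm_inner_le_norm (𝕜 := ℂ) (leftReg x f) h).trans ?_
    rw [LinearIsometry.norm_map]
    exact mul_le_of_le_one_right (norm_nonneg _) hh
  · intro x
    rw [Metric.equicontinuousAt_iff_right]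
    intro ε hε
    have := Metric.tendsto_nhds.1 ((continuous_leftReg f).tendsto x) ε hε
    filter_upwards [this] with y hy
    rintro ⟨_, h, hh, rfl⟩
    rw [mem_closedBall_zero_iff] at hh
    change dist (convFun f h x) (convFun f h y) < ε
    rw [dist_comm, dist_eq_norm, convFun_apply, convFun_apply, ← inner_sub_left]
    refine (norm_inner_le_norm _ _).trans_lt ?_
    rw [dist_eq_norm] at hy
    exact (mul_le_of_le_one_right (norm_nonneg _) hh).trans_lt hy

/-- The convolution operator `h ↦ (x ↦ ⟨L_x f, h⟩)` on `L²(S)`. -/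
noncomputable def conv (f : L2 S) : L2 S →L[ℂ] L2 S :=
  (BoundedContinuousFunction.toLp 2 Measure.haar ℂ).comp (convFun f)

theorem isCompactOperator_conv (f : L2 S) : IsCompactOperator (conv f) :=
  (isCompactOperator_convFun f).clm_comp (BoundedContinuousFunction.toLp 2 Measure.haar ℂ)

theorem conv_leftReg (f h : L2 S) (g : S) : conv f (leftReg g h) = leftReg g (conv f h) := by
  change BoundedContinuousFunction.toLp 2 Measure.haar ℂ _ =
    leftReg g (BoundedContinuousFunction.toLp 2 Measure.haar ℂ _)
  rw [leftReg_toLp]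
  congr 1
  ext x
  change inner ℂ (leftReg x f) (leftReg g h) = inner ℂ (leftReg (g⁻¹ * x) f) h
  rw [leftReg_mul, inner_leftReg_left g⁻¹, inv_inv]

theorem convFun_toLp (f : S →ᵇ ℂ) (h : L2 S) (x : S) :
    convFun (BoundedContinuousFunction.toLp 2 Measure.haar ℂ f) h x =
      ∫ y, star (f (x⁻¹ * y)) * h y ∂Measure.haar := by
  rw [convFun_apply, leftReg_toLp, L2.inner_def]
  refine integral_congr_ae ?_
  filter_upwards [BoundedContinuousFunction.coeFn_toLp (p := 2) (𝕜 := ℂ) Measure.haar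
    (f.compContinuous ⟨fun y => x⁻¹ * y, continuous_const_mul _⟩)] with y hy
  rw [hy]
  simp [mul_comm]

/-- The kernel `conj (f (x⁻¹y))` of the operator is Hermitian if `f(x⁻¹) = conj (f x)`. -/
theorem isSymmetric_conv (f : S →ᵇ ℂ) (hf : ∀ x, f x⁻¹ = star (f x)) :
    (conv (BoundedContinuousFunction.toLp 2 Measure.haar ℂ f)).IsSymmetric := by
  intro h h'
  set F : L2 S := BoundedContinuousFunction.toLp 2 Measure.haar ℂ f
  have hi : ∀ u : L2 S, Integrable u (Measure.haar : Measure S) := fun u =>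
    (Lp.memLp u).integrable (by norm_num)
  have h1 : inner ℂ (conv F h) h' =
      ∫ x, ∫ y, f (x⁻¹ * y) * (star (h y) * h' x) ∂Measure.haar ∂Measure.haar := by
    rw [L2.inner_def]
    refine integral_congr_ae ?_
    filter_upwards [BoundedContinuousFunction.coeFn_toLp (p := 2) (𝕜 := ℂ) Measure.haar
      (convFun F h)] with x hx
    change inner ℂ ((BoundedContinuousFunction.toLp 2 Measure.haar ℂ (convFun F h)) x) _ = _
    rw [hx, convFun_toLp, RCLike.inner_apply', ← integral_conj, ← integral_mul_const]
    refine integral_congr_ae (ae_of_all _ fun y => ?_)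
    simp [mul_assoc]
  have h2 : inner ℂ h (conv F h') =
      ∫ y, ∫ x, f (x⁻¹ * y) * (star (h y) * h' x) ∂Measure.haar ∂Measure.haar := by
    rw [L2.inner_def]
    refine integral_congr_ae ?_
    filter_upwards [BoundedContinuousFunction.coeFn_toLp (p := 2) (𝕜 := ℂ) Measure.haar
      (convFun F h')] with y hy
    change inner ℂ _ ((BoundedContinuousFunction.toLp 2 Measure.haar ℂ (convFun F h')) y) = _
    rw [hy, convFun_toLp, RCLike.inner_apply', ← integral_const_mul]
    refine integral_congr_ae (ae_of_all _ fun x => ?_)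
    have : star (f (y⁻¹ * x)) = f (x⁻¹ * y) := by rw [← hf]; simp
    simp only [this]
    simp
    ring
  change inner ℂ (conv F h) h' = inner ℂ h (conv F h')
  rw [h1, h2]
  refine integral_integral_swap ?_
  have hc : Continuous fun p : S × S => f (p.1⁻¹ * p.2) :=
    f.continuous.comp (continuous_fst.inv.mul continuous_snd)
  have hp : Integrable (fun p : S × S => h' p.1 * star (h p.2))
      ((Measure.haar : Measure S).prod Measure.haar) :=
    (hi h').mul_prod ((starL' ℝ : ℂ ≃L[ℝ] ℂ).integrable_comp_iff.2 (hi h))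
  refine (hp.bdd_mul (c := ‖f‖) hc.aestronglyMeasurable
    (ae_of_all _ fun p => f.norm_coe_le_norm _)).congr (ae_of_all _ fun p => ?_)
  simp [Function.uncurry, mul_comm]

/-- If `s` acts trivially on all finite-dimensional invariant subspaces, in particular on the
eigenspaces with nonzero eigenvalue of a symmetric convolution operator, then by the spectral
theorem it acts trivially on the range of the operator. -/
theorem leftReg_conv_eq (f : S →ᵇ ℂ) (hf : ∀ x, f x⁻¹ = star (f x)) (s : S)
    (hs : ∀ V : Submodule ℂ (L2 S), FiniteDimensional ℂ V →
      (∀ g, ∀ v ∈ V, leftReg g v ∈ V) → ∀ v ∈ V, leftReg s v = v) (h : L2 S) :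
    leftReg s (conv (BoundedContinuousFunction.toLp 2 Measure.haar ℂ f) h) =
      conv (BoundedContinuousFunction.toLp 2 Measure.haar ℂ f) h := by
  set T := conv (BoundedContinuousFunction.toLp 2 Measure.haar ℂ f)
  have hsym : T.IsSymmetric := isSymmetric_conv f hf
  have hcpt : IsCompactOperator T := isCompactOperator_conv _
  set D : L2 S →L[ℂ] L2 S := (leftReg s).toContinuousLinearMap.comp T - T
  have hle : (⨆ μ, Module.End.eigenspace (T : Module.End ℂ (L2 S)) μ) ≤ D.ker := by
    refine iSup_le fun μ v hv => ?_
    have hv' : T v = μ • v := Module.End.mem_eigenspace_iff.1 hv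
    change leftReg s (T v) - T v = 0
    rw [hv', map_smul, ← smul_sub]
    rcases eq_or_ne μ 0 with rfl | hμ
    · exact zero_smul _ _
    · rw [hs _ (T.finite_dimensional_eigenspace hcpt μ hμ) ?_ v hv, sub_self, smul_zero]
      intro g w hw
      have hw' : T w = μ • w := Module.End.mem_eigenspace_iff.1 hw
      refine Module.End.mem_eigenspace_iff.2 ?_
      change T (leftReg g w) = _
      rw [conv_leftReg, hw', map_smul]
  have hD : (⨆ μ, Module.End.eigenspace (T : Module.End ℂ (L2 S)) μ).topologicalClosure ≤ D.ker :=
    Submodule.topologicalClosure_minimal _ hle D.isClosed_ker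
  rw [Submodule.topologicalClosure_eq_top_iff.2
    (T.orthogonalComplement_iSup_eigenspaces_eq_bot hcpt hsym)] at hD
  exact sub_eq_zero.1 (hD (Submodule.mem_top (x := h)))

variable [T2Space S]

omit [SecondCountableTopology S] [MeasurableSpace S] [BorelSpace S] in
/-- A bump function at the unit that does not see its translate by `s`. -/
theorem exists_bump {s : S} (hs : s ≠ 1) : ∃ f : S →ᵇ ℂ, (∀ x, f x⁻¹ = star (f x)) ∧
    f 1 ≠ 0 ∧ ∀ x, f (s * x) * f x = 0 := by
  -- a neighbourhood `W` of `1` with `s ∉ W W⁻¹`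
  have hW : ∀ᶠ p : S × S in 𝓝 (1, 1), p.1 * p.2⁻¹ ≠ s := by
    have hc : Continuous fun p : S × S => p.1 * p.2⁻¹ := continuous_fst.mul continuous_snd.inv
    refine hc.continuousAt.eventually_ne ?_
    simpa using hs.symm
  rw [nhds_prod_eq] at hW
  obtain ⟨W, hW1, hW⟩ := (eventually_prod_self_iff (r := fun x y : S => x * y⁻¹ ≠ s)).1 hW
  obtain ⟨u, hu0, hu1, -⟩ := exists_continuous_zero_one_of_isClosed
    (isClosed_compl_iff.2 (isOpen_interior (s := W))) (isClosed_singleton (x := (1 : S)))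
    (by rw [disjoint_singleton_right]; simpa using mem_interior_iff_mem_nhds.2 hW1)
  refine ⟨BoundedContinuousFunction.mkOfCompact ⟨fun x => ((u x * u x⁻¹ : ℝ) : ℂ), by fun_prop⟩,
    fun x => ?_, ?_, fun x => ?_⟩
  · simp [mul_comm]
  · have : u 1 = 1 := hu1 rfl
    simp [this]
  · simp only [BoundedContinuousFunction.mkOfCompact_apply, ContinuousMap.coe_mk,
      ← Complex.ofReal_mul]
    rw [Complex.ofReal_eq_zero]
    by_contra hne
    have h1 : u (s * x) ≠ 0 := by rintro h; simp [h] at hne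
    have h2 : u x ≠ 0 := by rintro h; simp [h] at hne
    have m : ∀ y, u y ≠ 0 → y ∈ W := fun y hy => by
      by_contra hyW
      exact hy (hu0 fun hh => hyW (interior_subset hh))
    exact hW _ (m _ h1) _ (m _ h2) (by simp)

/-- Otherwise `s` would fix the function `x ↦ ⟨L_x f, f⟩` for a bump function `f` as in
`exists_bump`; but this function is not zero at `1`, and zero at `s⁻¹`. -/
theorem exists_submodule_leftReg_ne {s : S} (hs : s ≠ 1) : ∃ V : Submodule ℂ (L2 S),
    FiniteDimensional ℂ V ∧ (∀ g, ∀ v ∈ V, leftReg g v ∈ V) ∧ ∃ v ∈ V, leftReg s v ≠ v := by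
  by_contra! hcon
  obtain ⟨f, hf, hf1, hfs⟩ := exists_bump hs
  set F : L2 S := BoundedContinuousFunction.toLp 2 Measure.haar ℂ f
  have h1 := leftReg_conv_eq f hf s hcon F
  have h2 : leftReg s (BoundedContinuousFunction.toLp 2 Measure.haar ℂ (convFun F F)) =
    BoundedContinuousFunction.toLp 2 Measure.haar ℂ (convFun F F) := h1
  rw [leftReg_toLp] at h2
  have h3 := BoundedContinuousFunction.toLp_injective (p := 2) (𝕜 := ℂ) Measure.haar h2
  have h4 : convFun F F (s⁻¹ * 1) = convFun F F 1 := congrArg (fun u : S →ᵇ ℂ => u 1) h3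
  have h5 : convFun F F (s⁻¹ * 1) = 0 := by
    rw [convFun_toLp]
    refine integral_eq_zero_of_ae ?_
    filter_upwards [BoundedContinuousFunction.coeFn_toLp (p := 2) (𝕜 := ℂ) Measure.haar f]
      with y hy
    rw [hy]
    have := hfs y
    rcases mul_eq_zero.1 this with h | h <;> simp [h]
  rw [h4, convFun_apply, leftReg_one, inner_self_eq_zero] at h5
  have h6 : f = 0 := BoundedContinuousFunction.toLp_injective (p := 2) (𝕜 := ℂ) Measure.haar
    (by rw [map_zero]; exact h5)
  exact hf1 (by rw [h6]; rfl)

/-- An invariant subspace of minimal dimension on which `s` acts nontrivially is irreducible, since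
invariant subspaces have invariant orthogonal complements. -/
theorem exists_irreducible_leftReg_ne {s : S} (hs : s ≠ 1) : ∃ V : Submodule ℂ (L2 S),
    FiniteDimensional ℂ V ∧ (∀ g, ∀ v ∈ V, leftReg g v ∈ V) ∧ (∃ v ∈ V, leftReg s v ≠ v) ∧
    ∀ W ≤ V, (∀ g, ∀ w ∈ W, leftReg g w ∈ W) → W = ⊥ ∨ W = V := by
  classical
  have hex : ∃ n, ∃ V : Submodule ℂ (L2 S), FiniteDimensional ℂ V ∧
      (∀ g, ∀ v ∈ V, leftReg g v ∈ V) ∧ (∃ v ∈ V, leftReg s v ≠ v) ∧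
      Module.finrank ℂ V = n := by
    obtain ⟨V, h1, h2, h3⟩ := exists_submodule_leftReg_ne hs
    exact ⟨_, V, h1, h2, h3, rfl⟩
  obtain ⟨V, hfd, hV, hne, hrk⟩ := Nat.find_spec hex
  have hmin : ∀ W < V, (∀ g, ∀ w ∈ W, leftReg g w ∈ W) → ∀ w ∈ W, leftReg s w = w := by
    intro W hWV hW
    by_contra! hcon
    have hfW : FiniteDimensional ℂ W := Submodule.finiteDimensional_of_le hWV.le
    have := Nat.find_min' hex ⟨W, hfW, hW, hcon, rfl⟩
    have h2 := Submodule.finrank_lt_finrank_of_lt hWV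
    omega
  refine ⟨V, hfd, hV, hne, fun W hWV hW => ?_⟩
  by_contra! hcon
  have hfW : FiniteDimensional ℂ W := Submodule.finiteDimensional_of_le hWV
  have hW' : ∀ g, ∀ w ∈ Wᗮ ⊓ V, leftReg g w ∈ Wᗮ ⊓ V := by
    rintro g w ⟨hw1, hw2⟩
    refine ⟨fun u hu => ?_, hV g w hw2⟩
    have := inner_leftReg_left g⁻¹ u w
    rw [inv_inv] at this
    rw [← this]
    exact hw1 _ (hW _ _ hu)
  have hsup : W ⊔ Wᗮ ⊓ V = V := Submodule.sup_orthogonal_inf_of_hasOrthogonalProjection hWV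
  have hlt : Wᗮ ⊓ V < V := by
    refine lt_of_le_of_ne inf_le_right fun h => hcon.1 ?_
    have hVW : V ≤ Wᗮ := h ▸ inf_le_left
    rw [Submodule.eq_bot_iff]
    intro w hw
    exact inner_self_eq_zero.1 (hVW (hWV hw) w hw)
  obtain ⟨v, hv, hvne⟩ := hne
  rw [← hsup] at hv
  obtain ⟨w, hw, w', hw', rfl⟩ := Submodule.mem_sup.1 hv
  refine hvne ?_
  rw [map_add, hmin W (lt_of_le_of_ne hWV hcon.2) hW w hw, hmin _ hlt hW' w' hw']

end LeftRegular

end PeterWeyl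

open LeftRegular MeasureTheory in
/-- The Peter–Weyl theorem in the form that is needed: the irreducible matrix representations of a
compact group separate its points. -/
theorem IrrepMatrix.exists_apply_ne_one {S : Type*} [TopologicalSpace S] [Group S]
    [IsTopologicalGroup S] [CompactSpace S] [T2Space S] [SecondCountableTopology S] {s : S}
    (hs : s ≠ 1) : ∃ (n : ℕ) (r : IrrepMatrix S n), r.ρ s ≠ 1 := by
  let _ : MeasurableSpace S := borel S
  have _ : BorelSpace S := ⟨rfl⟩
  obtain ⟨V, hfd, hV, ⟨v, hv, hvne⟩, hirr⟩ := exists_irreducible_leftReg_ne hs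
  let R : S →* Module.End ℂ V :=
    { toFun := fun g => (leftReg g).toLinearMap.restrict (hV g)
      map_one' := by
        ext w
        simp [LinearMap.restrict_apply, leftReg_one]
      map_mul' := fun g g' => by
        ext w
        simp [LinearMap.restrict_apply, leftReg_mul] }
  have hR : ∀ g (w : V), (R g w : L2 S) = leftReg g w := fun g w => rfl
  let b := Module.finBasis ℂ V
  refine ⟨Module.finrank ℂ V,
    { ρ := ((LinearMap.toMatrixAlgEquiv b : Module.End ℂ V ≃ₐ[ℂ] _) : Module.End ℂ V →* _).comp R
      continuous := ?_
      pos := ?_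
      irreducible := ?_ }, ?_⟩
  · refine continuous_matrix fun i j => ?_
    have h1 : ∀ g, LinearMap.toMatrixAlgEquiv b (R g) i j = b.coord i (R g (b j)) := fun g => by
      simp [LinearMap.toMatrixAlgEquiv_apply]
    simp only [MonoidHom.comp_apply]
    refine Continuous.congr ?_ fun g => (h1 g).symm
    refine (LinearMap.continuous_of_finiteDimensional (b.coord i)).comp ?_
    exact (continuous_leftReg _).subtype_mk _
  · have : Nontrivial V := ⟨⟨v, hv⟩, 0, fun h => hvne (by
      rw [Subtype.ext_iff] at h
      simp only [ZeroMemClass.coe_zero] at h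
      rw [h, map_zero])⟩
    exact Module.finrank_pos
  · intro W hW
    let e : (Fin (Module.finrank ℂ V) → ℂ) ≃ₗ[ℂ] V := b.equivFun.symm
    let j : (Fin (Module.finrank ℂ V) → ℂ) →ₗ[ℂ] L2 S := V.subtype ∘ₗ e.toLinearMap
    have hj : Function.Injective j := V.subtype_injective.comp e.injective
    have hact : ∀ g w, j (LinearMap.toMatrixAlgEquiv b (R g) *ᵥ w) = leftReg g (j w) := by
      intro g w
      change ((e _ : V) : L2 S) = leftReg g (e w : V)
      rw [← hR]
      congr 1
      refine b.equivFun.symm_apply_eq.2 ?_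
      have := LinearMap.toMatrix_mulVec_repr b b (R g) (e w)
      have h3 : ((b.repr (e w)) : Fin (Module.finrank ℂ V) → ℂ) = w :=
        b.equivFun.apply_symm_apply w
      rw [h3] at this
      exact this
    have hle : W.map j ≤ V := by
      rintro _ ⟨w, -, rfl⟩
      exact (e w).2
    have hinv : ∀ g, ∀ w ∈ W.map j, leftReg g w ∈ W.map j := by
      rintro g _ ⟨w, hw, rfl⟩
      exact ⟨_, hW g w hw, hact g w⟩
    rcases hirr (W.map j) hle hinv with h | h
    · left
      exact Submodule.map_injective_of_injective hj (h.trans (Submodule.map_bot _).symm)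
    · right
      rw [Submodule.eq_top_iff']
      intro w
      have : j w ∈ W.map j := by rw [h]; exact (e w).2
      obtain ⟨w', hw', h'⟩ := this
      rwa [← hj h']
  · intro h
    have h1 : LinearMap.toMatrixAlgEquiv b (R s) = 1 := h
    rw [EmbeddingLike.map_eq_one_iff] at h1
    exact hvne (by rw [← hR s ⟨v, hv⟩, h1]; rfl)

/-! ### Subdivisions -/

/-- `[a,b]` has a subdivision all of whose intervals `[x,y]` satisfy `R x y`: there is a finite
chain of such intervals from `a` to `b`. -/
def Chain (R : ℝ → ℝ → Prop) : ℝ → ℝ → Prop :=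
  Relation.TransGen fun x y => x < y ∧ R x y

namespace Chain

variable {R R' : ℝ → ℝ → Prop} {a b c : ℝ}

theorem single (h : a < b) (hR : R a b) : Chain R a b :=
  Relation.TransGen.single ⟨h, hR⟩

theorem trans (h : Chain R a b) (h' : Chain R b c) : Chain R a c := Relation.TransGen.trans h h'

theorem lt (h : Chain R a b) : a < b := by
  induction h with
  | single h => exact h.1
  | tail _ h ih => exact ih.trans h.1

theorem mono (h : Chain R a b)
    (hR : ∀ x y, a ≤ x → x < y → y ≤ b → R x y → R' x y) : Chain R' a b := by
  induction h with
  | single h => exact single h.1 (hR _ _ le_rfl h.1 le_rfl h.2)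
  | tail h h' ih =>
    exact (ih fun x y hx hxy hy => hR x y hx hxy (hy.trans h'.1.le)).trans
      (single h'.1 (hR _ _ (lt h).le h'.1 le_rfl h'.2))

theorem restrict (h : Chain R a b)
    (hR : ∀ x y x' y', R x y → x ≤ x' → x' < y' → y' ≤ y → R x' y') {x y : ℝ} (hx : a ≤ x)
    (hxy : x < y) (hy : y ≤ b) : Chain R x y := by
  induction h generalizing x y with
  | single h => exact single hxy (hR _ _ _ _ h.2 hx hxy hy)
  | @tail m b' _ h' ih =>
    rcases le_or_gt y m with hym | hym
    · exact ih hx hxy hym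
    rcases le_or_gt m x with hmx | hmx
    · exact single hxy (hR _ _ _ _ h'.2 hmx hxy hy)
    · exact (ih hx hmx le_rfl).trans (single hym (hR _ _ _ _ h'.2 le_rfl hym hy))

theorem reflect (h : Chain R a b) (s : ℝ)
    (hR : ∀ x y, a ≤ x → x < y → y ≤ b → R x y → R' (s - y) (s - x)) :
    Chain R' (s - b) (s - a) := by
  induction h with
  | single h => exact single (by linarith [h.1]) (hR _ _ le_rfl h.1 le_rfl h.2)
  | tail h h' ih =>
    exact (single (by linarith [h'.1]) (hR _ _ (lt h).le h'.1 le_rfl h'.2)).trans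
      (ih fun x y hx hxy hy => hR x y hx hxy (hy.trans h'.1.le))

theorem exists_fin (h : Chain R a b) : ∃ (n : ℕ) (τ : Fin (n + 1) → ℝ), StrictMono τ ∧
    τ 0 = a ∧ τ (Fin.last n) = b ∧ ∀ i : Fin n, R (τ i.castSucc) (τ i.succ) := by
  suffices ∃ (n : ℕ) (τ : Fin (n + 1) → ℝ), τ 0 = a ∧ τ (Fin.last n) = b ∧
      ∀ i : Fin n, τ i.castSucc < τ i.succ ∧ R (τ i.castSucc) (τ i.succ) by
    obtain ⟨n, τ, h0, h1, h2⟩ := this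
    exact ⟨n, τ, Fin.strictMono_iff_lt_succ.2 fun i => (h2 i).1, h0, h1, fun i => (h2 i).2⟩
  induction h with
  | @single b h =>
    refine ⟨1, ![a, b], rfl, rfl, fun i => ?_⟩
    fin_cases i
    exact h
  | @tail m b _ h ih =>
    obtain ⟨n, τ, h0, h1, h2⟩ := ih
    refine ⟨n + 1, Fin.snoc τ b, ?_, Fin.snoc_last _ _, fun i => ?_⟩
    · rw [← Fin.castSucc_zero, Fin.snoc_castSucc, h0]
    · refine Fin.lastCases ?_ (fun j => ?_) i
      · rw [Fin.snoc_castSucc, Fin.succ_last, Fin.snoc_last, h1]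
        exact h
      · rw [Fin.snoc_castSucc, Fin.succ_castSucc, Fin.snoc_castSucc]
        exact h2 j

theorem of_fin {n : ℕ} {τ : Fin (n + 1) → ℝ} (hτ : StrictMono τ) (h0 : τ 0 = a)
    (h1 : τ (Fin.last n) = b) (hab : a < b) (h : ∀ i : Fin n, R (τ i.castSucc) (τ i.succ)) :
    Chain R a b := by
  have key : ∀ i : Fin (n + 1), i ≠ 0 → Chain R a (τ i) := by
    intro i
    refine Fin.induction (fun h => absurd rfl h) (fun i ih _ => ?_) i
    have hs : Chain R (τ i.castSucc) (τ i.succ) := single (hτ Fin.castSucc_lt_succ) (h i)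
    by_cases hi : i.castSucc = 0
    · rwa [hi, h0] at hs
    · exact (ih hi).trans hs
  rw [← h1]
  refine key _ fun h => ?_
  rw [h, h0] at h1
  exact hab.ne h1

end Chain

namespace Curve

variable {M N : Type*}

theorem exists_subdivision_iff (γ : Curve M) (R : ℝ → ℝ → Prop) :
    (∃ D : γ.Subdivision, ∀ i : Fin D.n, R (D.τ i.castSucc) (D.τ i.succ)) ↔
      Chain R γ.a γ.b := by
  constructor
  · rintro ⟨D, hD⟩
    exact Chain.of_fin D.strictMono D.first D.last γ.lt hD
  · intro h
    obtain ⟨n, τ, h1, h2, h3, h4⟩ := h.exists_fin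
    exact ⟨⟨n, τ, h1, h2, h3⟩, h4⟩

theorem extend_apply (γ : Curve M) (t : Icc γ.a γ.b) : γ.extend t = γ.toFun t :=
  IccExtend_val _ _ _

theorem extend_of_mem (γ : Curve M) {t : ℝ} (ht : t ∈ Icc γ.a γ.b) :
    γ.extend t = γ.toFun ⟨t, ht⟩ := IccExtend_of_mem _ _ ht

theorem extend_a (γ : Curve M) : γ.extend γ.a = γ.startPoint :=
  γ.extend_of_mem ⟨le_rfl, γ.lt.le⟩

theorem extend_b (γ : Curve M) : γ.extend γ.b = γ.endPoint :=
  γ.extend_of_mem ⟨γ.lt.le, le_rfl⟩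

theorem endPoint_map (f : M → N) (γ : Curve M) : (γ.map f).endPoint = f γ.endPoint := rfl

theorem extend_restrict (γ : Curve M) {c d : ℝ} (hc : γ.a ≤ c) (hcd : c < d) (hd : d ≤ γ.b) :
    EqOn (γ.restrict c d hc hcd hd).extend γ.extend (Icc c d) := by
  intro t ht
  rw [extend_of_mem _ (t := t) ht, extend_of_mem _ ⟨hc.trans ht.1, ht.2.trans hd⟩]
  rfl

theorem Subdivision.a_le {γ : Curve M} (D : γ.Subdivision) (i : Fin (D.n + 1)) : γ.a ≤ D.τ i :=
  D.first ▸ D.strictMono.monotone (Fin.zero_le _)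

theorem Subdivision.le_b {γ : Curve M} (D : γ.Subdivision) (i : Fin (D.n + 1)) : D.τ i ≤ γ.b :=
  D.last ▸ D.strictMono.monotone (Fin.le_last _)

theorem extend_piece (γ : Curve M) (D : γ.Subdivision) (i : Fin D.n) :
    EqOn (γ.piece D i).extend γ.extend (Icc (D.τ i.castSucc) (D.τ i.succ)) :=
  γ.extend_restrict _ _ _

theorem startPoint_piece (γ : Curve M) (D : γ.Subdivision) (i : Fin D.n) :
    (γ.piece D i).startPoint = γ.extend (D.τ i.castSucc) := by
  rw [← extend_a]
  exact γ.extend_piece D i ⟨le_rfl, (γ.piece D i).lt.le⟩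

theorem endPoint_piece (γ : Curve M) (D : γ.Subdivision) (i : Fin D.n) :
    (γ.piece D i).endPoint = γ.extend (D.τ i.succ) := by
  rw [← extend_b]
  exact γ.extend_piece D i ⟨(γ.piece D i).lt.le, le_rfl⟩

theorem extend_inv (γ : Curve M) :
    EqOn γ.inv.extend (fun t => γ.extend (γ.a + γ.b - t)) (Icc γ.a γ.b) := by
  intro t ht
  rw [extend_of_mem γ.inv (t := t) ht]
  change _ = γ.extend (γ.a + γ.b - t)
  rw [extend_of_mem γ (t := γ.a + γ.b - t) ⟨by linarith [ht.2], by linarith [ht.1]⟩]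
  simp only [inv, add_comm]

section Regularity

variable {E H : Type*} [NormedAddCommGroup E] [NormedSpace ℝ E] [TopologicalSpace H]
  (I : ModelWithCorners ℝ E H) [TopologicalSpace M] [ChartedSpace H M]

/-- The map `c` is of class `C^k` on `[x,y]`: it agrees there with a `C^k` map on an open
interval. -/
def SmoothOn (k : ℕ∞ω) (c : ℝ → M) (x y : ℝ) : Prop :=
  ∃ (u v : ℝ) (f : ℝ → M), u < x ∧ y < v ∧ ContMDiffOn 𝓘(ℝ, ℝ) I k f (Ioo u v) ∧
    EqOn f c (Icc x y)

theorem isClass_piece_iff (k : ℕ∞ω) (γ : Curve M) (D : γ.Subdivision) (i : Fin D.n) :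
    (γ.piece D i).IsClass I k ↔ SmoothOn I k γ.extend (D.τ i.castSucc) (D.τ i.succ) := by
  refine exists₃_congr fun u v f => and_congr_right fun _ => and_congr_right fun _ =>
    and_congr_right fun _ => ?_
  constructor
  · intro h t ht
    rw [← γ.extend_piece D i ht]
    exact (h ⟨t, ht⟩).trans (extend_apply _ _).symm
  · intro h t
    rw [← extend_apply, γ.extend_piece D i t.2]
    exact h t.2

theorem isPath_iff (k : ℕ∞ω) (γ : Curve M) :
    γ.IsPath I k ↔ Chain (SmoothOn I k γ.extend) γ.a γ.b := by
  rw [← exists_subdivision_iff]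
  exact exists_congr fun D => forall_congr' fun i => isClass_piece_iff I k γ D i

end Regularity

end Curve

/-! ### Velocities -/

section Velocity

variable {E H : Type*} [NormedAddCommGroup E] [NormedSpace ℝ E] [TopologicalSpace H]
  (I : ModelWithCorners ℝ E H) {M : Type*} [TopologicalSpace M] [ChartedSpace H M]
  {E' H' : Type*} [NormedAddCommGroup E'] [NormedSpace ℝ E'] [TopologicalSpace H']
  {I' : ModelWithCorners ℝ E' H'} {M' : Type*} [TopologicalSpace M'] [ChartedSpace H' M']

/-- The velocity `c'(t)` of the curve `c`, as an element of the model space. -/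
noncomputable def velocity (c : ℝ → M) (t : ℝ) : E :=
  (mfderiv 𝓘(ℝ, ℝ) I c t : ℝ →L[ℝ] E) 1

variable (I') in
/-- The differential of `F` at `x`, as a map between the model spaces; its type does not depend
on `x`. -/
noncomputable def differential (F : M → M') (x : M) : E →L[ℝ] E' := mfderiv I I' F x

variable {I}

theorem velocity_congr {c c' : ℝ → M} {t : ℝ} (h : c =ᶠ[𝓝 t] c') :
    velocity I c t = velocity I c' t := by
  unfold velocity
  rw [h.mfderiv_eq]
  rfl

theorem velocity_comp {F : M → M'} {c : ℝ → M} {t : ℝ} (hF : MDifferentiableAt I I' F (c t))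
    (hc : MDifferentiableAt 𝓘(ℝ, ℝ) I c t) :
    velocity I' (fun t => F (c t)) t =
      differential I I' F (c t) (velocity I c t) :=
  mfderiv_comp_apply t hF hc _

theorem differential_comp {E'' H'' M'' : Type*} [NormedAddCommGroup E''] [NormedSpace ℝ E'']
    [TopologicalSpace H''] {I'' : ModelWithCorners ℝ E'' H''} [TopologicalSpace M'']
    [ChartedSpace H'' M''] {F : M → M'} {F' : M' → M''} {x : M}
    (hF' : MDifferentiableAt I' I'' F' (F x)) (hF : MDifferentiableAt I I' F x) (v : E) :
    differential I I'' (fun x => F' (F x)) x v =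
      differential I' I'' F' (F x) (differential I I' F x v) :=
  mfderiv_comp_apply x hF' hF v

theorem differential_id (x : M) (v : E) : differential I I (fun x : M => x) x v = v := by
  have : differential I I (fun x : M => x) x = ContinuousLinearMap.id ℝ E := mfderiv_id
  rw [this]
  rfl

theorem velocity_eq_deriv (u : ℝ → E) (t : ℝ) : velocity 𝓘(ℝ, E) u t = deriv u t := by
  unfold velocity
  rw [mfderiv_eq_fderiv]
  rfl

/-- A continuous curve whose velocity vanishes at all but finitely many times is constant. -/
theorem eq_of_velocity_eq_zero [FiniteDimensional ℝ E] [IsManifold I 1 M] {s : ℝ → M} {x y : ℝ}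
    (hxy : x ≤ y)
    (hc : ContinuousOn s (Icc x y)) {F : Set ℝ} (hF : F.Finite)
    (hs : ∀ t ∈ Ioo x y \ F, MDifferentiableAt 𝓘(ℝ, ℝ) I s t ∧ velocity I s t = 0) :
    s x = s y := by
  have := FiniteDimensional.complete ℝ E
  refine isPreconnected_Icc.induction₂ (s := Icc x y) (fun t t' => s t = s t') ?_
    (fun _ _ _ _ _ _ h h' => h.trans h') (fun _ _ _ _ h => h.symm)
    (left_mem_Icc.2 hxy) (right_mem_Icc.2 hxy)
  intro t₀ ht₀
  have h1 : ∀ᶠ t in 𝓝[Icc x y] t₀, s t ∈ (chartAt H (s t₀)).source :=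
    (hc t₀ ht₀) ((chartAt H (s t₀)).open_source.mem_nhds (mem_chart_source H (s t₀)))
  obtain ⟨ε, hε, h2⟩ := Metric.mem_nhdsWithin_iff.1 h1
  filter_upwards [inter_mem_nhdsWithin (Icc x y) (Metric.ball_mem_nhds t₀ hε)] with t ht
  -- the whole interval between `t₀` and `t` is mapped into the chart domain
  have hsub : uIcc t₀ t ⊆ Metric.ball t₀ ε ∩ Icc x y := by
    refine subset_inter ?_ (OrdConnected.uIcc_subset ordConnected_Icc ht₀ ht.1)
    have : OrdConnected (Metric.ball t₀ ε) := by
      rw [Real.ball_eq_Ioo]; exact ordConnected_Ioo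
    exact this.uIcc_subset (Metric.mem_ball_self hε) ht.2
  have hch : ∀ r ∈ uIcc t₀ t, s r ∈ (chartAt H (s t₀)).source := fun r hr => h2 (hsub hr)
  have hu : ContinuousOn (fun r => extChartAt I (s t₀) (s r)) (uIcc t₀ t) := by
    refine (continuousOn_extChartAt (s t₀)).comp (hc.mono fun r hr => (hsub hr).2) fun r hr => ?_
    rw [extChartAt_source]
    exact hch r hr
  have hder : ∀ r ∈ Ioo (min t₀ t) (max t₀ t) \ F,
      HasDerivAt (fun r => extChartAt I (s t₀) (s r)) ((fun _ => (0 : E)) r) r := by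
    rintro r ⟨hr, hrF⟩
    have hr' : r ∈ uIcc t₀ t := Ioo_subset_Icc_self hr
    have hrI : r ∈ Ioo x y := by
      have e1 := (hsub (show min t₀ t ∈ uIcc t₀ t from left_mem_Icc.2 min_le_max)).2
      have e2 := (hsub (show max t₀ t ∈ uIcc t₀ t from right_mem_Icc.2 min_le_max)).2
      exact ⟨e1.1.trans_lt hr.1, hr.2.trans_le e2.2⟩
    obtain ⟨hd, hv⟩ := hs r ⟨hrI, hrF⟩
    have hE : MDifferentiableAt I 𝓘(ℝ, E) (extChartAt I (s t₀)) (s r) :=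
      mdifferentiableAt_extChartAt (hch r hr')
    have hv2 := velocity_comp hE hd
    rw [hv, map_zero, velocity_eq_deriv] at hv2
    have hd2 : MDifferentiableAt 𝓘(ℝ, ℝ) 𝓘(ℝ, E) (fun r => extChartAt I (s t₀) (s r)) r :=
      hE.comp r hd
    have := hd2.differentiableAt.hasDerivAt
    rwa [hv2] at this
  have hint := MeasureTheory.integral_eq_of_hasDerivAt_off_countable _ _ hF.countable hu hder
    intervalIntegrable_const
  rw [intervalIntegral.integral_zero, eq_comm, sub_eq_zero] at hint
  refine ((extChartAt I (s t₀)).injOn ?_ ?_ hint).symm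
  · rw [extChartAt_source]; exact hch t right_mem_uIcc
  · exact mem_extChartAt_source _

end Velocity

/-! ### Horizontal curves -/

section Bundle

variable {EP HP EM HM ES HS : Type*}
  [NormedAddCommGroup EP] [NormedSpace ℝ EP] [TopologicalSpace HP]
  [NormedAddCommGroup EM] [NormedSpace ℝ EM] [TopologicalSpace HM]
  [NormedAddCommGroup ES] [NormedSpace ℝ ES] [TopologicalSpace HS]
  {IP : ModelWithCorners ℝ EP HP} {IM : ModelWithCorners ℝ EM HM}
  {IS : ModelWithCorners ℝ ES HS} {P M S : Type*}
  [TopologicalSpace P] [ChartedSpace HP P] [TopologicalSpace M] [ChartedSpace HM M]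
  [TopologicalSpace S] [ChartedSpace HS S] [Group S]
  {B : PrincipalBundle IP IM IS P M S}

namespace PrincipalBundle

theorem act_diff {p q : P} (h : B.proj p = B.proj q) : B.act p (B.diff p q) = q := by
  have hex : ∃ s, q = B.act p s := (B.existsUnique_act p q h).exists
  rw [diff, dif_pos hex]
  exact hex.choose_spec.symm

theorem act_right_cancel {p : P} {s t : S} (h : B.act p s = B.act p t) : s = t :=
  (B.existsUnique_act p (B.act p t) (B.proj_act p t).symm).unique h.symm rfl

theorem diff_act (p : P) (s : S) : B.diff p (B.act p s) = s :=
  act_right_cancel (act_diff (B.proj_act p s).symm)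

theorem diff_eq_iff {p q : P} (h : B.proj p = B.proj q) {s : S} : B.diff p q = s ↔ q = B.act p s :=
  ⟨fun hs => by rw [← hs, act_diff h], fun hs => by rw [hs, diff_act]⟩

section LieGroup

variable [LieGroup IS ∞ S]

theorem mdifferentiableAt_mul_left (s h : S) : MDifferentiableAt IS IS (fun h => s * h) h :=
  (contMDiff_mul_left (I := IS) (n := ∞) (a := s)).mdifferentiableAt (by simp)

theorem mdifferentiableAt_mul_right (s h : S) : MDifferentiableAt IS IS (fun h => h * s) h :=
  (contMDiff_mul_right (I := IS) (n := ∞) (a := s)).mdifferentiableAt (by simp)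

theorem differential_conj_inv (s : S) (v : ES) :
    differential IS IS (fun h => s⁻¹ * h * s⁻¹⁻¹) 1 v =
    differential IS IS (fun h => s⁻¹ * h) s (differential IS IS (fun h => h * s) 1 v) := by
  have h1 := differential_comp (x := (1 : S)) (F := fun h => h * s) (F' := fun h => s⁻¹ * h)
    (mdifferentiableAt_mul_left (IS := IS) s⁻¹ _) (mdifferentiableAt_mul_right s 1) v
  have h2 : (fun h : S => s⁻¹ * h * s⁻¹⁻¹) = fun h => s⁻¹ * (h * s) := by
    funext h; rw [inv_inv, mul_assoc]
  rw [h2, h1, one_mul]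

theorem differential_mul_left_injective (s h : S) :
    Function.Injective (differential IS IS (fun h => s * h) h) := by
  refine Function.LeftInverse.injective (g := differential IS IS (fun h => s⁻¹ * h) (s * h))
    fun v => ?_
  rw [← differential_comp (F := fun h => s * h) (F' := fun h => s⁻¹ * h)
    (mdifferentiableAt_mul_left _ _) (mdifferentiableAt_mul_left _ _)]
  simp only [inv_mul_cancel_left]
  exact differential_id h v

omit [LieGroup IS ∞ S] in
theorem mdifferentiableAt_orbit (p : P) (s : S) :
    MDifferentiableAt IS IP (fun s => B.act p s) s := AutAction.mdifferentiable_orbit B p s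

/-- The differential of the orbit map at `s` in terms of fundamental vectors. -/
theorem differential_orbit (p : P) (s : S) (w : ES) :
    differential IS IP (fun s => B.act p s) s w =
      differential IS IP (fun h => B.act (B.act p s) h) 1
        (differential IS IS (fun h => s⁻¹ * h) s w) := by
  have h1 := differential_comp (x := s) (F := fun h => s⁻¹ * h)
    (F' := fun h => B.act (B.act p s) h) (mdifferentiableAt_orbit _ _)
    (mdifferentiableAt_mul_left (IS := IS) s⁻¹ s) w
  simp only [← B.act_mul, mul_inv_cancel_left] at h1
  rw [h1, inv_mul_cancel]
  simp only [B.act_mul]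

/-- The product rule for the curve `t ↦ c(t) · s(t)`. -/
theorem velocity_act {c : ℝ → P} {s : ℝ → S} {t : ℝ} (hc : MDifferentiableAt 𝓘(ℝ, ℝ) IP c t)
    (hs : MDifferentiableAt 𝓘(ℝ, ℝ) IS s t) :
    velocity IP (fun t => B.act (c t) (s t)) t =
      differential IP IP (fun q => B.act q (s t)) (c t) (velocity IP c t) +
        differential IS IP (fun h => B.act (B.act (c t) (s t)) h) 1
          (differential IS IS (fun h => (s t)⁻¹ * h) (s t) (velocity IS s t)) := by
  have hact : MDifferentiableAt (IP.prod IS) IP (fun x : P × S => B.act x.1 x.2) (c t, s t) :=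
    B.contMDiff_act.mdifferentiableAt (by simp)
  have h1 := velocity_comp (c := fun t => (c t, s t)) hact (hc.prodMk hs)
  refine h1.trans ?_
  have h2 : velocity (IP.prod IS) (fun t => (c t, s t)) t = (velocity IP c t, velocity IS s t) := by
    unfold velocity
    rw [mfderiv_prodMk hc hs]
    rfl
  rw [h2, ← differential_orbit]
  have h3 := mfderiv_prod_eq_add_apply (v := (velocity IP c t, velocity IS s t)) hact
  exact h3

end LieGroup

variable [IsManifold IP ∞ P]

/-- The value of a connection, as an element of the model space of the group. -/
noncomputable def Connection.val (A : B.Connection) (p : P) (v : EP) : ES := A.form p v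

theorem Connection.val_add (A : B.Connection) (p : P) (v w : EP) :
    A.val p (v + w) = A.val p v + A.val p w := map_add (A.form p) v w

theorem Connection.val_act (A : B.Connection) (p : P) (s : S) (v : EP) :
    A.val (B.act p s) (differential IP IP (fun q => B.act q s) p v) =
      differential IS IS (fun h => s⁻¹ * h * s⁻¹⁻¹) 1 (A.val p v) := A.equivariant p s v

theorem Connection.val_fundamental (A : B.Connection) (p : P) (v : ES) :
    A.val p (differential IS IP (fun h => B.act p h) 1 v) = v := A.vertical p v

/-- The derivative of the curve `t ↦ c(t) · s(t)` is mapped by a connection `A` to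
`Ad(s⁻¹) A(c') + s⁻¹ s'`. -/
theorem Connection.val_velocity_act [LieGroup IS ∞ S] (A : B.Connection) {c : ℝ → P} {s : ℝ → S}
    {t : ℝ} (hc : MDifferentiableAt 𝓘(ℝ, ℝ) IP c t) (hs : MDifferentiableAt 𝓘(ℝ, ℝ) IS s t) :
    A.val (B.act (c t) (s t)) (velocity IP (fun t => B.act (c t) (s t)) t) =
      differential IS IS (fun h => (s t)⁻¹ * h * (s t)⁻¹⁻¹) 1 (A.val (c t) (velocity IP c t)) +
        differential IS IS (fun h => (s t)⁻¹ * h) (s t) (velocity IS s t) := by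
  rw [velocity_act hc hs, A.val_add, A.val_act, A.val_fundamental]

/-- `c` is differentiable with horizontal velocity at the time `t`. -/
def Connection.IsHorizontalAt (A : B.Connection) (c : ℝ → P) (t : ℝ) : Prop :=
  MDifferentiableAt 𝓘(ℝ, ℝ) IP c t ∧ A.val (c t) (velocity IP c t) = 0

theorem Connection.IsHorizontalAt.congr {A : B.Connection} {c c' : ℝ → P} {t : ℝ}
    (h : A.IsHorizontalAt c t) (hc : c' =ᶠ[𝓝 t] c) : A.IsHorizontalAt c' t :=
  ⟨h.1.congr_of_eventuallyEq hc, by rw [velocity_congr hc, hc.eq_of_nhds]; exact h.2⟩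

/-! ### Uniqueness of horizontal lifts -/

omit [IsManifold IP ∞ P] in
/-- In a local trivialization, the action of `S` becomes the multiplication in `S`. -/
theorem exists_fibreCoordinate (m : M) : ∃ (U : Set M) (ψ : P → S), IsOpen U ∧ m ∈ U ∧
    ContMDiffOn IP IS ∞ ψ (B.proj ⁻¹' U) ∧
    ∀ p, B.proj p ∈ U → ∀ s, ψ (B.act p s) = ψ p * s := by
  obtain ⟨U, φ, hU, hm, hs, -, hφ, -, hact⟩ := B.locallyTrivial m
  refine ⟨U, fun p => (φ p).2, hU, hm, ?_, fun p hp s => ?_⟩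
  · rw [← hs]
    exact contMDiff_snd.comp_contMDiffOn hφ
  · change (φ (B.act p s)).2 = (φ p).2 * s
    rw [hact p (hs ▸ hp)]

omit [IsManifold IP ∞ P] in
/-- In a local trivialization, the element of `S` by which two points of a fibre differ is a smooth
function of these points. -/
theorem exists_diff_eq (m : M) : ∃ (U : Set M) (ψ : P → S), IsOpen U ∧ m ∈ U ∧
    ContMDiffOn IP IS ∞ ψ (B.proj ⁻¹' U) ∧
    ∀ p q, B.proj p = B.proj q → B.proj p ∈ U → B.diff p q = (ψ p)⁻¹ * ψ q := by
  obtain ⟨U, ψ, hU, hm, hψ, hact⟩ := B.exists_fibreCoordinate m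
  refine ⟨U, ψ, hU, hm, hψ, fun p q hpq hp => ?_⟩
  rw [eq_inv_mul_iff_mul_eq, ← hact p hp, act_diff hpq]

variable [LieGroup IS ∞ S]

omit [IsManifold IP ∞ P] in
theorem continuousOn_diff {c c' : ℝ → P} {T : Set ℝ} (hc : ContinuousOn c T)
    (hc' : ContinuousOn c' T) (h : ∀ t ∈ T, B.proj (c t) = B.proj (c' t)) :
    ContinuousOn (fun t => B.diff (c t) (c' t)) T := by
  have := topologicalGroup_of_lieGroup IS ∞ (G := S)
  intro t ht
  obtain ⟨U, ψ, hU, hm, hψ, hd⟩ := B.exists_diff_eq (B.proj (c t))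
  have hV : IsOpen (B.proj ⁻¹' U) := hU.preimage B.contMDiff_proj.continuous
  have h1 : ContinuousAt ψ (c t) := hψ.continuousOn.continuousAt (hV.mem_nhds hm)
  have h2 : ContinuousAt ψ (c' t) :=
    hψ.continuousOn.continuousAt (hV.mem_nhds (by rw [mem_preimage, ← h t ht]; exact hm))
  refine ((h1.comp_continuousWithinAt (hc t ht)).inv.mul
    (h2.comp_continuousWithinAt (hc' t ht))).congr_of_eventuallyEq ?_
    (hd _ _ (h t ht) hm)
  filter_upwards [self_mem_nhdsWithin, (hc t ht) (hV.mem_nhds hm)] with r hr hrU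
  exact hd _ _ (h r hr) hrU

omit [IsManifold IP ∞ P] in
theorem mdifferentiableAt_diff {c c' : ℝ → P} {t : ℝ} (hc : MDifferentiableAt 𝓘(ℝ, ℝ) IP c t)
    (hc' : MDifferentiableAt 𝓘(ℝ, ℝ) IP c' t) (h : ∀ᶠ r in 𝓝 t, B.proj (c r) = B.proj (c' r)) :
    MDifferentiableAt 𝓘(ℝ, ℝ) IS (fun t => B.diff (c t) (c' t)) t := by
  obtain ⟨U, ψ, hU, hm, hψ, hd⟩ := B.exists_diff_eq (B.proj (c t))
  have hV : IsOpen (B.proj ⁻¹' U) := hU.preimage B.contMDiff_proj.continuous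
  have hm' : c' t ∈ B.proj ⁻¹' U := by rw [mem_preimage, ← h.self_of_nhds]; exact hm
  have h1 : MDifferentiableAt IP IS ψ (c t) :=
    (hψ.contMDiffAt (hV.mem_nhds hm)).mdifferentiableAt (by simp)
  have h2 : MDifferentiableAt IP IS ψ (c' t) :=
    (hψ.contMDiffAt (hV.mem_nhds hm')).mdifferentiableAt (by simp)
  have hdiv : MDifferentiableAt (IS.prod IS) IS (fun x : S × S => x.1⁻¹ * x.2)
      (ψ (c t), ψ (c' t)) :=
    ((contMDiff_fst.inv).mul contMDiff_snd).mdifferentiableAt (n := ∞) (by simp)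
  refine (hdiv.comp t ((h1.comp t hc).prodMk (h2.comp t hc'))).congr_of_eventuallyEq ?_
  filter_upwards [h, hc.continuousAt (hV.mem_nhds hm)] with r hr hrU
  exact hd _ _ hr hrU

/-- If `c' = c · s` with horizontal `c` and `c'`, then `s⁻¹ s' = 0`, so `s` is constant. -/
theorem Connection.eq_of_isHorizontalAt [FiniteDimensional ℝ ES] (A : B.Connection) {c c' : ℝ → P}
    {x y : ℝ} (hxy : x ≤ y) {F F' : Set ℝ} (hF : F.Finite) (hF' : F'.Finite)
    (hc : ContinuousOn c (Icc x y)) (hc' : ContinuousOn c' (Icc x y))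
    (h : ∀ t ∈ Ioo x y \ F, A.IsHorizontalAt c t) (h' : ∀ t ∈ Ioo x y \ F', A.IsHorizontalAt c' t)
    (hp : ∀ t ∈ Icc x y, B.proj (c t) = B.proj (c' t)) (h0 : c x = c' x) : c y = c' y := by
  have : IsManifold IS 1 S := IsManifold.of_le (n := ∞) (by simp)
  have key := eq_of_velocity_eq_zero (I := IS) (s := fun t => B.diff (c t) (c' t)) hxy
    (continuousOn_diff hc hc' hp) (hF.union hF') ?_
  · have hx := act_diff (hp x (left_mem_Icc.2 hxy))
    have hy := act_diff (hp y (right_mem_Icc.2 hxy))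
    rw [← hy, ← key]
    have : B.diff (c x) (c' x) = 1 := by
      rw [diff_eq_iff (hp x (left_mem_Icc.2 hxy)), B.act_one, h0]
    rw [this, B.act_one]
  · rintro t ⟨ht, htF⟩
    obtain ⟨hd, hv⟩ := h t ⟨ht, fun hh => htF (Or.inl hh)⟩
    obtain ⟨hd', hv'⟩ := h' t ⟨ht, fun hh => htF (Or.inr hh)⟩
    have hev : ∀ᶠ r in 𝓝 t, B.proj (c r) = B.proj (c' r) := by
      filter_upwards [isOpen_Ioo.mem_nhds ht] with r hr
      exact hp r (Ioo_subset_Icc_self hr)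
    have hs := mdifferentiableAt_diff hd hd' hev
    refine ⟨hs, ?_⟩
    have hcongr : (fun r => B.act (c r) (B.diff (c r) (c' r))) =ᶠ[𝓝 t] c' := by
      filter_upwards [hev] with r hr
      exact act_diff hr
    have h1 := A.val_velocity_act hd hs
    rw [velocity_congr hcongr, act_diff hev.self_of_nhds, hv', hv, map_zero, zero_add] at h1
    refine differential_mul_left_injective _ _ (h1.symm.trans ?_)
    rw [map_zero]

end PrincipalBundle

end Bundle

/-! ### Existence of horizontal lifts -/

section Chart

variable {E H : Type*} [NormedAddCommGroup E] [NormedSpace ℝ E] [TopologicalSpace H]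
  {I : ModelWithCorners ℝ E H} {M : Type*} [TopologicalSpace M] [ChartedSpace H M]
  {E' H' : Type*} [NormedAddCommGroup E'] [NormedSpace ℝ E'] [TopologicalSpace H']
  {I' : ModelWithCorners ℝ E' H'} {M' : Type*} [TopologicalSpace M'] [ChartedSpace H' M']

theorem differential_congr {F F' : M → M'} {x : M} (h : F =ᶠ[𝓝 x] F') :
    differential I I' F x = differential I I' F' x := by
  unfold differential
  rw [h.mfderiv_eq]

theorem mdifferentiableAt_extChartAt_symm' [IsManifold I 1 M] [I.Boundaryless] {x : M} {u : E}
    (hu : u ∈ (extChartAt I x).target) :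
    MDifferentiableAt 𝓘(ℝ, E) I (extChartAt I x).symm u :=
  ((contMDiffOn_extChartAt_symm x).contMDiffAt
    ((isOpen_extChartAt_target x).mem_nhds hu)).mdifferentiableAt one_ne_zero

theorem differential_extChartAt_symm_apply [IsManifold I 1 M] [I.Boundaryless] {x y : M}
    (hy : y ∈ (extChartAt I x).source) (v : E) :
    differential 𝓘(ℝ, E) I (extChartAt I x).symm (extChartAt I x y)
      (differential I 𝓘(ℝ, E) (extChartAt I x) y v) = v := by
  rw [← differential_comp (mdifferentiableAt_extChartAt_symm' ((extChartAt I x).map_source hy))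
    (mdifferentiableAt_extChartAt (by rwa [← extChartAt_source I]))]
  refine Eq.trans ?_ (differential_id (I := I) y v)
  rw [differential_congr (F' := fun y : M => y)]
  filter_upwards [(isOpen_extChartAt_source x).mem_nhds hy] with z hz
  exact (extChartAt I x).left_inv hz

/-- The map `t ↦ (c(t), c'(t))` into the tangent bundle is continuous if `c` is `C¹`. -/
theorem continuousOn_velocity [IsManifold I 1 M] {c : ℝ → M} {T : Set ℝ} (hT : IsOpen T)
    (hc : ContMDiffOn 𝓘(ℝ, ℝ) I 1 c T) :
    ContinuousOn (fun t => (⟨c t, velocity (E := E) I c t⟩ : TangentBundle I M)) T := by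
  have h1 := hc.continuousOn_tangentMapWithin le_rfl hT.uniqueMDiffOn
  have h2 : Continuous fun t : ℝ => (⟨t, (1 : ℝ)⟩ : TangentBundle 𝓘(ℝ, ℝ) ℝ) :=
    (tangentBundleModelSpaceHomeomorph 𝓘(ℝ, ℝ)).symm.continuous.comp
      (continuous_id.prodMk continuous_const)
  refine (h1.comp h2.continuousOn fun t ht => ht).congr fun t ht => ?_
  change _ = tangentMapWithin 𝓘(ℝ, ℝ) I c T ⟨t, (1 : ℝ)⟩
  unfold tangentMapWithin velocity
  simp only [mfderivWithin_of_isOpen hT ht]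
  rfl

end Chart

section Group

variable {E H : Type*} [NormedAddCommGroup E] [NormedSpace ℝ E] [TopologicalSpace H]
  {I : ModelWithCorners ℝ E H} {S : Type*} [TopologicalSpace S] [ChartedSpace H S] [Group S]

/-- The differential of the right translations at the unit, read in the chart at the unit, depends
smoothly on the translation. -/
theorem contDiffAt_rightTranslation [LieGroup I ∞ S] [I.Boundaryless] :
    ContDiffAt ℝ 1 (fun u => fderiv ℝ (fun w => extChartAt I (1 : S)
      ((extChartAt I (1 : S)).symm w * (extChartAt I (1 : S)).symm u)) (extChartAt I (1 : S) 1))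
      (extChartAt I (1 : S) 1) := by
  have hs : ContMDiffAt 𝓘(ℝ, E) I ∞ (extChartAt I (1 : S)).symm (extChartAt I (1 : S) 1) :=
    (contMDiffOn_extChartAt_symm (1 : S)).contMDiffAt (extChartAt_target_mem_nhds (1 : S))
  have h1 : (extChartAt I (1 : S)).symm (extChartAt I (1 : S) 1) = 1 := extChartAt_to_inv (1 : S)
  have hm : ContMDiffAt 𝓘(ℝ, E × E) I ∞ (fun p : E × E =>
      (extChartAt I (1 : S)).symm p.2 * (extChartAt I (1 : S)).symm p.1)
      (extChartAt I (1 : S) 1, extChartAt I (1 : S) 1) := by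
    refine ContMDiffAt.mul ?_ ?_
    · exact ContMDiffAt.comp (g := (extChartAt I (1 : S)).symm) _ hs
        contDiffAt_snd.contMDiffAt
    · exact ContMDiffAt.comp (g := (extChartAt I (1 : S)).symm) _ hs
        contDiffAt_fst.contMDiffAt
  have he : ContMDiffAt I 𝓘(ℝ, E) ∞ (extChartAt I (1 : S))
      ((extChartAt I (1 : S)).symm (extChartAt I (1 : S) 1) *
        (extChartAt I (1 : S)).symm (extChartAt I (1 : S) 1)) := by
    rw [h1, one_mul]
    exact contMDiffAt_extChartAt
  have h2 := (ContMDiffAt.comp (g := extChartAt I (1 : S))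
    (extChartAt I (1 : S) 1, extChartAt I (1 : S) 1) he hm).contDiffAt
  exact ContDiffAt.fderiv (f := fun u w => extChartAt I (1 : S)
    ((extChartAt I (1 : S)).symm w * (extChartAt I (1 : S)).symm u)) h2 contDiffAt_const
    (by norm_cast)

/-- Local solutions of the equation `s' = -a s` in a Lie group, for a continuous curve `a` in the
Lie algebra: in a chart, this is an ordinary differential equation to which the theorem of
Picard–Lindelöf applies. -/
theorem exists_velocity_eq_neg_mul [FiniteDimensional ℝ E] [LieGroup I ∞ S] [I.Boundaryless]
    {a : ℝ → E} {t₀ δ : ℝ} (hδ : 0 < δ) (ha : ContinuousOn a (Ioo (t₀ - δ) (t₀ + δ))) :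
    ∃ ε > 0, ε ≤ δ ∧ ∃ s : ℝ → S, ContMDiffOn 𝓘(ℝ, ℝ) I 1 s (Ioo (t₀ - ε) (t₀ + ε)) ∧
      ∀ t ∈ Ioo (t₀ - ε) (t₀ + ε),
        velocity I s t = -differential I I (fun h => h * s t) 1 (a t) := by
  have := FiniteDimensional.complete ℝ E
  have : IsManifold I 1 S := IsManifold.of_le (n := ∞) (by simp)
  set e := extChartAt I (1 : S)
  set L : E → E →L[ℝ] E := fun u => fderiv ℝ (fun w => e (e.symm w * e.symm u)) (e 1)
  have hLd : ContDiffAt ℝ 1 L (e 1) := contDiffAt_rightTranslation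
  obtain ⟨K, V, hV, hK⟩ := hLd.exists_lipschitzOnWith
  obtain ⟨r, hr, hrV⟩ := Metric.nhds_basis_closedBall.mem_iff.1
    (inter_mem hV (extChartAt_target_mem_nhds (I := I) (1 : S)))
  have hrL : LipschitzOnWith K L (Metric.closedBall (e 1) r) := hK.mono fun u hu => (hrV hu).1
  -- bounds for the coefficients
  set a' : ℝ → E := fun t => differential I 𝓘(ℝ, E) e 1 (a t)
  have ha' : ContinuousOn a' (Ioo (t₀ - δ) (t₀ + δ)) :=
    (differential I 𝓘(ℝ, E) e 1).continuous.comp_continuousOn ha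
  have hsub : Icc (t₀ - δ / 2) (t₀ + δ / 2) ⊆ Ioo (t₀ - δ) (t₀ + δ) := fun t ht =>
    ⟨by linarith [ht.1], by linarith [ht.2]⟩
  obtain ⟨C, hC⟩ := isCompact_Icc.exists_bound_of_continuousOn (ha'.mono hsub)
  have hC0 : 0 ≤ C := (norm_nonneg _).trans
    (hC t₀ ⟨by linarith, by linarith⟩)
  lift C to NNReal using hC0
  lift r to NNReal using hr.le
  have hLb : ∀ u ∈ Metric.closedBall (e 1) r, ‖L u‖ ≤ ‖L (e 1)‖ + K * r := fun u hu => by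
    have h1 := hrL.dist_le_mul u hu (e 1) (Metric.mem_closedBall_self r.2)
    rw [dist_eq_norm] at h1
    have h2 : (K : ℝ) * dist u (e 1) ≤ K * r := by gcongr; exact hu
    calc ‖L u‖ = ‖L (e 1) + (L u - L (e 1))‖ := by rw [add_sub_cancel]
      _ ≤ ‖L (e 1)‖ + ‖L u - L (e 1)‖ := norm_add_le _ _
      _ ≤ _ := by linarith
  set D : NNReal := (‖L (e 1)‖₊ + K * r) * C
  set η : ℝ := min (δ / 2) (r / (D + 1))
  have hη : 0 < η := lt_min (by linarith) (by positivity)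
  have hηδ : Icc (t₀ - η) (t₀ + η) ⊆ Icc (t₀ - δ / 2) (t₀ + δ / 2) :=
    Icc_subset_Icc (by linarith [min_le_left (δ / 2) (r / (D + 1) : ℝ)])
      (by linarith [min_le_left (δ / 2) (r / (D + 1) : ℝ)])
  have hPL : IsPicardLindelof (fun t u => -L u (a' t)) (tmin := t₀ - η) (tmax := t₀ + η)
      ⟨t₀, by linarith, by linarith⟩ (e 1) r 0 D (K * C) := by
    refine ⟨fun t ht => ?_, fun u _ => ?_, fun t ht u hu => ?_, ?_⟩
    · refine LipschitzOnWith.of_dist_le_mul fun u hu u' hu' => ?_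
      rw [dist_neg_neg, dist_eq_norm, ← sub_apply]
      refine ((L u - L u').le_opNorm _).trans ?_
      rw [← dist_eq_norm]
      have h1 := hrL.dist_le_mul u hu u' hu'
      have h2 := hC t (hηδ ht)
      calc dist (L u) (L u') * ‖a' t‖ ≤ (K * dist u u') * C := by gcongr
        _ = _ := by push_cast; ring
    · exact ((L u).continuous.comp_continuousOn (ha'.mono (hηδ.trans hsub))).neg
    · rw [norm_neg]
      refine ((L u).le_opNorm _).trans ?_
      have h2 := hC t (hηδ ht)
      calc ‖L u‖ * ‖a' t‖ ≤ (‖L (e 1)‖ + K * r) * C := by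
            gcongr
            exact hLb u hu
        _ = D := by simp [D]
    · have : (D : ℝ) * η ≤ r := by
        calc (D : ℝ) * η ≤ (D + 1) * (r / (D + 1)) := by
              gcongr
              · linarith
              · exact min_le_right _ _
          _ = r := by field_simp
      simpa using this
  obtain ⟨α, hα0, hα⟩ := hPL.exists_eq_forall_mem_Icc_hasDerivWithinAt₀
  -- on a smaller interval the solution stays in the ball
  have hαc : ContinuousOn α (Icc (t₀ - η) (t₀ + η)) := fun t ht => (hα t ht).continuousWithinAt
  have hα1 : ∀ᶠ t in 𝓝 t₀, α t ∈ Metric.closedBall (e 1) (r : ℝ) := by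
    have h1 : ContinuousAt α t₀ := hαc.continuousAt (Icc_mem_nhds (by linarith) (by linarith))
    refine h1 ?_
    have : α t₀ = e 1 := hα0
    rw [this]
    exact Metric.closedBall_mem_nhds _ hr
  obtain ⟨ε, hε, hαε⟩ := Metric.eventually_nhds_iff_ball.1 hα1
  have hJ : Ioo (t₀ - min ε η) (t₀ + min ε η) ⊆ Ioo (t₀ - η) (t₀ + η) :=
    Ioo_subset_Ioo (by linarith [min_le_right ε η]) (by linarith [min_le_right ε η])
  have hball : ∀ t ∈ Ioo (t₀ - min ε η) (t₀ + min ε η), α t ∈ Metric.closedBall (e 1) (r : ℝ) := by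
    intro t ht
    refine hαε t ?_
    rw [Real.ball_eq_Ioo]
    exact ⟨by linarith [ht.1, min_le_left ε η], by linarith [ht.2, min_le_left ε η]⟩
  have hder : ∀ t ∈ Ioo (t₀ - min ε η) (t₀ + min ε η), HasDerivAt α (-L (α t) (a' t)) t :=
    fun t ht => (hα t (Ioo_subset_Icc_self (hJ ht))).hasDerivAt
      (Icc_mem_nhds (hJ ht).1 (hJ ht).2)
  refine ⟨min ε η, lt_min hε hη, ?_, fun t => e.symm (α t), ?_, ?_⟩
  · have := min_le_right ε η
    have := min_le_left (δ / 2) (r / (D + 1) : ℝ)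
    linarith
  · have hαd : ContDiffOn ℝ 1 α (Ioo (t₀ - min ε η) (t₀ + min ε η)) := by
      have h01 : (1 : ℕ∞ω) = 0 + 1 := by simp
      rw [h01, contDiffOn_succ_iff_deriv_of_isOpen isOpen_Ioo]
      refine ⟨fun t ht => (hder t ht).differentiableAt.differentiableWithinAt,
        fun h => absurd h (by simp), ?_⟩
      rw [contDiffOn_zero]
      refine ContinuousOn.congr (f := fun t => -L (α t) (a' t)) ?_ fun t ht => (hder t ht).deriv
      refine (ContinuousOn.clm_apply ?_ ?_).neg
      · exact hrL.continuousOn.comp (hαc.mono (hJ.trans Ioo_subset_Icc_self)) hball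
      · exact ha'.mono ((hJ.trans Ioo_subset_Icc_self).trans (hηδ.trans hsub))
    exact (contMDiffOn_extChartAt_symm (1 : S)).comp hαd.contMDiffOn
      fun t ht => (hrV (hball t ht)).2
  · intro t ht
    have htar : α t ∈ e.target := (hrV (hball t ht)).2
    set σ := e.symm (α t)
    have hσ : σ ∈ e.source := e.map_target htar
    have hσα : e σ = α t := e.right_inv htar
    have h1 := velocity_comp (mdifferentiableAt_extChartAt_symm' htar)
      (hder t ht).differentiableAt.mdifferentiableAt
    refine h1.trans ?_
    have h1S : (1 : S) ∈ e.source := mem_extChartAt_source (1 : S)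
    have hL : L (α t) (a' t) =
        differential I 𝓘(ℝ, E) e σ (differential I I (fun h => h * σ) 1 (a t)) := by
      have e1 : e.symm (e 1) = 1 := e.left_inv h1S
      have hd1 : MDifferentiableAt 𝓘(ℝ, E) I e.symm (e 1) :=
        mdifferentiableAt_extChartAt_symm' (e.map_source h1S)
      have hd2 : MDifferentiableAt I I (fun h => h * σ) (e.symm (e 1)) :=
        PrincipalBundle.mdifferentiableAt_mul_right _ _
      have hd3 : MDifferentiableAt I 𝓘(ℝ, E) e (e.symm (e 1) * σ) := by
        rw [e1, one_mul]
        exact mdifferentiableAt_extChartAt (by rwa [← extChartAt_source I])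
      have s1 : L (α t) (a' t) =
          differential 𝓘(ℝ, E) 𝓘(ℝ, E) (fun w => e (e.symm w * σ)) (e 1) (a' t) := by
        unfold differential
        rw [mfderiv_eq_fderiv]
      rw [s1, differential_comp (F := fun w => e.symm w * σ) hd3 (hd2.comp (e 1) hd1),
        differential_comp (F := e.symm) (F' := fun h => h * σ) hd2 hd1,
        differential_extChartAt_symm_apply h1S, e1, one_mul]
    rw [velocity_eq_deriv, (hder t ht).deriv, map_neg, hL, ← hσα,
      differential_extChartAt_symm_apply hσ]

end Group

section Bundle

variable {EP HP EM HM ES HS : Type*}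
  [NormedAddCommGroup EP] [NormedSpace ℝ EP] [TopologicalSpace HP]
  [NormedAddCommGroup EM] [NormedSpace ℝ EM] [TopologicalSpace HM]
  [NormedAddCommGroup ES] [NormedSpace ℝ ES] [TopologicalSpace HS]
  {IP : ModelWithCorners ℝ EP HP} {IM : ModelWithCorners ℝ EM HM}
  {IS : ModelWithCorners ℝ ES HS} {P M S : Type*}
  [TopologicalSpace P] [ChartedSpace HP P] [TopologicalSpace M] [ChartedSpace HM M]
  [TopologicalSpace S] [ChartedSpace HS S] [Group S]
  {B : PrincipalBundle IP IM IS P M S}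

namespace PrincipalBundle

variable [IsManifold IP ∞ P]

/-- Through some point over `f(t₀)`, hence over all of them, there is a horizontal lift of `f` near
`t₀`: in a trivialization, it is `t ↦ c(t) · s(t)` for the lift `c` with constant
fibre coordinate and a solution `s` of `s' = -A(c') s`. -/
theorem Connection.exists_local_lift [FiniteDimensional ℝ ES] [IS.Boundaryless] [LieGroup IS ∞ S]
    (A : B.Connection) {f : ℝ → M} {t₀ u v : ℝ} (ht₀ : t₀ ∈ Ioo u v)
    (hf : ContMDiffOn 𝓘(ℝ, ℝ) IM 1 f (Ioo u v)) :
    ∃ ε > 0, ∃ c : ℝ → P, ContMDiffOn 𝓘(ℝ, ℝ) IP 1 c (Ioo (t₀ - ε) (t₀ + ε)) ∧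
      ∀ t ∈ Ioo (t₀ - ε) (t₀ + ε), B.proj (c t) = f t ∧ A.IsHorizontalAt c t := by
  obtain ⟨U, φ, hU, hm, hs, ht, -, hφ, hact⟩ := B.locallyTrivial (f t₀)
  have hfU : ∀ᶠ t in 𝓝 t₀, f t ∈ U ∧ t ∈ Ioo u v :=
    ((hf.continuousOn.continuousAt (isOpen_Ioo.mem_nhds ht₀)).eventually_mem
      (hU.mem_nhds hm)).and
      (isOpen_Ioo.mem_nhds ht₀)
  obtain ⟨δ, hδ, hδU⟩ := Metric.eventually_nhds_iff_ball.1 hfU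
  rw [Real.ball_eq_Ioo] at hδU
  set c₀ : ℝ → P := fun t => φ.symm (f t, 1)
  have hmem : ∀ t ∈ Ioo (t₀ - δ) (t₀ + δ), (f t, (1 : S)) ∈ φ.target := fun t htδ => by
    rw [ht]
    exact ⟨(hδU t htδ).1, mem_univ _⟩
  have hc₀ : ContMDiffOn 𝓘(ℝ, ℝ) IP 1 c₀ (Ioo (t₀ - δ) (t₀ + δ)) :=
    (hφ.of_le (by simp)).comp ((hf.mono fun t htδ => (hδU t htδ).2).prodMk contMDiffOn_const) hmem
  have hproj : ∀ t ∈ Ioo (t₀ - δ) (t₀ + δ), B.proj (c₀ t) = f t := fun t htδ => by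
    have h1 := hact (c₀ t) (φ.map_target (hmem t htδ)) 1
    rw [B.act_one, φ.right_inv (hmem t htδ)] at h1
    exact (congrArg Prod.fst h1).symm
  have : IsManifold IP 1 P := IsManifold.of_le (n := ∞) (by simp)
  have ha : ContinuousOn (fun t => A.val (c₀ t) (velocity IP c₀ t)) (Ioo (t₀ - δ) (t₀ + δ)) :=
    A.contMDiff_form.continuous.comp_continuousOn (continuousOn_velocity isOpen_Ioo hc₀)
  obtain ⟨ε, hε, hεδ, s, hsd, hsv⟩ := exists_velocity_eq_neg_mul (I := IS) (S := S) hδ ha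
  have hsub : Ioo (t₀ - ε) (t₀ + ε) ⊆ Ioo (t₀ - δ) (t₀ + δ) :=
    Ioo_subset_Ioo (by linarith) (by linarith)
  have hcd : ContMDiffOn 𝓘(ℝ, ℝ) IP 1 (fun t => B.act (c₀ t) (s t)) (Ioo (t₀ - ε) (t₀ + ε)) :=
    (B.contMDiff_act.of_le (by simp)).comp_contMDiffOn ((hc₀.mono hsub).prodMk hsd)
  refine ⟨ε, hε, fun t => B.act (c₀ t) (s t), hcd, fun t htε => ⟨?_, ?_, ?_⟩⟩
  · rw [B.proj_act, hproj t (hsub htε)]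
  · exact (hcd.contMDiffAt (isOpen_Ioo.mem_nhds htε)).mdifferentiableAt one_ne_zero
  · have hd1 := (hc₀.contMDiffAt (isOpen_Ioo.mem_nhds (hsub htε))).mdifferentiableAt one_ne_zero
    have hd2 := (hsd.contMDiffAt (isOpen_Ioo.mem_nhds htε)).mdifferentiableAt one_ne_zero
    rw [A.val_velocity_act hd1 hd2, hsv t htε, map_neg, differential_conj_inv, add_neg_cancel]

theorem Connection.IsHorizontalAt.act [LieGroup IS ∞ S] {A : B.Connection} {c : ℝ → P} {t : ℝ}
    (h : A.IsHorizontalAt c t) (s : S) : A.IsHorizontalAt (fun t => B.act (c t) s) t := by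
  have hd : MDifferentiableAt IP IP (fun q => B.act q s) (c t) :=
    AutAction.mdifferentiable_act B s _
  refine ⟨hd.comp t h.1, ?_⟩
  rw [velocity_comp (F := fun q => B.act q s) hd h.1, A.val_act, h.2, map_zero]

/-- The curve `c` is `C¹` and horizontal on `[x,y]`, with one-sided derivatives at `x` and `y`. -/
def Connection.HorizontalOn (A : B.Connection) (c : ℝ → P) (x y : ℝ) : Prop :=
  ∃ (u v : ℝ) (f : ℝ → P), u < x ∧ y < v ∧ ContMDiffOn 𝓘(ℝ, ℝ) IP 1 f (Ioo u v) ∧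
    EqOn f c (Icc x y) ∧ ∀ t ∈ Icc x y, A.IsHorizontalAt f t

variable {A : B.Connection}

theorem Connection.HorizontalOn.congr {c c' : ℝ → P} {x y : ℝ} (h : A.HorizontalOn c x y)
    (hc : EqOn c c' (Icc x y)) : A.HorizontalOn c' x y := by
  obtain ⟨u, v, f, h1, h2, h3, h4, h5⟩ := h
  exact ⟨u, v, f, h1, h2, h3, h4.trans hc, h5⟩

theorem Connection.HorizontalOn.restrict {c : ℝ → P} {x y x' y' : ℝ} (h : A.HorizontalOn c x y)
    (hx : x ≤ x') (hy : y' ≤ y) : A.HorizontalOn c x' y' := by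
  obtain ⟨u, v, f, h1, h2, h3, h4, h5⟩ := h
  exact ⟨u, v, f, h1.trans_le hx, hy.trans_lt h2, h3, h4.mono (Icc_subset_Icc hx hy),
    fun t ht => h5 t (Icc_subset_Icc hx hy ht)⟩

theorem Connection.HorizontalOn.act [LieGroup IS ∞ S] {c : ℝ → P} {x y : ℝ}
    (h : A.HorizontalOn c x y) (s : S) : A.HorizontalOn (fun t => B.act (c t) s) x y := by
  obtain ⟨u, v, f, h1, h2, h3, h4, h5⟩ := h
  refine ⟨u, v, fun t => B.act (f t) s, h1, h2, ?_, fun t ht => ?_, fun t ht => (h5 t ht).act s⟩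
  · exact (B.contMDiff_act.of_le (by simp)).comp_contMDiffOn (h3.prodMk contMDiffOn_const)
  · exact congrArg (fun q => B.act q s) (h4 ht)

theorem Connection.HorizontalOn.continuousOn {c : ℝ → P} {x y : ℝ} (h : A.HorizontalOn c x y) :
    ContinuousOn c (Icc x y) := by
  obtain ⟨u, v, f, h1, h2, h3, h4, -⟩ := h
  exact (h3.continuousOn.mono (Icc_subset_Ioo h1 h2)).congr h4.symm

theorem Connection.HorizontalOn.isHorizontalAt {c : ℝ → P} {x y t : ℝ} (h : A.HorizontalOn c x y)
    (ht : t ∈ Ioo x y) : A.IsHorizontalAt c t := by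
  obtain ⟨u, v, f, -, -, -, h4, h5⟩ := h
  refine (h5 t (Ioo_subset_Icc_self ht)).congr ?_
  filter_upwards [isOpen_Ioo.mem_nhds ht] with r hr
  exact (h4 (Ioo_subset_Icc_self hr)).symm

/-- `c` is a piecewise `C¹` horizontal lift of `g` on `[x,y]`. -/
def Connection.LiftOn (A : B.Connection) (g : ℝ → M) (c : ℝ → P) (x y : ℝ) : Prop :=
  EqOn (fun t => B.proj (c t)) g (Icc x y) ∧ Chain (A.HorizontalOn c) x y

theorem Connection.LiftOn.exists_finite {g : ℝ → M} {c : ℝ → P} {x y : ℝ}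
    (h : A.LiftOn g c x y) : ContinuousOn c (Icc x y) ∧
      ∃ F : Set ℝ, F.Finite ∧ ∀ t ∈ Ioo x y \ F, A.IsHorizontalAt c t := by
  obtain ⟨-, h⟩ := h
  induction h with
  | single h => exact ⟨h.2.continuousOn, ∅, finite_empty, fun t ht => h.2.isHorizontalAt ht.1⟩
  | @tail m y' hm h ih =>
    obtain ⟨hc, F, hF, hh⟩ := ih
    refine ⟨?_, insert m F, hF.insert m, fun t ht => ?_⟩
    · rw [← Icc_union_Icc_eq_Icc (Chain.lt hm).le h.1.le]
      exact hc.union_of_isClosed h.2.continuousOn isClosed_Icc isClosed_Icc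
    · rcases lt_trichotomy t m with htm | htm | htm
      · exact hh t ⟨⟨ht.1.1, htm⟩, fun hF => ht.2 (Or.inr hF)⟩
      · exact absurd (Or.inl htm) ht.2
      · exact h.2.isHorizontalAt ⟨htm, ht.1.2⟩

/-- Uniqueness of horizontal lifts. -/
theorem Connection.LiftOn.eq [FiniteDimensional ℝ ES] [LieGroup IS ∞ S] {g : ℝ → M}
    {c c' : ℝ → P} {x y : ℝ} (h : A.LiftOn g c x y) (h' : A.LiftOn g c' x y) (h0 : c x = c' x) :
    c y = c' y := by
  obtain ⟨hc, F, hF, hh⟩ := h.exists_finite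
  obtain ⟨hc', F', hF', hh'⟩ := h'.exists_finite
  exact A.eq_of_isHorizontalAt h.2.lt.le hF hF' hc hc' hh hh'
    (fun t ht => (h.1 ht).trans (h'.1 ht).symm) h0

theorem Connection.LiftOn.restrict {g : ℝ → M} {c : ℝ → P} {x y x' y' : ℝ}
    (h : A.LiftOn g c x y) (hx : x ≤ x') (hxy : x' < y') (hy : y' ≤ y) : A.LiftOn g c x' y' :=
  ⟨h.1.mono (Icc_subset_Icc hx hy), h.2.restrict (fun _ _ _ _ hR h1 _ h2 => hR.restrict h1 h2)
    hx hxy hy⟩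

theorem Connection.LiftOn.act [LieGroup IS ∞ S] {g : ℝ → M} {c : ℝ → P} {x y : ℝ}
    (h : A.LiftOn g c x y) (s : S) : A.LiftOn g (fun t => B.act (c t) s) x y :=
  ⟨fun _ ht => (B.proj_act _ _).trans (h.1 ht), h.2.mono fun _ _ _ _ _ hR => hR.act s⟩

theorem Connection.LiftOn.congr {g g' : ℝ → M} {c c' : ℝ → P} {x y : ℝ}
    (h : A.LiftOn g c x y) (hg : EqOn g g' (Icc x y)) (hc : EqOn c c' (Icc x y)) :
    A.LiftOn g' c' x y :=
  ⟨fun t ht => by rw [← hg ht, ← h.1 ht]; exact congrArg B.proj (hc ht).symm,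
    h.2.mono fun _ _ hx _ hy hR => hR.congr (hc.mono (Icc_subset_Icc hx hy))⟩

theorem Connection.LiftOn.glue {g : ℝ → M} {c c' : ℝ → P} {x y z : ℝ}
    (h : A.LiftOn g c x y) (h' : A.LiftOn g c' y z) (hy : c y = c' y) :
    A.LiftOn g (fun t => if t ≤ y then c t else c' t) x z := by
  have e1 : EqOn c (fun t => if t ≤ y then c t else c' t) (Icc x y) := fun t ht => by
    simp only [if_pos ht.2]
  have e2 : EqOn c' (fun t => if t ≤ y then c t else c' t) (Icc y z) := fun t ht => by
    rcases ht.1.eq_or_lt with rfl | hlt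
    · simp only [if_pos le_rfl, hy]
    · simp only [if_neg hlt.not_ge]
  have k1 := h.congr (fun _ _ => rfl) e1
  have k2 := h'.congr (fun _ _ => rfl) e2
  refine ⟨?_, k1.2.trans k2.2⟩
  rw [← Icc_union_Icc_eq_Icc h.2.lt.le h'.2.lt.le]
  exact k1.1.union k2.1

/-- All points over `g(x)` are starting points of horizontal lifts of `g` on `[x,y]`. -/
def Connection.HasLifts (A : B.Connection) (g : ℝ → M) (x y : ℝ) : Prop :=
  ∀ p, B.proj p = g x → ∃ c, A.LiftOn g c x y ∧ c x = p

theorem Connection.HasLifts.trans {g : ℝ → M} {x y z : ℝ} (h : A.HasLifts g x y)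
    (h' : A.HasLifts g y z) : A.HasLifts g x z := by
  intro p hp
  obtain ⟨c, hc, hcp⟩ := h p hp
  obtain ⟨c', hc', hcp'⟩ := h' (c y) (hc.1 (right_mem_Icc.2 hc.2.lt.le))
  exact ⟨_, hc.glue hc' hcp'.symm, by simp only [if_pos hc.2.lt.le, hcp]⟩

theorem Connection.HasLifts.congr {g g' : ℝ → M} {x y : ℝ} (h : A.HasLifts g x y) (hxy : x ≤ y)
    (hg : EqOn g g' (Icc x y)) : A.HasLifts g' x y := fun p hp => by
  obtain ⟨c, hc, hcp⟩ := h p (hp.trans (hg (left_mem_Icc.2 hxy)).symm)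
  exact ⟨c, hc.congr hg fun _ _ => rfl, hcp⟩

variable [FiniteDimensional ℝ ES] [IS.Boundaryless] [LieGroup IS ∞ S]

theorem Connection.hasLifts_of_contMDiffOn (A : B.Connection) {f : ℝ → M} {u v x y : ℝ}
    (hf : ContMDiffOn 𝓘(ℝ, ℝ) IM 1 f (Ioo u v)) (hu : u < x) (hxy : x < y) (hv : y < v) :
    A.HasLifts f x y := by
  -- small intervals
  have hloc : ∀ t : Icc x y, ∃ ε > 0, ∀ x' y', x' < y' → x' ∈ Ioo (t - ε : ℝ) (t + ε) →
      y' ∈ Ioo (t - ε : ℝ) (t + ε) → A.HasLifts f x' y' := by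
    intro t
    obtain ⟨ε, hε, c, hc, hh⟩ := A.exists_local_lift (Icc_subset_Ioo hu hv t.2) hf
    refine ⟨ε, hε, fun x' y' hxy' hx' hy' p hp => ?_⟩
    have hp' : B.proj (c x') = B.proj p := by rw [hp, (hh x' hx').1]
    have hsub : Icc x' y' ⊆ Ioo (t - ε : ℝ) (t + ε) := Icc_subset_Ioo hx'.1 hy'.2
    have hlift : A.LiftOn f c x' y' :=
      ⟨fun r hr => (hh r (hsub hr)).1, Chain.single hxy' ⟨_, _, c, hx'.1, hy'.2, hc, fun _ _ => rfl,
        fun r hr => (hh r (hsub hr)).2⟩⟩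
    exact ⟨_, hlift.act (B.diff (c x') p), act_diff hp'⟩
  choose ε hε hlift using hloc
  -- a subdivision into small intervals
  obtain ⟨τ, h0, hmono, ⟨m, hm⟩, hτ⟩ := exists_monotone_Icc_subset_open_cover_Icc
    (c := fun t : Icc x y => {r : Icc x y | (r : ℝ) ∈ Ioo (t - ε t : ℝ) (t + ε t)}) hxy.le
    (fun t => isOpen_Ioo.preimage continuous_subtype_val)
    (fun t _ => mem_iUnion.2 ⟨t, by linarith [hε t], by linarith [hε t]⟩)
  have key : ∀ n, x < τ n → A.HasLifts f x (τ n) := by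
    intro n
    induction n with
    | zero => intro h; exact absurd h0 h.ne'
    | succ n ih =>
      intro hn
      obtain ⟨t, ht⟩ := hτ n
      have hle : τ n ≤ τ (n + 1) := hmono n.le_succ
      have ht1 := ht (left_mem_Icc.2 hle)
      have ht2 := ht (right_mem_Icc.2 hle)
      rcases (show (τ n : ℝ) ≤ τ (n + 1) from hle).eq_or_lt with heq | hlt
      · rw [← heq] at hn ⊢
        exact ih hn
      have hstep : A.HasLifts f (τ n) (τ (n + 1)) := hlift t _ _ hlt ht1 ht2
      rcases (τ n).2.1.eq_or_lt with heq | hlt'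
      · rw [← heq] at hstep
        exact hstep
      · exact (ih hlt').trans hstep
  have := key m
  rw [hm m le_rfl] at this
  exact this hxy

/-- Existence of horizontal lifts. -/
theorem Connection.hasLifts (A : B.Connection) {k : ℕ∞ω} (hk : 1 ≤ k) {γ : Curve M}
    (hγ : γ.IsPath IM k) : A.HasLifts γ.extend γ.a γ.b := by
  rw [Curve.isPath_iff] at hγ
  have hstep : ∀ x y, x < y ∧ Curve.SmoothOn IM k γ.extend x y → A.HasLifts γ.extend x y := by
    rintro x y ⟨hxy, u, v, f, hu, hv, hf, hfe⟩
    exact (A.hasLifts_of_contMDiffOn (hf.of_le hk) hu hxy hv).congr hxy.le hfe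
  generalize γ.b = b at hγ
  induction hγ with
  | single h => exact hstep _ _ h
  | tail _ h ih => exact ih.trans (hstep _ _ h)

end PrincipalBundle

end Bundle

/-! ### Properties of the parallel transport -/

section Bundle

variable {EP HP EM HM ES HS : Type*}
  [NormedAddCommGroup EP] [NormedSpace ℝ EP] [TopologicalSpace HP]
  [NormedAddCommGroup EM] [NormedSpace ℝ EM] [TopologicalSpace HM]
  [NormedAddCommGroup ES] [NormedSpace ℝ ES] [TopologicalSpace HS]
  {IP : ModelWithCorners ℝ EP HP} {IM : ModelWithCorners ℝ EM HM}
  {IS : ModelWithCorners ℝ ES HS} {P M S : Type*}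
  [TopologicalSpace P] [ChartedSpace HP P] [TopologicalSpace M] [ChartedSpace HM M]
  [TopologicalSpace S] [ChartedSpace HS S] [Group S]
  {B : PrincipalBundle IP IM IS P M S}

namespace PrincipalBundle

section Automorphisms

variable {EG HG : Type*} [NormedAddCommGroup EG] [NormedSpace ℝ EG] [TopologicalSpace HG]
  {IG : ModelWithCorners ℝ EG HG} {G : Type*} [TopologicalSpace G] [ChartedSpace HG G]
  [Group G] (Θ : B.AutAction IG G)

theorem AutAction.θ_inv_θ (g : G) (p : P) : Θ.θ g⁻¹ (Θ.θ g p) = p := by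
  rw [← Θ.mul_θ, inv_mul_cancel, Θ.one_θ]

theorem AutAction.θ_θ_inv (g : G) (p : P) : Θ.θ g (Θ.θ g⁻¹ p) = p := by
  rw [← Θ.mul_θ, mul_inv_cancel, Θ.one_θ]

end Automorphisms

variable [IsManifold IP ∞ P] {A : B.Connection}

/-- The one-sided derivatives of a curve at the ends of an interval are the derivatives of an
extension. -/
theorem Connection.form_mfderivWithin_iff {f c : ℝ → P} {x y t : ℝ} (hxy : x < y)
    (ht : t ∈ Icc x y) (hf : MDifferentiableAt 𝓘(ℝ, ℝ) IP f t) (hfc : EqOn f c (Icc x y)) :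
    A.form (c t) (mfderivWithin 𝓘(ℝ, ℝ) IP c (Icc x y) t (1 : ℝ)) = 0 ↔
      A.IsHorizontalAt f t := by
  have h1 : (mfderivWithin 𝓘(ℝ, ℝ) IP c (Icc x y) t : ℝ →L[ℝ] EP) 1 = velocity IP f t := by
    unfold velocity
    rw [mfderivWithin_congr (fun r hr => (hfc hr).symm) (hfc ht).symm,
      mfderivWithin_eq_mfderiv
        ((uniqueDiffOn_Icc hxy).uniqueMDiffOn t ht) hf]
    rfl
  change A.val (c t) ((mfderivWithin 𝓘(ℝ, ℝ) IP c (Icc x y) t : ℝ →L[ℝ] EP) 1) = 0 ↔ _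
  rw [h1, ← hfc ht]
  exact ⟨fun h => ⟨hf, h⟩, fun h => h.2⟩

theorem Connection.horizontalOn_piece_iff (c : Curve P) (D : c.Subdivision) (i : Fin D.n) :
    ((c.piece D i).IsClass IP 1 ∧ ∀ t ∈ Icc (c.piece D i).a (c.piece D i).b,
      A.form ((c.piece D i).extend t) (mfderivWithin 𝓘(ℝ, ℝ) IP (c.piece D i).extend
          (Icc (c.piece D i).a (c.piece D i).b) t (1 : ℝ)) = 0) ↔
      A.HorizontalOn c.extend (D.τ i.castSucc) (D.τ i.succ) := by
  have hlt : D.τ i.castSucc < D.τ i.succ := (c.piece D i).lt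
  have heq := c.extend_piece D i
  rw [Curve.isClass_piece_iff]
  constructor
  · rintro ⟨⟨u, v, f, h1, h2, h3, h4⟩, h5⟩
    refine ⟨u, v, f, h1, h2, h3, h4, fun t ht => ?_⟩
    have hd := (h3.contMDiffAt (isOpen_Ioo.mem_nhds
      (Icc_subset_Ioo h1 h2 ht))).mdifferentiableAt one_ne_zero
    exact (A.form_mfderivWithin_iff hlt ht hd (h4.trans heq.symm)).1 (h5 t ht)
  · rintro ⟨u, v, f, h1, h2, h3, h4, h5⟩
    exact ⟨⟨u, v, f, h1, h2, h3, h4⟩, fun t ht =>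
      (A.form_mfderivWithin_iff hlt ht (h5 t ht).1 (h4.trans heq.symm)).2 (h5 t ht)⟩

theorem Connection.isHorizontalLift_iff {γ : Curve M} {c : Curve P} :
    A.IsHorizontalLift γ c ↔ c.map B.proj = γ ∧ Chain (A.HorizontalOn c.extend) c.a c.b := by
  rw [← Curve.exists_subdivision_iff]
  exact and_congr_right fun _ => exists_congr fun D =>
    forall_congr' fun i => A.horizontalOn_piece_iff c D i

theorem Connection.IsHorizontalLift.liftOn {γ : Curve M} {c : Curve P}
    (h : A.IsHorizontalLift γ c) : A.LiftOn γ.extend c.extend γ.a γ.b := by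
  obtain ⟨h1, h2⟩ := Connection.isHorizontalLift_iff.1 h
  subst h1
  exact ⟨fun t _ => rfl, h2⟩

theorem Connection.LiftOn.isHorizontalLift {γ : Curve M} {c : ℝ → P}
    (h : A.LiftOn γ.extend c γ.a γ.b) :
    A.IsHorizontalLift γ ⟨γ.a, γ.b, γ.lt, fun t => c t⟩ := by
  rw [Connection.isHorizontalLift_iff]
  constructor
  · have : (fun t : Icc γ.a γ.b => B.proj (c t)) = γ.toFun := funext fun t =>
      (h.1 t.2).trans (γ.extend_apply t)
    unfold Curve.map
    simp only [this]
  · refine h.2.mono fun x y hx _ hy hR => hR.congr fun t ht => ?_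
    exact (Curve.extend_of_mem ⟨γ.a, γ.b, γ.lt, fun t => c t⟩
      (t := t) ⟨hx.trans ht.1, ht.2.trans hy⟩).symm

theorem Connection.IsHorizontalAt.reflect {c : ℝ → P} {s t : ℝ}
    (h : A.IsHorizontalAt c (s - t)) : A.IsHorizontalAt (fun t => c (s - t)) t := by
  have hd : HasDerivAt (fun t : ℝ => s - t) (-1) t := (hasDerivAt_id t).const_sub s
  have hd' : MDifferentiableAt 𝓘(ℝ, ℝ) 𝓘(ℝ, ℝ) (fun t : ℝ => s - t) t :=
    hd.differentiableAt.mdifferentiableAt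
  refine ⟨MDifferentiableAt.comp (g := c) t h.1 hd', ?_⟩
  have h1 := velocity_comp (F := c) (c := fun t : ℝ => s - t) h.1 hd'
  rw [velocity_eq_deriv, hd.deriv, map_neg] at h1
  rw [h1]
  refine (map_neg (A.form (c (s - t))) _).trans ?_
  exact neg_eq_zero.2 h.2

theorem Connection.LiftOn.reflect {g : ℝ → M} {c : ℝ → P} {x y : ℝ} (h : A.LiftOn g c x y) :
    A.LiftOn (fun t => g (x + y - t)) (fun t => c (x + y - t)) x y := by
  refine ⟨fun t ht => h.1 ⟨by linarith [ht.2], by linarith [ht.1]⟩, ?_⟩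
  have := h.2.reflect (R' := A.HorizontalOn fun t => c (x + y - t)) (x + y) ?_
  · simpa using this
  · rintro x' y' - - - ⟨u, v, f, h1, h2, h3, h4, h5⟩
    refine ⟨x + y - v, x + y - u, fun t => f (x + y - t), by linarith, by linarith, ?_,
      fun t ht => h4 ⟨by linarith [ht.2], by linarith [ht.1]⟩,
      fun t ht => (h5 (x + y - t) ⟨by linarith [ht.2], by linarith [ht.1]⟩).reflect⟩
    refine ContMDiffOn.comp (g := f) h3 ?_ fun t ht => ⟨by linarith [ht.2], by linarith [ht.1]⟩
    exact (contDiff_const.sub contDiff_id).contMDiff.contMDiffOn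

section Automorphisms

variable {EG HG : Type*} [NormedAddCommGroup EG] [NormedSpace ℝ EG] [TopologicalSpace HG]
  {IG : ModelWithCorners ℝ EG HG} {G : Type*} [TopologicalSpace G] [ChartedSpace HG G]
  [Group G] (Θ : B.AutAction IG G)

theorem AutAction.val_onConnection (g : G) (A : B.Connection) (p : P) (v : EP) :
    (Θ.onConnection g A).val p v =
      A.val (Θ.θ g⁻¹ p) (differential IP IP (Θ.θ g⁻¹) p v) := rfl

theorem AutAction.isHorizontalAt_onConnection (g : G) {c : ℝ → P} {t : ℝ}
    (h : A.IsHorizontalAt c t) :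
    (Θ.onConnection g A).IsHorizontalAt (fun t => Θ.θ g (c t)) t := by
  have hd := (Θ.mdifferentiable_translation g (c t)).comp t h.1
  refine ⟨hd, ?_⟩
  have h1 := velocity_comp (F := Θ.θ g⁻¹) (c := fun t => Θ.θ g (c t))
    (Θ.mdifferentiable_translation g⁻¹ _) hd
  rw [Θ.val_onConnection, ← h1]
  simp only [Θ.θ_inv_θ]
  exact h.2

end Automorphisms

section Unique

variable [FiniteDimensional ℝ ES] [LieGroup IS ∞ S]

/-- The parallel transport is computed by any horizontal lift. -/
theorem Connection.LiftOn.transport_eq {γ : Curve M} {c : ℝ → P}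
    (h : A.LiftOn γ.extend c γ.a γ.b) : A.transport γ (c γ.a) = c γ.b := by
  have hex : ∃ c' : Curve P, A.IsHorizontalLift γ c' ∧ c'.startPoint = c γ.a :=
    ⟨_, h.isHorizontalLift, rfl⟩
  rw [Connection.transport, dif_pos hex]
  obtain ⟨h1, h2⟩ := hex.choose_spec
  generalize hex.choose = c' at h1 h2
  have h3 := h1.liftOn
  obtain ⟨rfl, -⟩ := h1
  rw [← Curve.extend_a] at h2
  rw [← Curve.extend_b]
  exact h3.eq h h2

theorem Connection.LiftOn.transport_piece {γ : Curve M} {c : ℝ → P}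
    (h : A.LiftOn γ.extend c γ.a γ.b) (D : γ.Subdivision) (i : Fin D.n) :
    A.transport (γ.piece D i) (c (D.τ i.castSucc)) = c (D.τ i.succ) := by
  have h1 := h.restrict (D.a_le i.castSucc) (γ.piece D i).lt (D.le_b i.succ)
  exact (h1.congr (γ.extend_piece D i).symm fun _ _ => rfl).transport_eq

theorem Connection.transport_of_isConst {γ : Curve M} (hγ : γ.IsConst) {p : P}
    (hp : B.proj p = γ.startPoint) : A.transport γ p = p := by
  have hv : ∀ t, velocity IP (fun _ : ℝ => p) t = 0 := fun t => by
    unfold velocity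
    rw [mfderiv_const]
    rfl
  refine Connection.LiftOn.transport_eq (c := fun _ => p) ⟨fun t ht => ?_, Chain.single γ.lt
    ⟨γ.a - 1, γ.b + 1, fun _ => p, by linarith, by linarith, contMDiffOn_const, fun _ _ => rfl,
      fun t _ => ⟨mdifferentiableAt_const, ?_⟩⟩⟩
  · rw [γ.extend_of_mem ht, hγ, ← hp]
  · rw [hv]
    exact map_zero (A.form p)

theorem Connection.LiftOn.transport_inv {γ : Curve M} {c : ℝ → P}
    (h : A.LiftOn γ.extend c γ.a γ.b) : A.transport γ.inv (c γ.b) = c γ.a := by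
  have h1 : A.LiftOn γ.inv.extend (fun t => c (γ.a + γ.b - t)) γ.inv.a γ.inv.b :=
    h.reflect.congr γ.extend_inv.symm fun _ _ => rfl
  have h2 := h1.transport_eq
  simpa [Curve.inv] using h2

section Automorphisms

variable {EG HG : Type*} [NormedAddCommGroup EG] [NormedSpace ℝ EG] [TopologicalSpace HG]
  {IG : ModelWithCorners ℝ EG HG} {G : Type*} [TopologicalSpace G] [ChartedSpace HG G]
  [Group G] (Θ : B.AutAction IG G)

theorem AutAction.transport_onConnection_of_liftOn (g : G) {γ : Curve M} {c : ℝ → P}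
    (h : A.LiftOn γ.extend c γ.a γ.b) :
    (Θ.onConnection g A).transport (γ.map (Θ.base g)) (Θ.θ g (c γ.a)) = Θ.θ g (c γ.b) := by
  refine Connection.LiftOn.transport_eq (γ := γ.map (Θ.base g)) (c := fun t => Θ.θ g (c t))
    ⟨fun t ht => ?_, h.2.mono ?_⟩
  · change B.proj (Θ.θ g (c t)) = Θ.base g (γ.extend t)
    rw [Θ.proj_θ, ← h.1 ht]
  · rintro x y - - - ⟨u, v, f, h1, h2, h3, h4, h5⟩
    exact ⟨u, v, fun t => Θ.θ g (f t), h1, h2,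
      ((Θ.contMDiff_translation g).of_le (by simp)).comp_contMDiffOn h3,
      fun t ht => congrArg (Θ.θ g) (h4 ht), fun t ht => Θ.isHorizontalAt_onConnection g (h5 t ht)⟩

end Automorphisms

end Unique

section Exists

variable [FiniteDimensional ℝ ES] [IS.Boundaryless] [LieGroup IS ∞ S] {k : ℕ∞ω} {γ : Curve M}

theorem Connection.exists_liftOn (A : B.Connection) (hk : 1 ≤ k) (hγ : γ.IsPath IM k) {p : P}
    (hp : B.proj p = γ.startPoint) : ∃ c, A.LiftOn γ.extend c γ.a γ.b ∧ c γ.a = p :=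
  A.hasLifts hk hγ p (hp.trans γ.extend_a.symm)

theorem Connection.proj_transport (A : B.Connection) (hk : 1 ≤ k) (hγ : γ.IsPath IM k) {p : P}
    (hp : B.proj p = γ.startPoint) : B.proj (A.transport γ p) = γ.endPoint := by
  obtain ⟨c, hc, rfl⟩ := A.exists_liftOn hk hγ hp
  rw [hc.transport_eq, ← γ.extend_b]
  exact hc.1 (right_mem_Icc.2 γ.lt.le)

theorem Connection.transport_act (A : B.Connection) (hk : 1 ≤ k) (hγ : γ.IsPath IM k) {p : P}
    (hp : B.proj p = γ.startPoint) (s : S) :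
    A.transport γ (B.act p s) = B.act (A.transport γ p) s := by
  obtain ⟨c, hc, rfl⟩ := A.exists_liftOn hk hγ hp
  rw [hc.transport_eq]
  exact (hc.act s).transport_eq

theorem Connection.transport_inv_transport (A : B.Connection) (hk : 1 ≤ k) (hγ : γ.IsPath IM k)
    {p : P} (hp : B.proj p = γ.startPoint) : A.transport γ.inv (A.transport γ p) = p := by
  obtain ⟨c, hc, rfl⟩ := A.exists_liftOn hk hγ hp
  rw [hc.transport_eq, hc.transport_inv]

/-- Naturality of the parallel transport under automorphisms. -/
theorem AutAction.transport_onConnection {EG HG : Type*} [NormedAddCommGroup EG]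
    [NormedSpace ℝ EG] [TopologicalSpace HG] {IG : ModelWithCorners ℝ EG HG} {G : Type*}
    [TopologicalSpace G] [ChartedSpace HG G] [Group G] (Θ : B.AutAction IG G) (g : G)
    (A : B.Connection) (hk : 1 ≤ k) (hγ : γ.IsPath IM k) {p : P}
    (hp : B.proj p = γ.startPoint) :
    (Θ.onConnection g A).transport (γ.map (Θ.base g)) (Θ.θ g p) = Θ.θ g (A.transport γ p) := by
  obtain ⟨c, hc, rfl⟩ := A.exists_liftOn hk hγ hp
  rw [hc.transport_eq, Θ.transport_onConnection_of_liftOn g hc]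

end Exists

end PrincipalBundle

end Bundle

/-! ### The spectrum and its dense subset of evaluations -/

/-- The evaluations are dense in the spectrum of a `C^*`-algebra of bounded functions: a continuous
function on the spectrum is a Gelfand transform, and if it vanishes on the evaluations, it is the
Gelfand transform of zero. -/
theorem denseRange_of_eval {X : Type*} [TopologicalSpace X] (C : StarSubalgebra ℂ (X →ᵇ ℂ))
    [IsClosed (C : Set (X →ᵇ ℂ))] (ι : X → WeakDual.characterSpace ℂ C)
    (hι : ∀ x (f : C), ι x f = (f : X →ᵇ ℂ) x) : DenseRange ι := by
  intro χ
  by_contra hχ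
  obtain ⟨u, hu0, hu1, -⟩ := exists_continuous_zero_one_of_isClosed
    (isClosed_closure (s := range ι)) (isClosed_singleton (x := χ))
    (disjoint_singleton_right.2 hχ)
  obtain ⟨f, hf⟩ := (gelfandTransform_bijective C).2
    ((⟨Complex.ofReal, Complex.continuous_ofReal⟩ : C(ℝ, ℂ)).comp u)
  have hval : ∀ ψ : WeakDual.characterSpace ℂ C, ψ f = u ψ := fun ψ =>
    congrArg (fun F : C(WeakDual.characterSpace ℂ C, ℂ) => F ψ) hf
  have hf0 : f = 0 := by
    ext x
    rw [← hι, hval, hu0 (subset_closure (mem_range_self x))]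
    simp
  have h1 := hval χ
  rw [hu1 rfl, hf0, map_zero] at h1
  simp at h1

/-- Convergence in the spectrum is pointwise convergence. -/
theorem WeakDual.CharacterSpace.tendsto_iff {A X : Type*} [CommCStarAlgebra A] {l : Filter X}
    {u : X → WeakDual.characterSpace ℂ A} {χ : WeakDual.characterSpace ℂ A} :
    Tendsto u l (𝓝 χ) ↔ ∀ f, Tendsto (fun x => u x f) l (𝓝 (χ f)) := by
  rw [tendsto_subtype_rng]
  exact WeakBilin.tendsto_iff_forall_eval_tendsto _ ContinuousLinearMap.coe_injective

/-- The topology of a compact group is determined by its irreducible representations. -/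
theorem IrrepMatrix.tendsto_of_forall {S X : Type*} [TopologicalSpace S] [Group S]
    [IsTopologicalGroup S] [CompactSpace S] [T2Space S] [SecondCountableTopology S] {l : Filter X}
    {u : X → S} {s : S} (h : ∀ (n : ℕ) (r : IrrepMatrix S n) (i j : Fin n),
      Tendsto (fun x => r.ρ (u x) i j) l (𝓝 (r.ρ s i j))) : Tendsto u l (𝓝 s) := by
  rw [tendsto_iff_ultrafilter]
  intro g hg
  have hlim := (g.map u).le_nhds_lim
  suffices (g.map u).lim = s by
    rw [← this]
    exact hlim
  by_contra hne
  have hne1 : (g.map u).lim * s⁻¹ ≠ 1 := fun h => hne (mul_inv_eq_one.1 h)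
  obtain ⟨n, r, hr⟩ := IrrepMatrix.exists_apply_ne_one hne1
  refine hr ?_
  have h1 : r.ρ (g.map u).lim = r.ρ s := by
    ext i j
    have hc : Continuous fun s => r.ρ s i j := r.continuous.matrix_elem i j
    exact tendsto_nhds_unique ((hc.tendsto _).comp hlim) ((h n r i j).mono_left hg)
  rw [map_mul, h1, ← map_mul, mul_inv_cancel, map_one]

section Bundle

variable {EP HP EM HM ES HS : Type*}
  [NormedAddCommGroup EP] [NormedSpace ℝ EP] [TopologicalSpace HP]
  [NormedAddCommGroup EM] [NormedSpace ℝ EM] [TopologicalSpace HM]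
  [NormedAddCommGroup ES] [NormedSpace ℝ ES] [TopologicalSpace HS]
  {IP : ModelWithCorners ℝ EP HP} {IM : ModelWithCorners ℝ EM HM}
  {IS : ModelWithCorners ℝ ES HS} {P M S : Type*}
  [TopologicalSpace P] [ChartedSpace HP P] [TopologicalSpace M] [ChartedSpace HM M]
  [TopologicalSpace S] [ChartedSpace HS S] [Group S]
  {B : PrincipalBundle IP IM IS P M S}

namespace PrincipalBundle

/-! ### Homomorphisms of paths as functions on the bundle -/

/-- `h(γ)(p)`, without the proofs that `γ ∈ Γ` and `p ∈ F_{γ(a)}`; the value is `p` if one of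
them fails. -/
noncomputable def PathHom.apply [IsManifold IP ∞ P] {Γ : Set (Curve M)} (h : B.PathHom Γ)
    (γ : Curve M) (p : P) : P :=
  open Classical in
  if H : γ ∈ Γ ∧ B.proj p = γ.startPoint then (h.toFun γ H.1).toFun ⟨p, H.2⟩ else p

section PathHom

variable [IsManifold IP ∞ P] {Γ : Set (Curve M)} (h : B.PathHom Γ) {γ : Curve M} (hγ : γ ∈ Γ)
  {p : P} (hp : B.proj p = γ.startPoint)

include hγ hp

theorem PathHom.apply_eq : h.apply γ p = (h.toFun γ hγ).toFun ⟨p, hp⟩ := dif_pos ⟨hγ, hp⟩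

theorem PathHom.proj_apply : B.proj (h.apply γ p) = γ.endPoint := by
  rw [h.apply_eq hγ hp]
  exact ((h.toFun γ hγ).toFun ⟨p, hp⟩).2

theorem PathHom.apply_act (s : S) : h.apply γ (B.act p s) = B.act (h.apply γ p) s := by
  rw [h.apply_eq hγ ((B.proj_act p s).trans hp), h.apply_eq hγ hp]
  exact (h.toFun γ hγ).map_act ⟨p, hp⟩ s

theorem PathHom.apply_inv_apply (hi : γ.inv ∈ Γ) : h.apply γ.inv (h.apply γ p) = p := by
  rw [h.apply_eq hi ((h.proj_apply hγ hp).trans γ.startPoint_inv.symm)]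
  simp only [h.apply_eq hγ hp]
  exact h.map_inv γ hγ hi ⟨p, hp⟩

theorem PathHom.apply_equivalent {γ' : Curve M} (hγ' : γ' ∈ Γ) (he : B.Equivalent γ γ') :
    h.apply γ p = h.apply γ' p := by
  rw [h.apply_eq hγ hp, h.apply_eq hγ' (hp.trans he.1)]
  exact h.map_equivalent γ γ' hγ hγ' he ⟨p, hp⟩

end PathHom

theorem PathHom.apply_decomposition [IsManifold IP ∞ P] {Γ : Set (Curve M)} (h : B.PathHom Γ)
    {γ : Curve M} (hγ : γ ∈ Γ)
    (D : γ.Subdivision) (hD : ∀ i, γ.piece D i ∈ Γ) (q : Fin (D.n + 1) → P)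
    (h0 : B.proj (q 0) = γ.startPoint)
    (hq : ∀ i : Fin D.n, B.proj (q i.castSucc) = (γ.piece D i).startPoint ∧
      h.apply (γ.piece D i) (q i.castSucc) = q i.succ) :
    h.apply γ (q 0) = q (Fin.last D.n) := by
  rw [h.apply_eq hγ h0]
  exact h.map_decomposition γ hγ D hD q h0 fun i =>
    ⟨(hq i).1, (h.apply_eq (hD i) (hq i).1).symm.trans (hq i).2⟩

variable [IsManifold IP ∞ P]

/-! ### Cylindrical functions -/

variable [CompactSpace S]

/-- The cylindrical function `A ↦ ρᵢⱼ(h_γ^ν(A))`. -/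
noncomputable def cylGenerator (B : PrincipalBundle IP IM IS P M S) (ν : M → P) (γ : Curve M)
    {n : ℕ} (r : IrrepMatrix S n) (i j : Fin n) : B.Connection →ᵇ ℂ :=
  BoundedContinuousFunction.compContinuous
    (BoundedContinuousFunction.mkOfCompact ⟨fun s => r.ρ s i j, r.continuous.matrix_elem i j⟩)
    ⟨B.holonomy ν γ, continuous_of_discreteTopology⟩

theorem cylGenerator_apply (ν : M → P) (γ : Curve M) {n : ℕ} (r : IrrepMatrix S n) (i j : Fin n)
    (A : B.Connection) : B.cylGenerator ν γ r i j A = r.ρ (B.holonomy ν γ A) i j := rfl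

omit [CompactSpace S] in
theorem isClosed_Cyl (B : PrincipalBundle IP IM IS P M S) (ν : M → P) (Γ : Set (Curve M)) :
    IsClosed (B.Cyl ν Γ : Set (B.Connection →ᵇ ℂ)) :=
  StarSubalgebra.isClosed_topologicalClosure _

omit [CompactSpace S] in
theorem cylGenerators_subset (B : PrincipalBundle IP IM IS P M S) (ν : M → P) (Γ : Set (Curve M)) :
    B.cylGenerators ν Γ ⊆ B.Cyl ν Γ :=
  (StarAlgebra.subset_adjoin ℂ _).trans (StarSubalgebra.le_topologicalClosure _)

theorem cylGenerator_mem (ν : M → P) {Γ : Set (Curve M)} {γ : Curve M} (hγ : γ ∈ Γ) {n : ℕ}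
    (r : IrrepMatrix S n) (i j : Fin n) : B.cylGenerator ν γ r i j ∈ B.Cyl ν Γ :=
  B.cylGenerators_subset ν Γ ⟨γ, hγ, n, r, i, j, fun _ => rfl⟩

omit [CompactSpace S] in
/-- Each generalized connection is a limit of connections. -/
theorem comap_evalChar_neBot {ν : M → P} {Γ : Set (Curve M)} (χ : B.GenConnection ν Γ) :
    (comap (B.evalChar ν Γ) (𝓝 χ)).NeBot := by
  have := B.isClosed_Cyl ν Γ
  rw [comap_neBot_iff]
  intro t ht
  obtain ⟨A, hA⟩ := (denseRange_of_eval (B.Cyl ν Γ) (B.evalChar ν Γ) fun _ _ => rfl).exists_mem_open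
    isOpen_interior ⟨χ, mem_interior_iff_mem_nhds.2 ht⟩
  exact ⟨A, interior_subset hA⟩

omit [CompactSpace S] in
theorem tendsto_evalChar_iff {X : Type*} {l : Filter X} {ν : M → P} {Γ : Set (Curve M)}
    {χ : B.GenConnection ν Γ} {u : X → B.Connection} :
    Tendsto (fun x => B.evalChar ν Γ (u x)) l (𝓝 χ) ↔
      ∀ f : B.Cyl ν Γ, Tendsto (fun x => (f : B.Connection →ᵇ ℂ) (u x)) l (𝓝 (χ f)) := by
  have := B.isClosed_Cyl ν Γ
  exact WeakDual.CharacterSpace.tendsto_iff (A := B.Cyl ν Γ)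

omit [CompactSpace S] in
/-- Each ultrafilter of connections converges to a generalized connection. -/
theorem exists_tendsto_evalChar (ν : M → P) (Γ : Set (Curve M)) (U : Ultrafilter B.Connection) :
    ∃ χ : B.GenConnection ν Γ, ∀ f : B.Cyl ν Γ,
      Tendsto (f : B.Connection →ᵇ ℂ) U (𝓝 (χ f)) := by
  have := B.isClosed_Cyl ν Γ
  have : CompactSpace (WeakDual.characterSpace ℂ (B.Cyl ν Γ)) := inferInstance
  have hlim := (U.map (B.evalChar ν Γ)).le_nhds_lim
  exact ⟨_, tendsto_evalChar_iff.1 hlim⟩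

omit [CompactSpace S] in
/-- Star homomorphisms on the cylindrical functions are determined by the generators. -/
theorem Cyl_ext {ν : M → P} {Γ : Set (Curve M)} {φ ψ : B.Cyl ν Γ →⋆ₐ[ℂ] ℂ} (hφ : Continuous φ)
    (hψ : Continuous ψ)
    (h : ∀ f (hf : f ∈ B.cylGenerators ν Γ), φ ⟨f, B.cylGenerators_subset ν Γ hf⟩ =
      ψ ⟨f, B.cylGenerators_subset ν Γ hf⟩) : φ = ψ := by
  refine StarAlgHom.ext_topologicalClosure hφ hψ ?_
  refine StarAlgHom.ext_adjoin fun x hx => ?_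
  exact h x hx

end PrincipalBundle

end Bundle

section Bundle

variable {EP HP EM HM ES HS : Type*}
  [NormedAddCommGroup EP] [NormedSpace ℝ EP] [TopologicalSpace HP]
  [NormedAddCommGroup EM] [NormedSpace ℝ EM] [TopologicalSpace HM]
  [NormedAddCommGroup ES] [NormedSpace ℝ ES] [TopologicalSpace HS]
  {IP : ModelWithCorners ℝ EP HP} {IM : ModelWithCorners ℝ EM HM}
  {IS : ModelWithCorners ℝ ES HS} {P M S : Type*}
  [TopologicalSpace P] [ChartedSpace HP P] [TopologicalSpace M] [ChartedSpace HM M]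
  [TopologicalSpace S] [ChartedSpace HS S] [Group S]
  {B : PrincipalBundle IP IM IS P M S}

namespace PrincipalBundle

variable [IsManifold IP ∞ P] [FiniteDimensional ℝ ES] [IS.Boundaryless] [LieGroup IS ∞ S]
  {ν : M → P} {k : ℕ∞ω} {Γ : Set (Curve M)}

/-! ### Surjectivity of `κ` -/

theorem act_holonomy (hν : ∀ m, B.proj (ν m) = m) (hk : 1 ≤ k) {γ : Curve M}
    (hγ : γ.IsPath IM k) (A : B.Connection) :
    B.act (ν γ.endPoint) (B.holonomy ν γ A) = A.transport γ (ν γ.startPoint) :=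
  act_diff ((hν _).trans (A.proj_transport hk hγ (hν _)).symm)

theorem transport_eq_act (hν : ∀ m, B.proj (ν m) = m) (hk : 1 ≤ k) {γ : Curve M}
    (hγ : γ.IsPath IM k) (A : B.Connection) {p : P} (hp : B.proj p = γ.startPoint) :
    A.transport γ p =
      B.act (ν γ.endPoint) (B.holonomy ν γ A * B.diff (ν γ.startPoint) p) := by
  have h1 : B.act (ν γ.startPoint) (B.diff (ν γ.startPoint) p) = p :=
    act_diff ((hν _).trans hp.symm)
  conv_lhs => rw [← h1]
  rw [A.transport_act hk hγ (hν _), ← act_holonomy hν hk hγ, B.act_mul]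

/-- The analogue of `h_γ^ν(A)` for a homomorphism of paths `h`: the `s ∈ S` with
`h(γ)(ν_{γ(a)}) = ν_{γ(b)} · s`. -/
noncomputable def PathHom.holonomy (h : B.PathHom Γ) (ν : M → P) (γ : Curve M) : S :=
  B.diff (ν γ.endPoint) (h.apply γ (ν γ.startPoint))

omit [FiniteDimensional ℝ ES] [IS.Boundaryless] [LieGroup IS ∞ S] in
theorem PathHom.act_holonomy (h : B.PathHom Γ) (hν : ∀ m, B.proj (ν m) = m) {γ : Curve M}
    (hγ : γ ∈ Γ) : B.act (ν γ.endPoint) (h.holonomy ν γ) = h.apply γ (ν γ.startPoint) :=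
  act_diff ((hν _).trans (h.proj_apply hγ (hν _)).symm)

omit [FiniteDimensional ℝ ES] [IS.Boundaryless] [LieGroup IS ∞ S] in
theorem PathHom.apply_eq_act (h : B.PathHom Γ) (hν : ∀ m, B.proj (ν m) = m) {γ : Curve M}
    (hγ : γ ∈ Γ) {p : P} (hp : B.proj p = γ.startPoint) :
    h.apply γ p = B.act (ν γ.endPoint) (h.holonomy ν γ * B.diff (ν γ.startPoint) p) := by
  have h1 : B.act (ν γ.startPoint) (B.diff (ν γ.startPoint) p) = p :=
    act_diff ((hν _).trans hp.symm)
  conv_lhs => rw [← h1]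
  rw [h.apply_act hγ (hν _), ← h.act_holonomy hν hγ, B.act_mul]

/-- The connection `A` has the parallel transport `h(γ)` along `γ`. -/
def PathHom.Agrees (h : B.PathHom Γ) (A : B.Connection) (γ : Curve M) : Prop :=
  ∀ p, B.proj p = γ.startPoint → A.transport γ p = h.apply γ p

/-- Morphisms between fibres are determined by their values at one point. -/
theorem PathHom.agrees_of_holonomy_eq (h : B.PathHom Γ) (hν : ∀ m, B.proj (ν m) = m) (hk : 1 ≤ k)
    {γ : Curve M} (hγ : γ ∈ Γ) (hγk : γ.IsPath IM k) {A : B.Connection}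
    (hA : B.holonomy ν γ A = h.holonomy ν γ) : h.Agrees A γ := fun p hp => by
  rw [transport_eq_act hν hk hγk A hp, hA, ← h.apply_eq_act hν hγ hp]

theorem PathHom.Agrees.inv {h : B.PathHom Γ} {A : B.Connection} {γ : Curve M}
    (hA : h.Agrees A γ) (hν : ∀ m, B.proj (ν m) = m) (hk : 1 ≤ k) (hγ : γ ∈ Γ)
    (hγi : γ.inv ∈ Γ) (hγk : γ.IsPath IM k) : h.Agrees A γ.inv := fun p hp => by
  rw [Curve.startPoint_inv] at hp
  -- `p` is the image of a point `q` under the transport along `γ`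
  have h1 : B.proj (A.transport γ (ν γ.startPoint)) = B.proj p :=
    (A.proj_transport hk hγk (hν _)).trans hp.symm
  have hq : B.proj (B.act (ν γ.startPoint) (B.diff (A.transport γ (ν γ.startPoint)) p)) =
      γ.startPoint := (B.proj_act _ _).trans (hν _)
  have h2 := A.transport_act hk hγk (hν γ.startPoint)
    (B.diff (A.transport γ (ν γ.startPoint)) p)
  rw [act_diff h1] at h2
  generalize B.act (ν γ.startPoint) (B.diff (A.transport γ (ν γ.startPoint)) p) = q at h2 hq
  subst h2
  rw [A.transport_inv_transport hk hγk hq, hA q hq, h.apply_inv_apply hγ hq hγi]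

/-- By independence, each homomorphism of paths is on finitely many paths the parallel transport of
a connection. -/
theorem PathHom.exists_agrees (h : B.PathHom Γ) (hν : ∀ m, B.proj (ν m) = m) (hk : 1 ≤ k)
    (hΓ : ∀ γ ∈ Γ, γ.IsPath IM k) (hst : Curve.IsStable Γ) (hind : B.IsIndependent ν Γ)
    (s : Finset (Curve M)) (hs : (s : Set (Curve M)) ⊆ Γ) :
    ∃ A : B.Connection, ∀ γ ∈ s, h.Agrees A γ := by
  obtain ⟨t, ht, href, hfam⟩ := hind s hs
  obtain ⟨A, hA⟩ := hfam (h.holonomy ν)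
  have hδ : ∀ δ ∈ t, h.Agrees A δ := fun δ hδ =>
    h.agrees_of_holonomy_eq hν hk (ht hδ) (hΓ δ (ht hδ)) (hA δ hδ)
  refine ⟨A, fun γ hγs p hp => ?_⟩
  have hγ : γ ∈ Γ := hs hγs
  obtain ⟨D, hD⟩ := href γ hγs
  have hDΓ : ∀ i, γ.piece D i ∈ Γ := hst.2 γ hγ D
  have hpiece : ∀ i, h.Agrees A (γ.piece D i) := by
    intro i p hp
    have hpΓ := hDΓ i
    obtain ⟨δ, hδt, he⟩ := hD i
    have hδΓ : δ ∈ Γ := ht hδt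
    rcases he with he | he
    · rw [he.2.2 A p hp, h.apply_equivalent hpΓ hp hδΓ he]
      exact hδ δ hδt p (hp.trans he.1)
    · have hδi := hst.1 δ hδΓ
      rw [he.2.2 A p hp, h.apply_equivalent hpΓ hp hδi he]
      exact (hδ δ hδt).inv hν hk hδΓ hδi (hΓ δ hδΓ) p (hp.trans he.1)
  obtain ⟨c, hc, rfl⟩ := A.exists_liftOn hk (hΓ γ hγ) hp
  have hproj : ∀ i, B.proj (c (D.τ i)) = γ.extend (D.τ i) := fun i => hc.1 ⟨D.a_le i, D.le_b i⟩
  have h1 := h.apply_decomposition hγ D hDΓ (fun i => c (D.τ i)) (by rw [D.first]; exact hp)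
    fun i => by
      have hi : B.proj (c (D.τ i.castSucc)) = (γ.piece D i).startPoint := by
        rw [hproj, Curve.startPoint_piece]
      exact ⟨hi, (hpiece i _ hi).symm.trans (hc.transport_piece D i)⟩
  simp only [D.first, D.last] at h1
  rw [hc.transport_eq, h1]

variable [CompactSpace S]

/-- By compactness of the spectrum, there is a generalized connection with the values that `h`
prescribes on the generators. -/
theorem PathHom.exists_genConnection (h : B.PathHom Γ) (hν : ∀ m, B.proj (ν m) = m) (hk : 1 ≤ k)
    (hΓ : ∀ γ ∈ Γ, γ.IsPath IM k) (hst : Curve.IsStable Γ) (hind : B.IsIndependent ν Γ) :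
    ∃ χ : B.GenConnection ν Γ, ∀ (γ) (hγ : γ ∈ Γ) (n : ℕ) (r : IrrepMatrix S n) (i j : Fin n),
      χ ⟨B.cylGenerator ν γ r i j, cylGenerator_mem ν hγ r i j⟩ = r.ρ (h.holonomy ν γ) i j := by
  classical
  obtain ⟨U, hU⟩ := Ultrafilter.exists_ultrafilter_of_finite_inter_nonempty
    ((fun γ => {A : B.Connection | h.Agrees A γ}) '' Γ) (fun T hT => by
      obtain ⟨s, hs, rfl⟩ := Finset.subset_set_image_iff.1 hT
      obtain ⟨A, hA⟩ := h.exists_agrees hν hk hΓ hst hind s hs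
      refine ⟨A, ?_⟩
      rintro _ hγ
      obtain ⟨γ, hγs, rfl⟩ := Finset.mem_image.1 (Finset.mem_coe.1 hγ)
      exact hA γ hγs)
  obtain ⟨χ, hχ⟩ := exists_tendsto_evalChar ν Γ U
  refine ⟨χ, fun γ hγ n r i j => ?_⟩
  refine tendsto_nhds_unique (hχ ⟨B.cylGenerator ν γ r i j, cylGenerator_mem ν hγ r i j⟩) ?_
  refine tendsto_const_nhds.congr' ?_
  filter_upwards [hU ⟨γ, hγ, rfl⟩] with A hA
  change _ = r.ρ (B.holonomy ν γ A) i j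
  rw [PrincipalBundle.holonomy, hA _ (hν _)]
  rfl

variable [T2Space S]

/-- A generalized connection with the right values on the generators corresponds to `h` under `κ`,
since the irreducible representations of `S` determine its topology. -/
theorem PathHom.isKappa (h : B.PathHom Γ) (hν : ∀ m, B.proj (ν m) = m) (hk : 1 ≤ k)
    (hΓ : ∀ γ ∈ Γ, γ.IsPath IM k) {χ : B.GenConnection ν Γ}
    (hχ : ∀ (γ) (hγ : γ ∈ Γ) (n : ℕ) (r : IrrepMatrix S n) (i j : Fin n),
      χ ⟨B.cylGenerator ν γ r i j, cylGenerator_mem ν hγ r i j⟩ = r.ρ (h.holonomy ν γ) i j) :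
    IsKappa χ h := by
  have := topologicalGroup_of_lieGroup IS ∞ (G := S)
  have := FiniteDimensional.proper_real ES
  have := IS.secondCountableTopology
  have := ChartedSpace.secondCountable_of_sigmaCompact HS S
  intro γ hγ p
  have h1 : Tendsto (B.holonomy ν γ) (comap (B.evalChar ν Γ) (𝓝 χ)) (𝓝 (h.holonomy ν γ)) := by
    refine IrrepMatrix.tendsto_of_forall fun n r i j => ?_
    rw [← hχ γ hγ n r i j]
    exact (tendsto_evalChar_iff (u := fun A => A)).1 tendsto_comap
      ⟨B.cylGenerator ν γ r i j, cylGenerator_mem ν hγ r i j⟩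
  have h2 : Continuous fun s => B.act (ν γ.endPoint) (s * B.diff (ν γ.startPoint) p) :=
    B.contMDiff_act.continuous.comp
      (continuous_const.prodMk (continuous_mul_const (B.diff (ν γ.startPoint) (p : P))))
  have h3 := (h2.tendsto _).comp h1
  rw [← h.apply_eq_act hν hγ p.2, h.apply_eq hγ p.2] at h3
  refine h3.congr fun A => ?_
  exact (transport_eq_act hν hk (hΓ γ hγ) A p.2).symm

end PrincipalBundle

end Bundle

section Bundle

variable {EP HP EM HM ES HS : Type*}
  [NormedAddCommGroup EP] [NormedSpace ℝ EP] [TopologicalSpace HP]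
  [NormedAddCommGroup EM] [NormedSpace ℝ EM] [TopologicalSpace HM]
  [NormedAddCommGroup ES] [NormedSpace ℝ ES] [TopologicalSpace HS]
  {IP : ModelWithCorners ℝ EP HP} {IM : ModelWithCorners ℝ EM HM}
  {IS : ModelWithCorners ℝ ES HS} {P M S : Type*}
  [TopologicalSpace P] [ChartedSpace HP P] [TopologicalSpace M] [ChartedSpace HM M]
  [TopologicalSpace S] [ChartedSpace HS S] [Group S]
  {B : PrincipalBundle IP IM IS P M S}
  {EG HG : Type*} [NormedAddCommGroup EG] [NormedSpace ℝ EG] [TopologicalSpace HG]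
  {IG : ModelWithCorners ℝ EG HG} {G : Type*} [TopologicalSpace G] [ChartedSpace HG G]
  [Group G]

/-! ### Invariant generalized connections -/

theorem IrrepMatrix.apply_mul_mul {n : ℕ} (r : IrrepMatrix S n) (a s b : S) (i j : Fin n) :
    r.ρ (a * s * b) i j = ∑ k, ∑ l, (r.ρ a i k * r.ρ b l j) * r.ρ s k l := by
  rw [map_mul, map_mul, Matrix.mul_apply]
  simp only [Matrix.mul_apply, Finset.sum_mul]
  rw [Finset.sum_comm]
  exact Finset.sum_congr rfl fun k _ => Finset.sum_congr rfl fun l _ => by ring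

namespace PrincipalBundle

namespace AutAction

variable (Θ : B.AutAction IG G)

theorem base_base_inv (g : G) (m : M) : Θ.base g (Θ.base g⁻¹ m) = m := by
  obtain ⟨p, rfl⟩ := B.proj_surjective m
  rw [← Θ.proj_θ, ← Θ.proj_θ, Θ.θ_θ_inv]

theorem map_base_base_inv (g : G) (γ : Curve M) :
    (γ.map (Θ.base g⁻¹)).map (Θ.base g) = γ :=
  Curve.ext rfl rfl (heq_of_eq (funext fun _ => Θ.base_base_inv g _))

/-- The `s ∈ S` with `θ(g, ν_m) = ν_{g·m} · s`. -/
noncomputable def twist (ν : M → P) (g : G) (m : M) : S := B.diff (ν (Θ.base g m)) (Θ.θ g (ν m))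

variable {ν : M → P} {k : ℕ∞ω} {Γ : Set (Curve M)}

theorem act_twist (hν : ∀ m, B.proj (ν m) = m) (g : G) (m : M) :
    B.act (ν (Θ.base g m)) (Θ.twist ν g m) = Θ.θ g (ν m) :=
  act_diff (by rw [hν, Θ.proj_θ, hν])

variable [IsManifold IP ∞ P]

/-- The homomorphism of paths `h` is equivariant: `h(gγ)(gp) = θ(g, h(γ)(p))`. -/
def IsEquivariantHom (h : B.PathHom Γ) : Prop :=
  ∀ (g : G), ∀ γ ∈ Γ, ∀ p, B.proj p = γ.startPoint →
    h.apply (γ.map (Θ.base g)) (Θ.θ g p) = Θ.θ g (h.apply γ p)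

variable {Θ} in
/-- The relation between the group elements that describe an equivariant homomorphism of paths along
`γ` and `gγ`. -/
theorem IsEquivariantHom.holonomy_map {h : B.PathHom Γ} (hh : Θ.IsEquivariantHom h)
    (hν : ∀ m, B.proj (ν m) = m) (hG : Θ.IsInvariantPaths Γ) (g : G) {γ : Curve M} (hγ : γ ∈ Γ) :
    h.holonomy ν (γ.map (Θ.base g)) =
      Θ.twist ν g γ.endPoint * h.holonomy ν γ * (Θ.twist ν g γ.startPoint)⁻¹ := by
  rw [eq_mul_inv_iff_mul_eq]
  have h1 := hh g γ hγ _ (hν _)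
  rw [← Θ.act_twist hν, h.apply_act (hG g γ hγ) (p := ν (Θ.base g γ.startPoint)) (hν _),
    ← h.act_holonomy hν hγ, Θ.θ_act,
    ← Θ.act_twist hν, ← B.act_mul] at h1
  have h2 := h.act_holonomy hν (hG g γ hγ)
  rw [Curve.startPoint_map, Curve.endPoint_map] at h2
  rw [← h2, ← B.act_mul] at h1
  exact act_right_cancel h1

variable [FiniteDimensional ℝ ES] [IS.Boundaryless] [LieGroup IS ∞ S]

/-- The same relation between `A` along `γ` and `φ(g, A)` along `gγ`. -/
theorem holonomy_map (hν : ∀ m, B.proj (ν m) = m) (hk : 1 ≤ k) (g : G) (A : B.Connection)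
    {γ : Curve M} (hγ : γ.IsPath IM k) (hgγ : (γ.map (Θ.base g)).IsPath IM k) :
    B.holonomy ν (γ.map (Θ.base g)) (Θ.onConnection g A) =
      Θ.twist ν g γ.endPoint * B.holonomy ν γ A * (Θ.twist ν g γ.startPoint)⁻¹ := by
  rw [eq_mul_inv_iff_mul_eq]
  have h1 := transport_onConnection Θ g A hk hγ (hν γ.startPoint)
  rw [← Θ.act_twist hν, Connection.transport_act _ hk hgγ (p := ν (Θ.base g γ.startPoint)) (hν _),
    ← act_holonomy hν hk hγ, Θ.θ_act,
    ← Θ.act_twist hν, ← B.act_mul] at h1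
  have h2 := act_holonomy hν hk hgγ (Θ.onConnection g A)
  rw [Curve.startPoint_map, Curve.endPoint_map] at h2
  rw [← h2, ← B.act_mul] at h1
  exact act_right_cancel h1

/-- `φ_g^*` as a homomorphism of `C^*`-algebras. -/
noncomputable def pullbackHom (g : G) : (B.Connection →ᵇ ℂ) →⋆ₐ[ℂ] (B.Connection →ᵇ ℂ) where
  toFun := Θ.pullback g
  map_one' := rfl
  map_mul' _ _ := rfl
  map_zero' := rfl
  map_add' _ _ := rfl
  commutes' _ := rfl
  map_star' _ := rfl

omit [FiniteDimensional ℝ ES] [IS.Boundaryless] [LieGroup IS ∞ S] in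
theorem continuous_pullbackHom (g : G) : Continuous (Θ.pullbackHom g) :=
  BoundedContinuousFunction.continuous_compContinuous _

variable [CompactSpace S]

/-- `φ_g^*(ρᵢⱼ ∘ h_γ)` is a linear combination of the matrix entries of `ρ ∘ h_{g⁻¹γ}`. -/
theorem pullback_cylGenerator (hν : ∀ m, B.proj (ν m) = m) (hk : 1 ≤ k)
    (hΓ : ∀ γ ∈ Γ, γ.IsPath IM k) (hG : Θ.IsInvariantPaths Γ) (g : G) {γ : Curve M} (hγ : γ ∈ Γ)
    {n : ℕ} (r : IrrepMatrix S n) (i j : Fin n) :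
    Θ.pullback g (B.cylGenerator ν (γ.map (Θ.base g)) r i j) =
      ∑ k, ∑ l, (r.ρ (Θ.twist ν g γ.endPoint) i k * r.ρ (Θ.twist ν g γ.startPoint)⁻¹ l j) •
        B.cylGenerator ν γ r k l := by
  ext A
  change r.ρ (B.holonomy ν (γ.map (Θ.base g)) (Θ.onConnection g A)) i j = _
  rw [Θ.holonomy_map hν hk g A (hΓ γ hγ) (hΓ _ (hG g γ hγ)), r.apply_mul_mul]
  simp only [BoundedContinuousFunction.coe_sum, Finset.sum_apply,
    BoundedContinuousFunction.coe_smul, smul_eq_mul, cylGenerator_apply]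

/-- `φ_g^*` maps cylindrical functions to cylindrical functions. -/
theorem pullback_mem (hν : ∀ m, B.proj (ν m) = m) (hk : 1 ≤ k)
    (hΓ : ∀ γ ∈ Γ, γ.IsPath IM k) (hG : Θ.IsInvariantPaths Γ) (g : G) {f : B.Connection →ᵇ ℂ}
    (hf : f ∈ B.Cyl ν Γ) : Θ.pullback g f ∈ B.Cyl ν Γ := by
  have h1 : B.Cyl ν Γ ≤ (B.Cyl ν Γ).comap (Θ.pullbackHom g) := by
    refine StarSubalgebra.topologicalClosure_minimal ?_
      ((B.isClosed_Cyl ν Γ).preimage (Θ.continuous_pullbackHom g))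
    refine StarAlgebra.adjoin_le ?_
    rintro f ⟨γ, hγ, n, r, i, j, hf⟩
    have hf' : f = B.cylGenerator ν ((γ.map (Θ.base g⁻¹)).map (Θ.base g)) r i j := by
      rw [Θ.map_base_base_inv]
      exact BoundedContinuousFunction.ext hf
    change Θ.pullback g f ∈ B.Cyl ν Γ
    rw [hf', Θ.pullback_cylGenerator hν hk hΓ hG g (hG g⁻¹ γ hγ)]
    exact sum_mem fun k _ => sum_mem fun l _ =>
      SMulMemClass.smul_mem _ (cylGenerator_mem ν (hG g⁻¹ γ hγ) r k l)
  exact h1 hf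

variable {Θ} in
/-- The generalized connection with the values of an equivariant homomorphism of paths on the
generators is invariant. -/
theorem IsEquivariantHom.isInvariantGen {h : B.PathHom Γ} (hh : Θ.IsEquivariantHom h)
    (hν : ∀ m, B.proj (ν m) = m) (hk : 1 ≤ k) (hΓ : ∀ γ ∈ Γ, γ.IsPath IM k)
    (hG : Θ.IsInvariantPaths Γ) {χ : B.GenConnection ν Γ}
    (hχ : ∀ (γ) (hγ : γ ∈ Γ) (n : ℕ) (r : IrrepMatrix S n) (i j : Fin n),
      χ ⟨B.cylGenerator ν γ r i j, cylGenerator_mem ν hγ r i j⟩ = r.ρ (h.holonomy ν γ) i j) :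
    Θ.IsInvariantGen χ := by
  have := B.isClosed_Cyl ν Γ
  intro g
  refine ⟨fun f hf => Θ.pullback_mem hν hk hΓ hG g hf, fun f => ?_⟩
  let χ' : B.Cyl ν Γ →⋆ₐ[ℂ] ℂ := StarAlgHomClass.toStarAlgHom χ
  have hχ' : Continuous χ' := map_continuous χ
  let ψ : B.Cyl ν Γ →⋆ₐ[ℂ] B.Cyl ν Γ :=
    ((Θ.pullbackHom g).comp (B.Cyl ν Γ).subtype).codRestrict (B.Cyl ν Γ)
      fun f => Θ.pullback_mem hν hk hΓ hG g f.2
  have hψ : Continuous ψ :=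
    ((Θ.continuous_pullbackHom g).comp continuous_subtype_val).subtype_mk _
  -- `χ ∘ φ_g^*` and `χ` are compared on the generators
  suffices H : χ'.comp ψ = χ' from congrArg (fun F : B.Cyl ν Γ →⋆ₐ[ℂ] ℂ => F f) H
  refine Cyl_ext (hχ'.comp hψ) hχ' ?_
  rintro f hf
  have hf' := hf
  obtain ⟨γ, hγ, n, r, i, j, hfA⟩ := hf'
  have hγ' := hG g⁻¹ γ hγ
  have e1 : ψ ⟨f, B.cylGenerators_subset ν Γ hf⟩ = ∑ k, ∑ l,
      (r.ρ (Θ.twist ν g (γ.map (Θ.base g⁻¹)).endPoint) i k *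
        r.ρ (Θ.twist ν g (γ.map (Θ.base g⁻¹)).startPoint)⁻¹ l j) •
        (⟨B.cylGenerator ν (γ.map (Θ.base g⁻¹)) r k l, cylGenerator_mem ν hγ' r k l⟩ :
          B.Cyl ν Γ) := by
    apply Subtype.ext
    have e2 : f = B.cylGenerator ν ((γ.map (Θ.base g⁻¹)).map (Θ.base g)) r i j := by
      rw [Θ.map_base_base_inv]
      exact BoundedContinuousFunction.ext hfA
    push_cast
    rw [← Θ.pullback_cylGenerator hν hk hΓ hG g hγ', ← e2]
    rfl
  have e3 : (⟨f, B.cylGenerators_subset ν Γ hf⟩ : B.Cyl ν Γ) =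
      ⟨B.cylGenerator ν γ r i j, cylGenerator_mem ν hγ r i j⟩ :=
    Subtype.ext (BoundedContinuousFunction.ext hfA)
  change χ' (ψ _) = χ' _
  rw [e1, e3]
  simp only [map_sum, map_smul]
  change ∑ k, ∑ l, _ • χ _ = χ _
  simp only [hχ _ hγ', hχ _ hγ, smul_eq_mul]
  rw [← r.apply_mul_mul, ← hh.holonomy_map hν hG g hγ', Θ.map_base_base_inv]

omit [CompactSpace S] in
/-- The parallel transports of an invariant generalized connection are equivariant, because
`φ(g, ·)` preserves the filter of connections that converge to it. -/
theorem isEquivariantHom_of_isKappa [T2Space P] (hk : 1 ≤ k) (hΓ : ∀ γ ∈ Γ, γ.IsPath IM k)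
    (hG : Θ.IsInvariantPaths Γ) {h : B.PathHom Γ} {χ : B.GenConnection ν Γ}
    (hχ : Θ.IsInvariantGen χ) (hκ : IsKappa χ h) : Θ.IsEquivariantHom h := by
  intro g γ hγ p hp
  have := comap_evalChar_neBot χ
  obtain ⟨hg, hinv⟩ := hχ g
  have h1 : Tendsto (Θ.onConnection g) (comap (B.evalChar ν Γ) (𝓝 χ))
      (comap (B.evalChar ν Γ) (𝓝 χ)) := by
    rw [tendsto_comap_iff]
    refine tendsto_evalChar_iff.2 fun f => ?_
    rw [← hinv f]
    exact (tendsto_evalChar_iff (u := fun A => A)).1 tendsto_comap ⟨Θ.pullback g f, hg f f.2⟩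
  have hp' : B.proj (Θ.θ g p) = (γ.map (Θ.base g)).startPoint :=
    Θ.proj_θ_startPoint g γ ⟨p, hp⟩
  have h2 := (hκ _ (hG g γ hγ) ⟨Θ.θ g p, hp'⟩).comp h1
  have h3 := ((Θ.contMDiff_translation g).continuous.tendsto _).comp (hκ γ hγ ⟨p, hp⟩)
  rw [h.apply_eq hγ hp, h.apply_eq (hG g γ hγ) hp']
  refine tendsto_nhds_unique (h2.congr fun A => ?_) h3
  exact transport_onConnection Θ g A hk (hΓ γ hγ) hp

/-- In a form that does not involve the spectrum, the invariance of `h` is its equivariance. -/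
theorem isInvariantHom_iff_isEquivariantHom [T2Space P] [T2Space S] (hν : ∀ m, B.proj (ν m) = m)
    (hk : 1 ≤ k) (hΓ : ∀ γ ∈ Γ, γ.IsPath IM k) (hst : Curve.IsStable Γ)
    (hG : Θ.IsInvariantPaths Γ) (hind : B.IsIndependent ν Γ) (h : B.PathHom Γ) :
    Θ.IsInvariantHom ν h ↔ Θ.IsEquivariantHom h := by
  refine ⟨fun ⟨χ, hχ, hκ⟩ => Θ.isEquivariantHom_of_isKappa hk hΓ hG hχ hκ, fun hh => ?_⟩
  obtain ⟨χ, hχ⟩ := h.exists_genConnection hν hk hΓ hst hind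
  exact ⟨χ, hh.isInvariantGen hν hk hΓ hG hχ, h.isKappa hν hk hΓ hχ⟩

omit [FiniteDimensional ℝ ES] [IS.Boundaryless] [LieGroup IS ∞ S] [CompactSpace S] in
theorem isEquivariantHom_iff (hG : Θ.IsInvariantPaths Γ) (h : B.PathHom Γ) :
    Θ.IsEquivariantHom h ↔
      ∀ (g : G) (γ : Curve M) (hγ : γ ∈ Γ) (p : B.Fibre γ.startPoint),
        ((h.toFun (γ.map (Θ.base g)) (hG g γ hγ)).toFun
            ⟨Θ.θ g p, Θ.proj_θ_startPoint g γ p⟩ : P) =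
          Θ.θ g ((h.toFun γ hγ).toFun p) := by
  refine forall_congr' fun g => forall_congr' fun γ => forall_congr' fun hγ => ?_
  rw [Subtype.forall]
  refine forall_congr' fun p => forall_congr' fun hp => ?_
  rw [h.apply_eq hγ hp, h.apply_eq (hG g γ hγ) (Θ.proj_θ_startPoint g γ ⟨p, hp⟩)]

end AutAction

end PrincipalBundle

end Bundle

/-! ### Homomorphisms of paths of trivial bundles -/

/-- The solution of the recursion `sᵢ₊₁ = uᵢ sᵢ`. -/
theorem apply_last_eq_prod {S : Type*} [Monoid S] {n : ℕ} {u : Fin n → S} {s : Fin (n + 1) → S}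
    (h : ∀ i : Fin n, s i.succ = u i * s i.castSucc) :
    s (Fin.last n) = (List.ofFn fun i : Fin n => u i.rev).prod * s 0 := by
  induction n with
  | zero => simp
  | succ n ih =>
    have h1 := ih (u := fun i => u i.castSucc) (s := fun i => s i.castSucc)
      fun i => h i.castSucc
    rw [← Fin.succ_last, h, List.ofFn_succ, List.prod_cons, mul_assoc]
    simp only [Fin.rev_succ]
    rw [h1]
    simp [Fin.rev_zero]

namespace Curve

variable {M : Type*}

/-- The subdivision of the domain by its midpoint. -/
noncomputable def midpointSubdivision (γ : Curve M) : γ.Subdivision where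
  n := 2
  τ := ![γ.a, (γ.a + γ.b) / 2, γ.b]
  strictMono := by
    have := γ.lt
    rw [Fin.strictMono_iff_lt_succ]
    intro i
    fin_cases i
    · change γ.a < (γ.a + γ.b) / 2
      linarith
    · change (γ.a + γ.b) / 2 < γ.b
      linarith
  first := rfl
  last := rfl

theorem Subdivision.exists_succ_eq_last {γ : Curve M} (D : γ.Subdivision) :
    ∃ i : Fin D.n, i.succ = Fin.last D.n := by
  have hn : D.n ≠ 0 := by
    intro hn
    have h1 : (0 : Fin (D.n + 1)) = Fin.last D.n := Fin.ext (by simp [hn])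
    exact γ.lt.ne (D.first.symm.trans ((congrArg D.τ h1).trans D.last))
  exact ⟨⟨D.n - 1, by omega⟩, Fin.ext (by simp; omega)⟩

end Curve

section Bundle

variable {EM HM ES HS : Type*}
  [NormedAddCommGroup EM] [NormedSpace ℝ EM] [TopologicalSpace HM]
  [NormedAddCommGroup ES] [NormedSpace ℝ ES] [TopologicalSpace HS]
  {IM : ModelWithCorners ℝ EM HM} {IS : ModelWithCorners ℝ ES HS} {M S : Type*}
  [TopologicalSpace M] [ChartedSpace HM M]
  [TopologicalSpace S] [ChartedSpace HS S] [Group S]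
  [IsManifold IM ∞ M] [LieGroup IS ∞ S] {Γ : Set (Curve M)} {k : ℕ∞ω}

namespace PrincipalBundle

namespace GroupPathHom

theorem toFun_congr (f : GroupPathHom IM IS M S Γ) {γ γ' : Curve M} (h : γ = γ') (hγ : γ ∈ Γ)
    (hγ' : γ' ∈ Γ) : f.toFun γ hγ = f.toFun γ' hγ' := by
  subst h
  rfl

variable [FiniteDimensional ℝ ES]

/-- A constant path is equivalent to its two halves, so that its value is idempotent. -/
theorem toFun_of_isConst (f : GroupPathHom IM IS M S Γ) (hst : Curve.IsStable Γ) {γ : Curve M}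
    (hγ : γ ∈ Γ) (hc : γ.IsConst) : f.toFun γ hγ = 1 := by
  have hD := hst.2 γ hγ γ.midpointSubdivision
  have hp : ∀ i, f.toFun _ (hD i) = f.toFun γ hγ := by
    intro i
    refine f.map_equivalent _ _ _ _ ⟨hc _, (hc _).trans (hc _).symm, fun A p hp => ?_⟩
    have hci : (γ.piece γ.midpointSubdivision i).IsConst := fun t => (hc _).trans (hc _).symm
    rw [A.transport_of_isConst hci hp, A.transport_of_isConst hc (hp.trans (hc _))]
  have h1 := f.map_decomposition γ hγ γ.midpointSubdivision hD
  simp only [hp] at h1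
  have h2 : f.toFun γ hγ = f.toFun γ hγ * (f.toFun γ hγ * 1) := h1
  rw [mul_one] at h2
  exact left_eq_mul.1 h2

/-- The homomorphism of paths `h(γ)(γ(a), s) = (γ(b), f(γ) s)`; it is the preimage of `f` under
`Ω`. -/
noncomputable def toPathHom (f : GroupPathHom IM IS M S Γ) (hst : Curve.IsStable Γ) :
    (trivial IM IS M S).PathHom Γ where
  toFun γ hγ :=
    { toFun := fun p => ⟨(γ.endPoint, f.toFun γ hγ * p.1.2), rfl⟩
      map_act := fun _ _ => Prod.ext rfl (mul_assoc _ _ _).symm }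
  map_const γ hγ hc p := by
    rw [f.toFun_of_isConst hst hγ hc]
    exact Prod.ext ((hc _).trans p.2.symm) (one_mul _)
  map_decomposition γ hγ D hD q h0 hq := by
    refine Prod.ext ?_ ?_
    · obtain ⟨i, hi⟩ := D.exists_succ_eq_last
      obtain ⟨_, h⟩ := hq i
      rw [← hi, ← h]
      change _ = (γ.piece D i).endPoint
      rw [Curve.endPoint_piece, hi, D.last, Curve.extend_b]
    · have h1 := apply_last_eq_prod (u := fun i => f.toFun _ (hD i)) (s := fun i => (q i).2)
        fun i => (congrArg Prod.snd (hq i).2).symm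
      change f.toFun γ hγ * (q 0).2 = (q (Fin.last D.n)).2
      rw [h1, f.map_decomposition γ hγ D hD]
  map_inv γ hγ hi p := by
    refine Prod.ext (γ.endPoint_inv.trans p.2.symm) ?_
    change f.toFun γ.inv hi * (f.toFun γ hγ * p.1.2) = p.1.2
    rw [f.map_inv γ hγ hi, inv_mul_cancel_left]
  map_equivalent γ γ' hγ hγ' h p := by
    refine Prod.ext h.2.1 ?_
    change f.toFun γ hγ * p.1.2 = f.toFun γ' hγ' * p.1.2
    rw [f.map_equivalent γ γ' hγ hγ' h]

theorem toPathHom_apply (f : GroupPathHom IM IS M S Γ) (hst : Curve.IsStable Γ) {γ : Curve M}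
    (hγ : γ ∈ Γ) {p : M × S} (hp : p.1 = γ.startPoint) :
    (f.toPathHom hst).apply γ p = (γ.endPoint, f.toFun γ hγ * p.2) :=
  (f.toPathHom hst).apply_eq hγ hp

/-- A homomorphism of paths is determined by its image under `Ω`. -/
theorem apply_eq_of_omega_eq {f : GroupPathHom IM IS M S Γ} (hst : Curve.IsStable Γ)
    {h : (trivial IM IS M S).PathHom Γ} (hf : ∀ (γ) (hγ : γ ∈ Γ), f.toFun γ hγ = omega h γ hγ)
    {γ : Curve M} (hγ : γ ∈ Γ) {p : M × S} (hp : p.1 = γ.startPoint) :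
    h.apply γ p = (f.toPathHom hst).apply γ p := by
  have h0 : (trivial IM IS M S).proj (γ.startPoint, 1) = γ.startPoint := rfl
  have h1 : p = (trivial IM IS M S).act (γ.startPoint, 1) p.2 :=
    Prod.ext hp (one_mul p.2).symm
  rw [h1, h.apply_act hγ h0, (f.toPathHom hst).apply_act hγ h0]
  congr 1
  rw [f.toPathHom_apply hst hγ rfl, mul_one, hf γ hγ]
  exact Prod.ext (h.proj_apply hγ h0) (by rw [h.apply_eq hγ h0]; rfl)

variable {EG HG : Type*} [NormedAddCommGroup EG] [NormedSpace ℝ EG] [TopologicalSpace HG]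
  {IG : ModelWithCorners ℝ EG HG} {G : Type*} [TopologicalSpace G] [ChartedSpace HG G]
  [Group G]

variable [IS.Boundaryless] in
/-- Under `Ω`, the invariant homomorphisms of paths correspond to the equivariant ones. -/
theorem isInvariantGroupHom_iff [CompactSpace S] [T2Space M] [T2Space S]
    (Θ : (trivial IM IS M S).AutAction IG G) {ν : M → M × S} (hν : ∀ m, (ν m).1 = m) (hk : 1 ≤ k)
    (hΓ : ∀ γ ∈ Γ, γ.IsPath IM k) (hst : Curve.IsStable Γ) (hG : Θ.IsInvariantPaths Γ)
    (hind : (trivial IM IS M S).IsIndependent ν Γ) (f : GroupPathHom IM IS M S Γ) :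
    IsInvariantGroupHom Θ ν f ↔ Θ.IsEquivariantHom (f.toPathHom hst) := by
  constructor
  · rintro ⟨h, hh, hf⟩
    rw [Θ.isInvariantHom_iff_isEquivariantHom hν hk hΓ hst hG hind] at hh
    intro g γ hγ p hp
    have h1 := hh g γ hγ p hp
    rwa [apply_eq_of_omega_eq hst hf hγ hp, apply_eq_of_omega_eq hst hf (hG g γ hγ)
      (Θ.proj_θ_startPoint g γ ⟨p, hp⟩)] at h1
  · intro hf
    exact ⟨f.toPathHom hst,
      (Θ.isInvariantHom_iff_isEquivariantHom hν hk hΓ hst hG hind _).2 hf,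
      fun γ hγ => (mul_one _).symm⟩

end GroupPathHom

end PrincipalBundle

end Bundle

/-! ### The action of `E` on `ℝ³ × SU(2)` -/

/-- For the action of `E`, the equivariance of `(γ(a), s) ↦ (γ(b), f(γ) s)` means that `f` is
equivariant for the conjugation. -/
theorem lqcAction_isEquivariantHom_iff {Γ : Set (Curve R3)} (hst : Curve.IsStable Γ)
    (hE : lqcAction.IsInvariantPaths Γ) (f : PrincipalBundle.GroupPathHom (𝓡 3) (𝓡 3) R3 SU2 Γ) :
    lqcAction.IsEquivariantHom (f.toPathHom hst) ↔
      ∀ (v : R3) (σ : SU2) (γ : Curve R3) (hγ : γ ∈ Γ),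
        f.toFun (γ.map fun x => v + SU2.rot σ x) (lqcAction_mem hE v σ hγ) =
          σ * f.toFun γ hγ * σ⁻¹ := by
  have key : ∀ (v : R3) (σ : SU2) (γ : Curve R3) (hγ : γ ∈ Γ) (p : R3 × SU2)
      (_ : p.1 = γ.startPoint),
      (f.toPathHom hst).apply (γ.map (lqcAction.base (v, σ))) (lqcAction.θ (v, σ) p) =
        lqcAction.θ (v, σ) ((f.toPathHom hst).apply γ p) ↔
      f.toFun (γ.map fun x => v + SU2.rot σ x) (lqcAction_mem hE v σ hγ) * (σ * p.2) =
        σ * (f.toFun γ hγ * p.2) := by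
    intro v σ γ hγ p hp
    rw [f.toPathHom_apply hst (hE (v, σ) γ hγ) (lqcAction.proj_θ_startPoint (v, σ) γ ⟨p, hp⟩),
      f.toPathHom_apply hst hγ hp,
      f.toFun_congr (congrArg γ.map (lqcAction_base v σ)) _ (lqcAction_mem hE v σ hγ)]
    refine Prod.ext_iff.trans (and_iff_right ?_)
    exact congrFun (lqcAction_base v σ) γ.endPoint
  constructor
  · intro h v σ γ hγ
    have h1 := (key v σ γ hγ (γ.startPoint, 1) rfl).1 (h (v, σ) γ hγ _ rfl)
    rw [mul_one, mul_one] at h1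
    rw [← h1, mul_inv_cancel_right]
  · rintro h ⟨v, σ⟩ γ hγ p hp
    refine (key v σ γ hγ p hp).2 ?_
    rw [h, ← mul_assoc, inv_mul_cancel_right, mul_assoc]

theorem mainTheorem6 :
    -- the general case
    (∀ {EP HP EM HM ES HS EG HG : Type*}
      [NormedAddCommGroup EP] [NormedSpace ℝ EP] [FiniteDimensional ℝ EP] [TopologicalSpace HP]
      [NormedAddCommGroup EM] [NormedSpace ℝ EM] [FiniteDimensional ℝ EM] [TopologicalSpace HM]
      [NormedAddCommGroup ES] [NormedSpace ℝ ES] [FiniteDimensional ℝ ES] [TopologicalSpace HS]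
      [NormedAddCommGroup EG] [NormedSpace ℝ EG] [FiniteDimensional ℝ EG] [TopologicalSpace HG]
      (IP : ModelWithCorners ℝ EP HP) [IP.Boundaryless]
      (IM : ModelWithCorners ℝ EM HM) [IM.Boundaryless]
      (IS : ModelWithCorners ℝ ES HS) [IS.Boundaryless]
      (IG : ModelWithCorners ℝ EG HG) [IG.Boundaryless]
      {P M S G : Type*}
      [TopologicalSpace P] [T2Space P] [ChartedSpace HP P] [IsManifold IP ∞ P]
      [TopologicalSpace M] [T2Space M] [ChartedSpace HM M] [IsManifold IM ∞ M]
      [TopologicalSpace S] [T2Space S] [ChartedSpace HS S] [Group S] [LieGroup IS ∞ S]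
      [CompactSpace S]
      [TopologicalSpace G] [T2Space G] [ChartedSpace HG G] [Group G] [LieGroup IG ∞ G]
      (B : PrincipalBundle IP IM IS P M S) (Θ : B.AutAction IG G)
      (ν : M → P) (_ : ∀ m, B.proj (ν m) = m)
      (k : ℕ∞ω) (_ : 1 ≤ k) [IsManifold IM k M]
      (Γ : Set (Curve M)) (_ : ∀ γ ∈ Γ, γ.IsPath IM k) (_ : Curve.IsStable Γ)
      (hG : Θ.IsInvariantPaths Γ) (_ : B.IsIndependent ν Γ)
      (h : B.PathHom Γ),
      Θ.IsInvariantHom ν h ↔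
        ∀ (g : G) (γ : Curve M) (hγ : γ ∈ Γ) (p : B.Fibre γ.startPoint),
          ((h.toFun (γ.map (Θ.base g)) (hG g γ hγ)).toFun
              ⟨Θ.θ g p, Θ.proj_θ_startPoint g γ p⟩ : P) =
            Θ.θ g ((h.toFun γ hγ).toFun p)) ∧
    -- the case of homogeneous isotropic loop quantum cosmology
    (∀ (ν : R3 → R3 × SU2) (_ : ∀ x, lqcBundle.proj (ν x) = x)
      (k : ℕ∞ω) (_ : 1 ≤ k)
      (Γ : Set (Curve R3)) (_ : ∀ γ ∈ Γ, γ.IsPath (𝓡 3) k) (_ : Curve.IsStable Γ)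
      (hE : lqcAction.IsInvariantPaths Γ) (_ : lqcBundle.IsIndependent ν Γ)
      (f : PrincipalBundle.GroupPathHom (𝓡 3) (𝓡 3) R3 SU2 Γ),
      PrincipalBundle.IsInvariantGroupHom lqcAction ν f ↔
        ∀ (v : R3) (σ : SU2) (γ : Curve R3) (hγ : γ ∈ Γ),
          f.toFun (γ.map fun x => v + SU2.rot σ x) (lqcAction_mem hE v σ hγ) =
            σ * f.toFun γ hγ * σ⁻¹) := by
  refine ⟨?_, ?_⟩
  · intro EP HP EM HM ES HS EG HG _ _ _ _ _ _ _ _ _ _ _ _ _ _ _ _ IP _ IM _ IS _ IG _ P M S G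
      _ _ _ _ _ _ _ _ _ _ _ _ _ _ _ _ _ _ _ B Θ ν hν k hk _ Γ hΓ hst hG hind h
    rw [Θ.isInvariantHom_iff_isEquivariantHom hν hk hΓ hst hG hind, Θ.isEquivariantHom_iff hG]
  · intro ν hν k hk Γ hΓ hst hE hind f
    have : LieGroup (𝓡 3) ∞ SU2 := LieGroup.of_le (n := ω) le_top
    have : CompactSpace SU2 := SU2.homeoSphere.symm.compactSpace
    rw [PrincipalBundle.GroupPathHom.isInvariantGroupHom_iff lqcAction hν hk hΓ hst hE hind,
      lqcAction_isEquivariantHom_iff hst hE]
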